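/- All simplicial complexes are finite. For a $d$-dimensional simplicial complex $\Delta$ with $f_i$ faces of dimension $i$, put $g_2(\Delta)=f_1-(d+1)f_0+\binom{d+2}{2}$. A normal $3$-pseudomanifold is a nonempty pure $3$-dimensional simplicial complex in which every triangle lies in exactly two facets, any two facets are joined by a sequence of facets in which consecutive members meet in a triangle, and the link of every vertex and of every edge is connected. It is called $g_2$-minimal if $g_2(\Delta)=g_2(\mathrm{lk}(v,\Delta))$ for some vertex $v$. A vertex $v$ is singular if $|\mathrm{lk}(v,\Delta)|$ is not homeomorphic to the sphere $S^2$, and it has $\mathbb{RP}^2$ singularity if $|\mathrm{lk}(v,\Delta)|\cong\mathbb{RP}^2$. The graph $G(\cdot)$ of a complex is the collection of its faces of dimension at most one. Let $\sigma_1\neq\sigma_2$ be facets of a simplicial complex $\Delta$ with $\sigma_1\cap\sigma_2=\{x,y\}$, $x\ne y$, and let $\psi$ be a bijection from the vertices of $\sigma_1$ to those of $\sigma_2$ with $\psi(x)=x$, $\psi(y)=y$, such that for every other vertex $u$ of $\sigma_1$ every path of length at most two from $u$ to $\psi(u)$ in the graph of $\Delta$ passes through $x$ or $y$. The complex obtained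 by identifying every face $\rho\subseteq\sigma_1$ with $\psi(\rho)\subseteq\sigma_2$ and then removing the identified facet is called an edge folding of $\Delta$ (at the edge $xy$); it is considered up to relabelling of vertices. **Theorem.** Let $\Delta$ be a $g_2$-minimal normal $3$-pseudomanifold and let $t$ be a singular vertex of $\Delta$ such that $G(\Delta)=G(\mathrm{st}(t,\Delta))$. (1) If $\Delta$ has exactly three singular vertices, at least one of which has $\mathbb{RP}^2$ singularity, then $\Delta$ is an edge folding of a $g_2$-minimal normal $3$-pseudomanifold with exactly two singular vertices. (2) If $\Delta$ has exactly four singular vertices, at least two of which have $\mathbb{RP}^2$ singularity, then there are a $g_2$-minimal normal $3$-pseudomanifold $\Delta'$ with exactly two singular vertices and a simplicial complex $\Delta''$ such that $\Delta''$ is an edge folding of $\Delta'$ and $\Delta$ is an edge folding of $\Delta''$. -/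

import Mathlib

noncomputable section

namespace PreAbstractSimplicialComplex

variable {V W : Type*}

/-! Faces are the nonempty simplices, given by their vertex sets. A label `v : V` is a vertex of `K`
when `{v} ∈ K`; labels that are not vertices play no role. -/

/-- The number of `i`-dimensional faces of `K`. -/
def fNum (K : PreAbstractSimplicialComplex V) (i : ℕ) : ℕ :=
  {σ : Finset V | σ ∈ K ∧ σ.card = i + 1}.ncard

/-- The invariant `g₂ = f₁ - (d + 1) f₀ + (d + 2 choose 2)` of a `d`-dimensional complex. -/
def g₂ (d : ℕ) (K : PreAbstractSimplicialComplex V) : ℤ :=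
  (K.fNum 1 : ℤ) - (d + 1) * (K.fNum 0 : ℤ) + ((d + 2).choose 2 : ℕ)

/-- A facet is a maximal face. -/
def IsFacet (K : PreAbstractSimplicialComplex V) (σ : Finset V) : Prop :=
  σ ∈ K ∧ ∀ τ, τ ∈ K → σ ⊆ τ → τ = σ

open Classical in
/-- The link of `σ`: the faces disjoint from `σ` whose join with `σ` lies in `K`. -/
def link (K : PreAbstractSimplicialComplex V) (σ : Finset V) : PreAbstractSimplicialComplex V where
  faces := {τ | τ ∈ K ∧ Disjoint σ τ ∧ σ ∪ τ ∈ K}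
  isRelLowerSet_faces := by
    rintro τ ⟨h1, h2, h3⟩
    refine ⟨(K.isRelLowerSet_faces h1).1, fun ρ hρ hn => ?_⟩
    have hs : ρ ⊆ τ := hρ
    exact ⟨(K.isRelLowerSet_faces h1).2 hρ hn, h2.mono_right hs,
      (K.isRelLowerSet_faces h3).2 (Finset.union_subset_union_right hs)
        (hn.mono Finset.subset_union_right)⟩

open Classical in
/-- The star of `σ`: the faces of the joins of `σ` with the (possibly empty) faces of its link. -/
def star (K : PreAbstractSimplicialComplex V) (σ : Finset V) : PreAbstractSimplicialComplex V where
  faces := {γ | γ.Nonempty ∧ σ ∪ γ ∈ K}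
  isRelLowerSet_faces := by
    rintro γ ⟨h1, h2⟩
    refine ⟨h1, fun ρ hρ hn => ⟨hn, ?_⟩⟩
    exact (K.isRelLowerSet_faces h2).2 (Finset.union_subset_union_right hρ)
      (hn.mono Finset.subset_union_right)

/-- The graph `G(K)`: the faces of dimension at most one. -/
def graphFaces (K : PreAbstractSimplicialComplex V) : Set (Finset V) :=
  {σ | σ ∈ K ∧ σ.card ≤ 2}

open Classical in
/-- The same graph as a `SimpleGraph` on the labels, used for speaking about paths. -/
def graph (K : PreAbstractSimplicialComplex V) : SimpleGraph V where
  Adj a b := a ≠ b ∧ ({a, b} : Finset V) ∈ K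
  symm := ⟨fun a b h => ⟨h.1.symm, by rw [Finset.pair_comm]; exact h.2⟩⟩
  loopless := ⟨fun _ h => h.1 rfl⟩

/-- `K` is connected: it is nonempty and any two of its vertices are joined by an edge path. -/
def IsConn (K : PreAbstractSimplicialComplex V) : Prop :=
  (∃ v, {v} ∈ K) ∧ ∀ a b, {a} ∈ K → {b} ∈ K → K.graph.Reachable a b

open Classical in
/-- A `d`-pseudomanifold: a (nonempty) pure `d`-dimensional complex in which every
`(d - 1)`-dimensional face lies in exactly two facets, and in which any two facets are joined by a
sequence of facets whose consecutive members meet in a `(d - 1)`-dimensional face. -/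
structure IsPseudomanifold (d : ℕ) (K : PreAbstractSimplicialComplex V) : Prop where
  nonempty : ∃ σ, σ ∈ K
  pure : ∀ σ, K.IsFacet σ → σ.card = d + 1
  two_facets : ∀ τ, τ ∈ K → τ.card = d → {σ | K.IsFacet σ ∧ τ ⊆ σ}.ncard = 2
  strongly_connected : ∀ σ τ, K.IsFacet σ → K.IsFacet τ →
    Relation.ReflTransGen
      (fun α β => K.IsFacet α ∧ K.IsFacet β ∧ (α ∩ β).card = d) σ τ

/-- A normal `d`-pseudomanifold: moreover the link of every face of dimension at most `d - 2` is
connected. -/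
structure IsNormalPseudomanifold (d : ℕ) (K : PreAbstractSimplicialComplex V) : Prop
    extends IsPseudomanifold d K where
  link_connected : ∀ σ, σ ∈ K → σ.card + 1 ≤ d → (K.link σ).IsConn

/-- A `g₂`-minimal normal `3`-pseudomanifold: some vertex `v` has `g₂(K) = g₂(lk v)`. -/
def IsG₂MinimalNormal3 (K : PreAbstractSimplicialComplex V) : Prop :=
  K.IsNormalPseudomanifold 3 ∧ ∃ v, {v} ∈ K ∧ K.g₂ 3 = (K.link {v}).g₂ 2

/-- The geometric carrier `|K|` of a finite complex, as the space of barycentric coordinates. -/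
def carrier [Fintype V] (K : PreAbstractSimplicialComplex V) : Set (V → ℝ) :=
  {x | x ∈ stdSimplex ℝ V ∧ ∃ σ, σ ∈ K ∧ ∀ v, v ∉ σ → x v = 0}

end PreAbstractSimplicialComplex

/-- The two-dimensional sphere. -/
abbrev Sphere2 : Type := Metric.sphere (0 : EuclideanSpace ℝ (Fin 3)) 1

/-- Antipodal points of the sphere are identified. -/
def antipodalSetoid : Setoid Sphere2 where
  r x y := x = y ∨ x = -y
  iseqv := by
    refine ⟨fun _ => Or.inl rfl, ?_, ?_⟩
    · rintro x y (rfl | rfl)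
      · exact Or.inl rfl
      · exact Or.inr (neg_neg y).symm
    · rintro x y z (rfl | rfl) (rfl | rfl)
      · exact Or.inl rfl
      · exact Or.inr rfl
      · exact Or.inr rfl
      · exact Or.inl (neg_neg z)

/-- The real projective plane, with the quotient topology. -/
abbrev RP2 : Type := Quotient antipodalSetoid

namespace PreAbstractSimplicialComplex

variable {V W : Type*}

/-- A singular vertex: a vertex whose link is not a sphere. -/
def IsSingular [Fintype V] (K : PreAbstractSimplicialComplex V) (v : V) : Prop :=
  {v} ∈ K ∧ IsEmpty ((K.link {v}).carrier ≃ₜ Sphere2)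

/-- The vertex `v` has `ℝP²` singularity: the carrier of its link is homeomorphic to `ℝP²`. -/
def HasRP2Singularity [Fintype V] (K : PreAbstractSimplicialComplex V) (v : V) : Prop :=
  K.IsSingular v ∧ Nonempty ((K.link {v}).carrier ≃ₜ RP2)

open Classical in
/-- `L` is (up to relabelling of vertices) the edge folding `K_{xy}^ψ` of `K` at the edge `xy`.

The facets `σ₁` and `σ₂` meet exactly in `xy`, the map `ψ` is a bijection from the vertices of `σ₁`
to those of `σ₂` fixing `x` and `y`, and for the other vertices `u` of `σ₁` every path of length at
most two from `u` to `ψ u` passes through `x` or `y`. The map `q` is the quotient map on vertices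
that identifies each `u ∈ σ₁` with `ψ u` and nothing else; the faces of `L` are the images of the
faces of `K` except for the common image of `σ₁` and `σ₂`. -/
def IsEdgeFolding (K : PreAbstractSimplicialComplex V) (L : PreAbstractSimplicialComplex W) :
    Prop :=
  ∃ (σ₁ σ₂ : Finset V) (x y : V) (ψ : V → V) (q : V → W),
    K.IsFacet σ₁ ∧ K.IsFacet σ₂ ∧ σ₁ ≠ σ₂ ∧ x ≠ y ∧ σ₁ ∩ σ₂ = {x, y} ∧
    Set.BijOn ψ σ₁ σ₂ ∧ ψ x = x ∧ ψ y = y ∧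
    (∀ u ∈ σ₁, u ≠ x → u ≠ y → ∀ p : K.graph.Walk u (ψ u), p.IsPath → p.length ≤ 2 →
      x ∈ p.support ∨ y ∈ p.support) ∧
    (∀ a b, {a} ∈ K → {b} ∈ K →
      (q a = q b ↔ a = b ∨ (a ∈ σ₁ ∧ b = ψ a) ∨ (b ∈ σ₁ ∧ a = ψ b))) ∧
    L.faces = {τ | ∃ ρ, ρ ∈ K ∧ τ = ρ.image q} \ {σ₁.image q}

end PreAbstractSimplicialComplex

end

/-! All edges lie in the star of `t`, so in the link of any other vertex `x` the vertex `t` is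
joined to every other vertex. A mod 2 cohomology class of degree one on that link therefore has
exactly one representative that vanishes on the edges at `t`. The space of these representatives is
the kernel of an incidence matrix, and `bettiAt` is its dimension. Rank-nullity for the matrix and
its transpose gives Euler's relation `outerCount_add_two`.

This number detects singularities. It is 0 for a sphere and at most 1 for a projective plane: double
coverings of the sphere are trivial, and of two double coverings of the projective plane one of them
or their sum is trivial. Conversely, if it is 0, then Euler's relation and the pigeonhole principle
give a vertex of degree three in the link. Such vertices can be removed until the boundary of a
tetrahedron remains, so the link is a sphere (`nonempty_link_homeomorph_sphere`). The vertex `t`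
itself is governed by `bettiAt_le_of_isEvenLink`: the boundaries of the triangles at `w` that avoid
`t` cut the link of `t` into many regions, each with at least three boundary edges, and counting
bounds `bettiAt` at `w`. Hence `t` is singular as soon as another vertex is, and an `ℝP²`
singularity anywhere, even at `t`, leads to a vertex `v ≠ t` where `bettiAt` is 1.

At such a `v` take the nonzero class `φ` and a triangle `vab` with `φ {v, a, b} ≠ 0`. Then `tvab` is
a missing tetrahedron with complete boundary, and the circuit `tab` is one-sided in the link of `v`.
If `a` and `b` have `bettiAt` 0, the circuits `tvb` and `tva` separate their links
(`exists_bd_eq_ite`), so the boundary of `tvab` has two sides near `ab`. Cutting along this boundary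
duplicates `a` and `b` but, because of one-sidedness, neither `t` nor `v`. Filling in two tetrahedra
gives a complex that folds back to the given one at the edge `tv` (`isEdgeFolding_unfold`). By
Euler's relation `bettiAt` falls by one at `v`, is zero at the copies of `a` and `b`, and is
unchanged at all other vertices except `t`. The edge `ab` can be chosen away from two prescribed
vertices (`exists_support`), which protects the remaining singular vertices. One unfolding proves
the first case and two prove the second. `g₂`-minimality persists because the graph of each complex
is a cone with apex `t` over the graph of the link of `t`. -/

open Classical

/-! ### Trivializing double coverings. -/

section Trivialization

variable {Y ι : Type*} [TopologicalSpace Y]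

/-- A trivialization, relative to the cover `U`, of the locally constant `ZMod 2`-valued
transition functions `φ`. -/
structure IsTrivialization (U : ι → Set Y) (φ : ι → ι → ZMod 2) (g : ι → Y → ZMod 2) : Prop where
  continuousOn : ∀ i, ContinuousOn (g i) (U i)
  add_eq : ∀ i j y, y ∈ U i → y ∈ U j → g i y + g j y = φ i j

theorem zmod_two_add_cancel (a b : ZMod 2) : a + (a + b) = b := by
  rw [← add_assoc, CharTwo.add_self_eq_zero, zero_add]

theorem zmod_two_eq_of_add {a b c : ZMod 2} (h : a + b = c) : b = a + c := by
  rw [← h, zmod_two_add_cancel]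

theorem zmod_two_eq_of_add_eq_zero {a b : ZMod 2} (h : a + b = 0) : a = b := by
  rw [zmod_two_eq_of_add h, add_zero]

/-- The functions `φ` glue copies of `U i × ZMod 2` to a double covering. Over a simply connected
base the identity lifts to a section, whose coordinates in the local charts are the trivialization.
-/
theorem exists_isTrivialization_of_simplyConnected [SimplyConnectedSpace Y]
    [LocallyPathConnectedSpace Y] (U : ι → Set Y) (hU : ∀ i, IsOpen (U i))
    (hc : ∀ y, ∃ i, y ∈ U i) (φ : ι → ι → ZMod 2)
    (h : ∀ i j k y, y ∈ U i → y ∈ U j → y ∈ U k → φ i j + φ j k = φ i k) :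
    ∃ g, IsTrivialization U φ g := by
  choose idx hidx using hc
  let Z : FiberBundleCore ι Y (ZMod 2) :=
    { baseSet := U
      isOpen_baseSet := hU
      indexAt := idx
      mem_baseSet_at := hidx
      coordChange := fun i j _ a => a + φ i j
      coordChange_self := fun i y hy a => by
        have := h i i i y hy hy hy
        simpa using this
      continuousOn_coordChange := fun i j => by
        have : Continuous fun a : ZMod 2 => a + φ i j := continuous_of_discreteTopology
        exact (this.comp continuous_snd).continuousOn
      coordChange_comp := fun i j k y hy a => by
        have := h i j k y hy.1.1 hy.1.2 hy.2
        rw [← this, add_assoc] }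
  have cov : IsCoveringMap (Bundle.TotalSpace.proj : Bundle.TotalSpace (ZMod 2) Z.Fiber → Y) :=
    FiberBundle.isCoveringMap
  obtain ⟨y0⟩ : Nonempty Y := inferInstance
  obtain ⟨F, ⟨-, hF⟩, -⟩ := cov.existsUnique_continuousMap_lifts (ContinuousMap.id Y) y0
    ⟨y0, (0 : ZMod 2)⟩ rfl
  have hF' : ∀ y, (F y).1 = y := fun y => congrFun hF y
  refine ⟨fun i y => (Z.localTriv i (F y)).2, ?_, ?_⟩
  · intro i
    refine continuous_snd.comp_continuousOn ((Z.localTriv i).continuousOn.comp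
      F.continuous.continuousOn ?_)
    intro y hy
    rw [FiberBundleCore.mem_localTriv_source, hF' y]
    exact hy
  · intro i j y hi hj
    have e : ∀ k, (Z.localTriv k (F y)).2 = (show ZMod 2 from (F y).2) + φ (idx y) k := fun k => by
      rw [FiberBundleCore.localTriv_apply]
      change _ + φ (idx (F y).1) k = _
      rw [hF' y]
    rw [e, e]
    have h1 := h (idx y) i j y (hidx y) hi hj
    rw [← h1]
    generalize (show ZMod 2 from (F y).2) = a
    generalize φ (idx y) i = b
    generalize φ i j = c
    revert a b c
    decide

theorem IsTrivialization.add {U : ι → Set Y} {φ ψ : ι → ι → ZMod 2} {g h : ι → Y → ZMod 2}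
    (hg : IsTrivialization U φ g) (hh : IsTrivialization U ψ h) :
    IsTrivialization U (φ + ψ) (g + h) := by
  refine ⟨fun i => (hg.continuousOn i).add (hh.continuousOn i), fun i j y hi hj => ?_⟩
  have h1 := hg.add_eq i j y hi hj
  have h2 := hh.add_eq i j y hi hj
  simp only [Pi.add_apply, ← h1, ← h2]
  abel

/-- Two trivializations of the same transition functions differ by a constant on a preconnected
set. -/
theorem IsTrivialization.exists_const {U : ι → Set Y} (hU : ∀ i, IsOpen (U i))
    {φ : ι → ι → ZMod 2} {g h : ι → Y → ZMod 2} {W : Set Y} (hW : IsPreconnected W)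
    (hWU : ∀ y ∈ W, ∃ i, y ∈ U i)
    (hg : ∀ i, ContinuousOn (g i) (U i ∩ W)) (hh : ∀ i, ContinuousOn (h i) (U i ∩ W))
    (hg' : ∀ i j y, y ∈ W → y ∈ U i → y ∈ U j → g i y + g j y = φ i j)
    (hh' : ∀ i j y, y ∈ W → y ∈ U i → y ∈ U j → h i y + h j y = φ i j) :
    ∃ k, ∀ i, ∀ y ∈ W, y ∈ U i → g i y + h i y = k := by
  by_cases hne : W.Nonempty
  swap
  · exact ⟨0, fun i y hy => (hne ⟨y, hy⟩).elim⟩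
  obtain ⟨y0, hy0⟩ := hne
  -- The sum `g i + h i` does not depend on `i`, since both terms change by `φ i j`. Any index may
  -- be chosen, and the value 0 off the cover is never met on `W`.
  let d : Y → ZMod 2 := fun y => if hy : ∃ i, y ∈ U i then g hy.choose y + h hy.choose y else 0
  have hd : ∀ i, ∀ y ∈ W, y ∈ U i → g i y + h i y = d y := by
    intro i y hy hi
    have hex : ∃ i, y ∈ U i := ⟨i, hi⟩
    have e : d y = g hex.choose y + h hex.choose y := dif_pos hex
    rw [e]
    have h1 := hg' i _ y hy hi hex.choose_spec
    have h2 := hh' i _ y hy hi hex.choose_spec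
    rw [zmod_two_eq_of_add h1, zmod_two_eq_of_add h2]
    generalize φ _ _ = c
    generalize g i y = a
    generalize h i y = b
    revert a b c; decide
  have hcont : ContinuousOn d W := by
    intro y hy
    obtain ⟨i, hi⟩ := hWU y hy
    have h1 : ContinuousWithinAt (fun z => g i z + h i z) (U i ∩ W) y :=
      ((hg i).add (hh i)) y ⟨hi, hy⟩
    have h2 : ContinuousWithinAt d (U i ∩ W) y :=
      h1.congr (fun z hz => (hd i z hz.2 hz.1).symm) (hd i y hy hi).symm
    rw [Set.inter_comm] at h2
    exact (continuousWithinAt_inter ((hU i).mem_nhds hi)).1 h2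
  exact ⟨d y0, fun i y hy hi => (hd i y hy hi).trans (hW.constant hcont hy hy0)⟩

end Trivialization

/-! ### Double coverings of the sphere and of the projective plane. -/

section Sphere

instance : Fact (Module.finrank ℝ (EuclideanSpace ℝ (Fin 3)) = 2 + 1) := ⟨by simp⟩

instance : PreconnectedSpace Sphere2 := by
  apply Subtype.preconnectedSpace
  apply isPreconnected_sphere
  rw [← Module.finrank_eq_rank]
  norm_num [finrank_euclideanSpace]

/-- Stereographic projection from `p` turns this set into a plane without one point. -/
theorem isPreconnected_compl_pair_sphere (p r : Sphere2) (hpr : r ≠ p) :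
    IsPreconnected ({p}ᶜ ∩ {r}ᶜ : Set Sphere2) := by
  let s := stereographic' 2 p
  have hs : s.source = {p}ᶜ := stereographic'_source p
  have ht : s.target = Set.univ := stereographic'_target p
  have hr : r ∈ s.source := by rw [hs]; exact hpr
  have h1 : IsPreconnected ({s r}ᶜ : Set (EuclideanSpace ℝ (Fin 2))) := by
    refine (isConnected_compl_singleton_of_one_lt_rank ?_ _).isPreconnected
    rw [← Module.finrank_eq_rank]
    norm_num [finrank_euclideanSpace]
  have h2 := h1.image s.symm (s.continuousOn_symm.mono (by rw [ht]; exact Set.subset_univ _))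
  convert h2 using 1
  ext y
  constructor
  · rintro ⟨hp, hr'⟩
    have hy : y ∈ s.source := by rw [hs]; exact hp
    refine ⟨s y, fun h => hr' (s.injOn hy hr h), s.left_inv hy⟩
  · rintro ⟨z, hz, rfl⟩
    have hz' : z ∈ s.target := by rw [ht]; trivial
    refine ⟨?_, fun h => hz ?_⟩
    · rw [← hs]; exact s.map_target hz'
    · have h' : s.symm z = r := h
      change z = s r
      rw [← h', s.right_inv hz']

/-- The sphere without `p` is a plane by stereographic projection, hence simply connected. -/
theorem exists_isTrivialization_compl_sphere {ι : Type*} (U : ι → Set Sphere2)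
    (hU : ∀ i, IsOpen (U i)) (hc : ∀ y, ∃ i, y ∈ U i) (φ : ι → ι → ZMod 2)
    (h : ∀ i j k y, y ∈ U i → y ∈ U j → y ∈ U k → φ i j + φ j k = φ i k) (p : Sphere2) :
    ∃ g : ι → Sphere2 → ZMod 2, (∀ i, ContinuousOn (g i) (U i ∩ {p}ᶜ)) ∧
      ∀ i j y, y ∈ ({p}ᶜ : Set Sphere2) → y ∈ U i → y ∈ U j → g i y + g j y = φ i j := by
  let s := stereographic' 2 p
  have hs : s.source = {p}ᶜ := stereographic'_source p
  have ht : s.target = Set.univ := stereographic'_target p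
  have hcs : Continuous s.symm := by
    rw [← continuousOn_univ, ← ht]
    exact s.continuousOn_symm
  obtain ⟨g, hg⟩ := exists_isTrivialization_of_simplyConnected
    (fun i => s.symm ⁻¹' U i) (fun i => (hU i).preimage hcs) (fun y => hc _) φ
    (fun i j k y => h i j k _)
  refine ⟨fun i y => g i (s y), fun i => ?_, fun i j y hy hi hj => ?_⟩
  · refine (hg.continuousOn i).comp (s.continuousOn.mono ?_) ?_
    · rw [hs]; exact Set.inter_subset_right
    · intro y hy
      change s.symm (s y) ∈ U i
      rw [s.left_inv (by rw [hs]; exact hy.2)]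
      exact hy.1
  · have e : s.symm (s y) = y := s.left_inv (by rw [hs]; exact hy)
    refine hg.add_eq i j (s y) ?_ ?_
    · change s.symm (s y) ∈ U i; rwa [e]
    · change s.symm (s y) ∈ U j; rwa [e]

/-- Two punctured spheres cover the sphere and have a connected overlap. The trivializations over
them differ by a constant, which can be absorbed into one of them. -/
theorem exists_isTrivialization_sphere {ι : Type*} (U : ι → Set Sphere2)
    (hU : ∀ i, IsOpen (U i)) (hc : ∀ y, ∃ i, y ∈ U i) (φ : ι → ι → ZMod 2)
    (h : ∀ i j k y, y ∈ U i → y ∈ U j → y ∈ U k → φ i j + φ j k = φ i k) :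
    ∃ g, IsTrivialization U φ g := by
  obtain ⟨p, hp⟩ : (Metric.sphere (0 : EuclideanSpace ℝ (Fin 3)) 1).Nonempty :=
    NormedSpace.sphere_nonempty.2 zero_le_one
  let p : Sphere2 := ⟨p, hp⟩
  have hne : -p ≠ p := by
    intro e
    have e1 : -(p : EuclideanSpace ℝ (Fin 3)) = p := congrArg Subtype.val e
    have e2 : (p : EuclideanSpace ℝ (Fin 3)) = 0 := by
      have e4 : (2 : ℝ) • (p : EuclideanSpace ℝ (Fin 3)) = 0 := by
        rw [two_smul]; nth_rewrite 1 [← e1]; simp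
      exact (smul_eq_zero.1 e4).resolve_left two_ne_zero
    have e3 : ‖(p : EuclideanSpace ℝ (Fin 3))‖ = 1 := by simp
    rw [e2] at e3
    simp at e3
  obtain ⟨g, hg, hg'⟩ := exists_isTrivialization_compl_sphere U hU hc φ h p
  obtain ⟨g2, hg2, hg2'⟩ := exists_isTrivialization_compl_sphere U hU hc φ h (-p)
  obtain ⟨k, hk⟩ := IsTrivialization.exists_const (φ := φ) hU
    (isPreconnected_compl_pair_sphere p (-p) hne) (fun y _ => hc y)
    (fun i => (hg i).mono fun y hy => ⟨hy.1, hy.2.1⟩)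
    (fun i => (hg2 i).mono fun y hy => ⟨hy.1, hy.2.2⟩)
    (fun i j y hy => hg' i j y hy.1) (fun i j y hy => hg2' i j y hy.2)
  -- Only the value at `p` comes from `g2`. Off `-p` the function nevertheless equals `g2 + k`, so
  -- it is continuous at `p` too.
  let G : ι → Sphere2 → ZMod 2 := fun i y => if y = p then g2 i y + k else g i y
  have hG1 : ∀ i y, y ≠ p → G i y = g i y := fun i y hy => if_neg hy
  have hG2 : ∀ i y, y ∈ U i → y ≠ -p → G i y = g2 i y + k := by
    intro i y hi hy
    by_cases hyp : y = p
    · exact if_pos hyp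
    · rw [hG1 i y hyp, ← hk i y ⟨hyp, hy⟩ hi, add_comm (g i y), zmod_two_add_cancel]
  refine ⟨G, fun i y hi => ?_, fun i j y hi hj => ?_⟩
  · by_cases hyp : y = p
    · have hyn : y ≠ -p := by rw [hyp]; exact hne.symm
      have h1 : ContinuousWithinAt (fun z => g2 i z + k) (U i ∩ {-p}ᶜ) y :=
        ((hg2 i).add continuousOn_const) y ⟨hi, hyn⟩
      have h2 : ContinuousWithinAt (G i) (U i ∩ {-p}ᶜ) y :=
        h1.congr (fun z hz => hG2 i z hz.1 hz.2) (hG2 i y hi hyn)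
      exact (continuousWithinAt_inter (isOpen_compl_singleton.mem_nhds hyn)).1 h2
    · have h2 : ContinuousWithinAt (G i) (U i ∩ {p}ᶜ) y :=
        ((hg i) y ⟨hi, hyp⟩).congr (fun z hz => hG1 i z hz.2) (hG1 i y hyp)
      exact (continuousWithinAt_inter (isOpen_compl_singleton.mem_nhds hyp)).1 h2
  · by_cases hyp : y = p
    · have hyn : y ≠ -p := by rw [hyp]; exact hne.symm
      rw [hG2 i y hi hyn, hG2 j y hj hyn, ← hg2' i j y hyn hi hj]
      generalize g2 i y = a
      generalize g2 j y = b
      clear hk hG1 hG2 G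
      revert a b k; decide
    · rw [hG1 i y hyp, hG1 j y hyp, hg' i j y hyp hi hj]

/-- Of two families of transition functions on the projective plane, one of them or their sum is
trivial. -/
theorem exists_isTrivialization_of_antipodal {X : Type*} [TopologicalSpace X] {π : Sphere2 → X}
    (hπ : Topology.IsQuotientMap π) (hπ' : ∀ y z, π y = π z ↔ y = z ∨ y = -z)
    {ι : Type*} (U : ι → Set X) (hU : ∀ i, IsOpen (U i)) (hc : ∀ y, ∃ i, y ∈ U i)
    (φ ψ : ι → ι → ZMod 2)
    (hφ : ∀ i j k y, y ∈ U i → y ∈ U j → y ∈ U k → φ i j + φ j k = φ i k)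
    (hψ : ∀ i j k y, y ∈ U i → y ∈ U j → y ∈ U k → ψ i j + ψ j k = ψ i k) :
    (∃ g, IsTrivialization U φ g) ∨ (∃ g, IsTrivialization U ψ g) ∨
      ∃ g, IsTrivialization U (φ + ψ) g := by
  let U' : ι → Set Sphere2 := fun i => π ⁻¹' U i
  have hU' : ∀ i, IsOpen (U' i) := fun i => (hU i).preimage hπ.continuous
  have hneg : ∀ y, π (-y) = π y := fun y => (hπ' _ _).2 (Or.inr rfl)
  have hnegU : ∀ i y, y ∈ U' i → -y ∈ U' i := fun i y hy => by
    change π (-y) ∈ U i; rw [hneg]; exact hy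
  -- The antipodal pullback of a trivialization trivializes the same transition functions, so it
  -- differs from the original by a constant.
  have flip : ∀ χ : ι → ι → ZMod 2, ∀ g, IsTrivialization U' χ g →
      ∃ k, ∀ i y, y ∈ U' i → g i y + g i (-y) = k := by
    intro χ g hg
    obtain ⟨k, hk⟩ := IsTrivialization.exists_const (φ := χ) (g := g) (h := fun i y => g i (-y)) hU'
      (isPreconnected_univ (α := Sphere2)) (fun y _ => hc _)
      (fun i => (hg.continuousOn i).mono Set.inter_subset_left)
      (fun i => (hg.continuousOn i).comp continuous_neg.continuousOn
        fun y hy => hnegU i y hy.1)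
      (fun i j y _ => hg.add_eq i j y)
      (fun i j y _ hi hj => hg.add_eq i j _ (hnegU i y hi) (hnegU j y hj))
    exact ⟨k, fun i y hi => hk i y trivial hi⟩
  -- If that constant is 0, the trivialization is invariant and descends to the quotient.
  have desc : ∀ χ : ι → ι → ZMod 2, ∀ g, IsTrivialization U' χ g →
      (∀ i y, y ∈ U' i → g i y + g i (-y) = 0) → ∃ g, IsTrivialization U χ g := by
    intro χ g hg h0
    obtain ⟨r, hr⟩ := hπ.surjective.hasRightInverse
    have key : ∀ i y, y ∈ U' i → g i (r (π y)) = g i y := by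
      intro i y hi
      rcases (hπ' _ _).1 (hr (π y)) with e | e
      · rw [e]
      · rw [e]; exact (zmod_two_eq_of_add_eq_zero (h0 i y hi)).symm
    refine ⟨fun i x => g i (r x), fun i => ?_, fun i j x hi hj => ?_⟩
    · rw [hπ.continuousOn_isOpen_iff (hU i)]
      exact (hg.continuousOn i).congr fun y hy => key i y hy
    · refine hg.add_eq i j (r x) ?_ ?_
      · change π (r x) ∈ U i; rwa [hr]
      · change π (r x) ∈ U j; rwa [hr]
  obtain ⟨g, hg⟩ := exists_isTrivialization_sphere U' hU' (fun y => hc _) φ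
    fun i j k y => hφ i j k _
  obtain ⟨g', hg'⟩ := exists_isTrivialization_sphere U' hU' (fun y => hc _) ψ
    fun i j k y => hψ i j k _
  obtain ⟨k, hk⟩ := flip φ g hg
  obtain ⟨k', hk'⟩ := flip ψ g' hg'
  have h01 : ∀ a : ZMod 2, a = 0 ∨ a = 1 := by decide
  rcases h01 k with rfl | rfl
  · exact Or.inl (desc φ g hg hk)
  rcases h01 k' with rfl | rfl
  · exact Or.inr (Or.inl (desc ψ g' hg' hk'))
  -- Both constants are 1, so they cancel for the sum.
  · refine Or.inr (Or.inr (desc _ _ (hg.add hg') fun i y hi => ?_))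
    have h1 := hk i y hi
    have h2 := hk' i y hi
    have h3 : (g i y + g i (-y)) + (g' i y + g' i (-y)) = 0 := by rw [h1, h2]; decide
    rw [← h3]
    simp only [Pi.add_apply]
    abel

end Sphere

/-! ### Simplicial cocycles as transition functions between open stars. -/

namespace PreAbstractSimplicialComplex

variable {V : Type*}

/-- A `ZMod 2`-valued simplicial `1`-cocycle. -/
def IsCocycle (K : PreAbstractSimplicialComplex V) (φ : V → V → ZMod 2) : Prop :=
  ∀ u v w, ({u, v, w} : Finset V) ∈ K → φ u v + φ v w = φ u w

/-- A `ZMod 2`-valued simplicial `1`-coboundary. -/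
def IsCoboundary (K : PreAbstractSimplicialComplex V) (φ : V → V → ZMod 2) : Prop :=
  ∃ f : V → ZMod 2, ∀ u v, ({u, v} : Finset V) ∈ K → φ u v = f u + f v

theorem mem_of_subset {K : PreAbstractSimplicialComplex V} {σ τ : Finset V} (h : σ ∈ K)
    (h1 : τ ⊆ σ) (h2 : τ.Nonempty) : τ ∈ K :=
  (K.isRelLowerSet_faces h).2 h1 h2

theorem nonempty_of_mem {K : PreAbstractSimplicialComplex V} {σ : Finset V} (h : σ ∈ K) :
    σ.Nonempty :=
  (K.isRelLowerSet_faces h).1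

variable [Fintype V]

/-- The open star of a vertex in the carrier. -/
def openStar (K : PreAbstractSimplicialComplex V) (v : V) : Set K.carrier := {x | 0 < x.1 v}

theorem isOpen_openStar (K : PreAbstractSimplicialComplex V) (v : V) : IsOpen (K.openStar v) :=
  isOpen_lt continuous_const ((continuous_apply v).comp continuous_subtype_val)

theorem exists_mem_openStar (K : PreAbstractSimplicialComplex V) (x : K.carrier) :
    ∃ v, x ∈ K.openStar v := by
  by_contra! h
  have h1 : ∑ v, x.1 v = 1 := x.2.1.2
  have h2 : ∑ v, x.1 v ≤ 0 := Finset.sum_nonpos fun v _ => not_lt.1 (h v)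
  linarith

theorem mem_of_forall_mem_openStar {K : PreAbstractSimplicialComplex V} {x : K.carrier}
    {σ : Finset V} (hσ : σ.Nonempty) (h : ∀ v ∈ σ, x ∈ K.openStar v) : σ ∈ K := by
  obtain ⟨-, τ, hτ, h0⟩ := x.2
  refine mem_of_subset hτ (fun v hv => ?_) hσ
  by_contra hn
  have h1 : 0 < x.1 v := h v hv
  rw [h0 v hn] at h1
  exact lt_irrefl _ h1

theorem IsCocycle.transition {K : PreAbstractSimplicialComplex V} {φ : V → V → ZMod 2}
    (h : K.IsCocycle φ) (i j k : V) (x : K.carrier) (hi : x ∈ K.openStar i)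
    (hj : x ∈ K.openStar j) (hk : x ∈ K.openStar k) : φ i j + φ j k = φ i k :=
  h i j k (mem_of_forall_mem_openStar (x := x) ⟨i, by simp⟩ (by simp [hi, hj, hk]))

/-- The value of `g v` at the vertex `v` serves as `f v`. Half of the edge `uv` lies in the open
star of `u` and half in that of `v`, so both values can be transported to the midpoint, where the
transition rule applies. -/
theorem isCoboundary_of_isTrivialization {K : PreAbstractSimplicialComplex V}
    {φ : V → V → ZMod 2} {g} (hg : IsTrivialization K.openStar φ g) : K.IsCoboundary φ := by
  have seg : ∀ u v (s : ℝ), ({u, v} : Finset V) ∈ K → 0 ≤ s → s ≤ 1 →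
      (fun w => (1 - s) * Pi.single (M := fun _ => ℝ) u 1 w
        + s * Pi.single (M := fun _ => ℝ) v 1 w) ∈ K.carrier := by
    intro u v s huv h0 h1
    refine ⟨⟨fun w => ?_, ?_⟩, _, huv, fun w hw => ?_⟩
    · have h2 : 0 ≤ Pi.single (M := fun _ => ℝ) u 1 w := by
        rw [Pi.single_apply]; split_ifs <;> norm_num
      have h3 : 0 ≤ Pi.single (M := fun _ => ℝ) v 1 w := by
        rw [Pi.single_apply]; split_ifs <;> norm_num
      have : 0 ≤ 1 - s := by linarith
      positivity
    · rw [Finset.sum_add_distrib, ← Finset.mul_sum, ← Finset.mul_sum]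
      simp
    · simp only [Finset.mem_insert, Finset.mem_singleton, not_or] at hw
      simp [hw.1, hw.2]
  have const : ∀ u v (huv : ({u, v} : Finset V) ∈ K) (x y : K.carrier),
      x.1 = (fun w => (1 - 0) * Pi.single (M := fun _ => ℝ) u 1 w
        + 0 * Pi.single (M := fun _ => ℝ) v 1 w) →
      y.1 = (fun w => (1 - 1 / 2) * Pi.single (M := fun _ => ℝ) u 1 w
        + (1 / 2) * Pi.single (M := fun _ => ℝ) v 1 w) → g u x = g u y := by
    intro u v huv x y hx hy
    let γ : Set.Icc (0 : ℝ) (1 / 2) → K.carrier := fun s =>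
      ⟨_, seg u v s huv s.2.1 (s.2.2.trans (by norm_num))⟩
    have hγ : Continuous γ := by
      refine Continuous.subtype_mk ?_ _
      fun_prop
    have hstar : ∀ s, γ s ∈ K.openStar u := by
      intro s
      change 0 < (1 - (s : ℝ)) * _ + (s : ℝ) * _
      have h1 := s.2.1
      have h2 : (s : ℝ) ≤ 1 / 2 := s.2.2
      rw [Pi.single_eq_same]
      have h3 : 0 ≤ Pi.single (M := fun _ => ℝ) v 1 u := by
        rw [Pi.single_apply]; split_ifs <;> norm_num
      have := mul_nonneg h1 h3
      linarith
    have hpre : IsPreconnected (Set.univ : Set (Set.Icc (0 : ℝ) (1 / 2))) :=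
      (Subtype.preconnectedSpace isPreconnected_Icc).isPreconnected_univ
    have := hpre.constant (f := fun s => g u (γ s))
      ((hg.continuousOn u).comp hγ.continuousOn fun s _ => hstar s)
      (x := ⟨0, by norm_num⟩) (y := ⟨1 / 2, by norm_num⟩) trivial trivial
    convert this using 2
    · exact Subtype.ext hx
    · exact Subtype.ext hy
  have hv : ∀ v, {v} ∈ K → (Pi.single v 1 : V → ℝ) ∈ K.carrier := by
    intro v hv
    convert seg v v 0 (by simpa using hv) le_rfl zero_le_one using 1
    ext w; simp
  refine ⟨fun v => if h : {v} ∈ K then g v ⟨_, hv v h⟩ else 0, fun u v huv => ?_⟩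
  have hu' : {u} ∈ K := mem_of_subset huv (by simp) (by simp)
  have hv' : {v} ∈ K := mem_of_subset huv (by simp) (by simp)
  have hvu : ({v, u} : Finset V) ∈ K := by rwa [Finset.pair_comm]
  let y : K.carrier := ⟨_, seg u v (1 / 2) huv (by norm_num) (by norm_num)⟩
  beta_reduce
  rw [dif_pos hu', dif_pos hv']
  rw [const u v huv _ y (by ext w; simp) rfl, const v u hvu _ y (by ext w; simp)
    (by ext w; simp only [y]; ring)]
  refine (hg.add_eq u v y ?_ ?_).symm
  · change 0 < (1 - (1 / 2 : ℝ)) * _ + (1 / 2) * _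
    rw [Pi.single_eq_same]
    have h3 : 0 ≤ Pi.single (M := fun _ => ℝ) v 1 u := by
      rw [Pi.single_apply]; split_ifs <;> norm_num
    linarith
  · change 0 < (1 - (1 / 2 : ℝ)) * _ + (1 / 2) * _
    rw [Pi.single_eq_same]
    have h3 : 0 ≤ Pi.single (M := fun _ => ℝ) u 1 v := by
      rw [Pi.single_apply]; split_ifs <;> norm_num
    linarith

theorem IsCocycle.isCoboundary_of_homeomorph_sphere {K : PreAbstractSimplicialComplex V}
    (e : K.carrier ≃ₜ Sphere2) {φ : V → V → ZMod 2} (h : K.IsCocycle φ) : K.IsCoboundary φ := by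
  obtain ⟨g, hg⟩ := exists_isTrivialization_sphere (fun v => e.symm ⁻¹' K.openStar v)
    (fun v => (K.isOpen_openStar v).preimage e.symm.continuous)
    (fun y => K.exists_mem_openStar _) φ (fun i j k y => h.transition i j k _)
  refine isCoboundary_of_isTrivialization (g := fun v x => g v (e x)) ⟨fun v => ?_, ?_⟩
  · refine (hg.continuousOn v).comp e.continuous.continuousOn fun x hx => ?_
    change e.symm (e x) ∈ K.openStar v
    rwa [e.symm_apply_apply]
  · intro i j x hi hj
    refine hg.add_eq i j (e x) ?_ ?_
    · change e.symm (e x) ∈ K.openStar i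
      rwa [e.symm_apply_apply]
    · change e.symm (e x) ∈ K.openStar j
      rwa [e.symm_apply_apply]

theorem IsCocycle.isCoboundary_or_of_homeomorph_RP2 {K : PreAbstractSimplicialComplex V}
    (e : K.carrier ≃ₜ RP2) {φ ψ : V → V → ZMod 2} (hφ : K.IsCocycle φ) (hψ : K.IsCocycle ψ) :
    K.IsCoboundary φ ∨ K.IsCoboundary ψ ∨ K.IsCoboundary (φ + ψ) := by
  have hq : Topology.IsQuotientMap (fun y : Sphere2 => e.symm (Quotient.mk antipodalSetoid y)) :=
    e.symm.isQuotientMap.comp isQuotientMap_quotient_mk'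
  have := exists_isTrivialization_of_antipodal hq (fun y z => by
      rw [e.symm.injective.eq_iff, Quotient.eq]
      rfl)
    K.openStar K.isOpen_openStar K.exists_mem_openStar φ ψ hφ.transition hψ.transition
  rcases this with ⟨g, hg⟩ | ⟨g, hg⟩ | ⟨g, hg⟩
  · exact Or.inl (isCoboundary_of_isTrivialization hg)
  · exact Or.inr (Or.inl (isCoboundary_of_isTrivialization hg))
  · exact Or.inr (Or.inr (isCoboundary_of_isTrivialization hg))

end PreAbstractSimplicialComplex

/-! ### Mod 2 chains of facets, `bettiAt` and Euler's relation for vertex links. -/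

noncomputable section Coned

variable {V : Type*}

/-- The facets of a normal `3`-pseudomanifold all of whose edges lie in the star of `t`.
Connectedness of the stars of the faces is expressed by `ZMod 2`-colourings of the facets. -/
structure IsConedNormal (𝓕 : Finset (Finset V)) (t : V) : Prop where
  nonempty : 𝓕.Nonempty
  card_eq : ∀ F ∈ 𝓕, F.card = 4
  two_facets : ∀ ρ : Finset V, ρ.card = 3 → (∃ F ∈ 𝓕, ρ ⊆ F) → (𝓕.filter (ρ ⊆ ·)).card = 2
  conn : ∀ σ : Finset V, σ.card ≤ 2 → ∀ c : Finset V → ZMod 2,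
    (∀ F ∈ 𝓕, ∀ G ∈ 𝓕, σ ⊆ F → σ ⊆ G → (F ∩ G).card = 3 → c F = c G) →
    ∀ F ∈ 𝓕, ∀ G ∈ 𝓕, σ ⊆ F → σ ⊆ G → c F = c G
  cone : ∀ F ∈ 𝓕, ∀ x ∈ F, ∀ y ∈ F, ∃ G ∈ 𝓕, {t, x, y} ⊆ G

/-- The mod `2` boundary of a chain of facets. -/
def bd (𝓕 : Finset (Finset V)) (c : Finset V → ZMod 2) (ρ : Finset V) : ZMod 2 :=
  ∑ F ∈ 𝓕.filter (ρ ⊆ ·), c F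

/-- The `2`-faces. -/
def ridges (𝓕 : Finset (Finset V)) : Finset (Finset V) := 𝓕.biUnion (Finset.powersetCard 3)

theorem mem_ridges {𝓕 : Finset (Finset V)} {ρ : Finset V} :
    ρ ∈ ridges 𝓕 ↔ ρ.card = 3 ∧ ∃ F ∈ 𝓕, ρ ⊆ F := by
  simp only [ridges, Finset.mem_biUnion, Finset.mem_powersetCard]
  tauto

theorem bd_eq_zero_of_not_mem {𝓕 : Finset (Finset V)} {c : Finset V → ZMod 2} {ρ : Finset V}
    (h : ¬ ∃ F ∈ 𝓕, ρ ⊆ F) : bd 𝓕 c ρ = 0 := by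
  rw [bd, Finset.filter_false_of_mem, Finset.sum_empty]
  exact fun F hF hs => h ⟨F, hF, hs⟩

theorem Finset.eq_inter_of_card_three {F G ρ : Finset V} (hF : F.card = 4) (hG : G.card = 4)
    (hne : F ≠ G) (hρ : ρ.card = 3) (h1 : ρ ⊆ F) (h2 : ρ ⊆ G) : F ∩ G = ρ := by
  refine (Finset.eq_of_subset_of_card_le (Finset.subset_inter h1 h2) ?_).symm
  by_contra hlt
  have h3 : 4 ≤ (F ∩ G).card := by omega
  have h4 : F ∩ G = F := Finset.eq_of_subset_of_card_le Finset.inter_subset_left (by omega)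
  have h5 : F ∩ G = G := Finset.eq_of_subset_of_card_le Finset.inter_subset_right (by omega)
  exact hne (h4.symm.trans h5)

theorem Finset.exists_erase_of_card {F ρ : Finset V} {n : ℕ} (hF : F.card = n + 1)
    (hρ : ρ.card = n) (h : ρ ⊆ F) : ∃ y ∈ F, ρ = F.erase y := by
  have h1 : (F \ ρ).card = 1 := by rw [Finset.card_sdiff_of_subset h]; omega
  obtain ⟨y, hy⟩ := Finset.card_eq_one.1 h1
  have hy' : y ∈ F \ ρ := by rw [hy]; simp
  rw [Finset.mem_sdiff] at hy'
  refine ⟨y, hy'.1, Finset.eq_of_subset_of_card_le (fun z hz => ?_) ?_⟩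
  · exact Finset.mem_erase.2 ⟨fun e => hy'.2 (e ▸ hz), h hz⟩
  · rw [Finset.card_erase_of_mem hy'.1]; omega

/-- The triangles of a tetrahedron correspond to the omitted vertices. -/
theorem sum_ridges_subset {𝓕 : Finset (Finset V)} {F : Finset V} (hF : F ∈ 𝓕)
    (hc : F.card = 4) {M : Type*} [AddCommMonoid M] (P : Finset V → Prop)
    [DecidablePred P] (g : Finset V → M) :
    ∑ ρ ∈ (ridges 𝓕).filter (fun ρ => P ρ ∧ ρ ⊆ F), g ρ =
      ∑ y ∈ F.filter (fun y => P (F.erase y)), g (F.erase y) := by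
  symm
  refine Finset.sum_bij (fun y _ => F.erase y) ?_ ?_ ?_ fun _ _ => rfl
  · intro y hy
    rw [Finset.mem_filter] at hy
    rw [Finset.mem_filter, mem_ridges, Finset.card_erase_of_mem hy.1]
    exact ⟨⟨by omega, F, hF, Finset.erase_subset _ _⟩, hy.2, Finset.erase_subset _ _⟩
  · intro y hy z hz h
    rw [Finset.mem_filter] at hy hz
    exact Finset.erase_injOn F hy.1 hz.1 h
  · intro ρ hρ
    rw [Finset.mem_filter, mem_ridges] at hρ
    obtain ⟨y, hy, rfl⟩ := Finset.exists_erase_of_card hc hρ.1.1 hρ.2.2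
    exact ⟨y, Finset.mem_filter.2 ⟨hy, hρ.2.1⟩, rfl⟩

theorem sum_ridges_comm {𝓕 : Finset (Finset V)} {M : Type*} [AddCommMonoid M]
    (P : Finset V → Prop) [DecidablePred P] (g : Finset V → Finset V → M) :
    ∑ ρ ∈ (ridges 𝓕).filter P, ∑ F ∈ 𝓕.filter (ρ ⊆ ·), g ρ F =
      ∑ F ∈ 𝓕, ∑ ρ ∈ (ridges 𝓕).filter (fun ρ => P ρ ∧ ρ ⊆ F), g ρ F := by
  refine Finset.sum_comm' fun ρ F => ?_
  simp only [Finset.mem_filter]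
  tauto

theorem even_card_eq_zero {M : Type*} {s : Finset M} (h : s.card = 2) (a : ZMod 2) :
    ∑ _y ∈ s, a = 0 := by
  rw [Finset.sum_const, h, two_nsmul, CharTwo.add_self_eq_zero]

namespace IsConedNormal

variable {𝓕 : Finset (Finset V)} {t : V} (h : IsConedNormal 𝓕 t)
include h

theorem exists_other {F ρ : Finset V} (hF : F ∈ 𝓕) (hρ : ρ.card = 3) (hs : ρ ⊆ F) :
    ∃ G ∈ 𝓕, G ≠ F ∧ ρ ⊆ G ∧ F ∩ G = ρ ∧ 𝓕.filter (ρ ⊆ ·) = {F, G} := by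
  have h2 := h.two_facets ρ hρ ⟨F, hF, hs⟩
  obtain ⟨A, B, hne, hAB⟩ := Finset.card_eq_two.1 h2
  have hA : A ∈ 𝓕.filter (ρ ⊆ ·) := by rw [hAB]; simp
  have hB : B ∈ 𝓕.filter (ρ ⊆ ·) := by rw [hAB]; simp
  have hF' : F ∈ 𝓕.filter (ρ ⊆ ·) := Finset.mem_filter.2 ⟨hF, hs⟩
  rw [Finset.mem_filter] at hA hB
  rw [hAB, Finset.mem_insert, Finset.mem_singleton] at hF'
  rcases hF' with rfl | rfl
  · exact ⟨B, hB.1, hne.symm, hB.2, Finset.eq_inter_of_card_three (h.card_eq _ hF)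
      (h.card_eq _ hB.1) hne hρ hs hB.2, hAB⟩
  · exact ⟨A, hA.1, hne, hA.2, Finset.eq_inter_of_card_three (h.card_eq _ hF)
      (h.card_eq _ hA.1) hne.symm hρ hs hA.2, by rw [hAB, Finset.pair_comm]⟩

theorem filter_eq_pair {F G : Finset V} (hF : F ∈ 𝓕) (hG : G ∈ 𝓕) (hρ : (F ∩ G).card = 3) :
    F ≠ G ∧ 𝓕.filter (F ∩ G ⊆ ·) = {F, G} := by
  have hne : F ≠ G := by
    rintro rfl
    rw [Finset.inter_self, h.card_eq F hF] at hρ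
    omega
  refine ⟨hne, ?_⟩
  symm
  refine Finset.eq_of_subset_of_card_le ?_ ?_
  · intro H hH
    rw [Finset.mem_insert, Finset.mem_singleton] at hH
    rcases hH with rfl | rfl
    · exact Finset.mem_filter.2 ⟨hF, Finset.inter_subset_left⟩
    · exact Finset.mem_filter.2 ⟨hG, Finset.inter_subset_right⟩
  · rw [h.two_facets _ hρ ⟨F, hF, Finset.inter_subset_left⟩, Finset.card_pair hne]

theorem bd_inter (c : Finset V → ZMod 2) {F G : Finset V} (hF : F ∈ 𝓕) (hG : G ∈ 𝓕)
    (hρ : (F ∩ G).card = 3) : bd 𝓕 c (F ∩ G) = c F + c G := by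
  obtain ⟨hne, he⟩ := h.filter_eq_pair hF hG hρ
  rw [bd, he, Finset.sum_pair hne]

/-- A vanishing boundary means that `c` does not jump between adjacent facets of the star. -/
theorem eq_of_bd_eq_zero {σ : Finset V} (hσ : σ.card ≤ 2) {c : Finset V → ZMod 2}
    (hc : ∀ ρ ∈ ridges 𝓕, σ ⊆ ρ → bd 𝓕 c ρ = 0) :
    ∀ F ∈ 𝓕, ∀ G ∈ 𝓕, σ ⊆ F → σ ⊆ G → c F = c G := by
  refine h.conn σ hσ c fun F hF G hG h1 h2 h3 => ?_
  have := hc (F ∩ G) (mem_ridges.2 ⟨h3, F, hF, Finset.inter_subset_left⟩)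
    (Finset.subset_inter h1 h2)
  rw [h.bd_inter c hF hG h3] at this
  exact zmod_two_eq_of_add_eq_zero this

/-- Every facet containing the edge `σ` has exactly two triangles containing `σ`, and these
contributions cancel. -/
theorem sum_bd_eq_zero {σ : Finset V} (hσ : σ.card = 2) (c : Finset V → ZMod 2) :
    ∑ ρ ∈ (ridges 𝓕).filter (σ ⊆ ·), bd 𝓕 c ρ = 0 := by
  simp only [bd]
  rw [sum_ridges_comm]
  refine Finset.sum_eq_zero fun F hF => ?_
  rw [sum_ridges_subset hF (h.card_eq F hF) (fun ρ => σ ⊆ ρ)]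
  by_cases hs : σ ⊆ F
  · apply even_card_eq_zero
    have : F.filter (fun y => σ ⊆ F.erase y) = F \ σ := by
      ext y
      simp only [Finset.mem_filter, Finset.mem_sdiff, Finset.subset_erase]
      tauto
    rw [this, Finset.card_sdiff_of_subset hs, h.card_eq F hF, hσ]
  · rw [Finset.filter_false_of_mem, Finset.sum_empty]
    intro y _ hy
    exact hs (hy.trans (Finset.erase_subset _ _))

/-- The boundary along `{t, x, p}` in terms of the boundary away from `t`. -/
theorem bd_cone {x p : V} (hxp : x ≠ p) (hxt : x ≠ t) (hpt : p ≠ t) (c : Finset V → ZMod 2) :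
    bd 𝓕 c {t, x, p} =
      ∑ ρ ∈ (ridges 𝓕).filter (fun ρ => {x, p} ⊆ ρ ∧ t ∉ ρ), bd 𝓕 c ρ := by
  have h1 := h.sum_bd_eq_zero (σ := {x, p}) (Finset.card_pair hxp) c
  rw [← Finset.sum_filter_add_sum_filter_not _ (fun ρ => t ∉ ρ), Finset.filter_filter,
    Finset.filter_filter] at h1
  rw [zmod_two_eq_of_add_eq_zero h1]
  have hcard : ({t, x, p} : Finset V).card = 3 := by
    rw [Finset.card_eq_three]
    exact ⟨t, x, p, hxt.symm, hpt.symm, hxp, rfl⟩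
  by_cases hm : {t, x, p} ∈ ridges 𝓕
  · rw [Finset.sum_eq_single_of_mem {t, x, p}]
    · simp [hm]
    · intro ρ hρ hne
      exfalso
      simp only [Finset.mem_filter, not_not, mem_ridges] at hρ
      refine hne (Finset.eq_of_subset_of_card_le ?_ (by rw [hcard, hρ.1.1])).symm
      intro y hy
      simp only [Finset.mem_insert, Finset.mem_singleton] at hy
      rcases hy with rfl | rfl | rfl
      · exact hρ.2.2
      · exact hρ.2.1 (by simp)
      · exact hρ.2.1 (by simp)
  · rw [bd_eq_zero_of_not_mem fun he => hm (mem_ridges.2 ⟨hcard, he⟩)]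
    symm
    refine Finset.sum_eq_zero fun ρ hρ => ?_
    exfalso
    simp only [Finset.mem_filter, not_not, mem_ridges] at hρ
    refine hm (mem_ridges.2 ⟨hcard, ?_⟩)
    obtain ⟨F, hF, hs⟩ := hρ.1.2
    refine ⟨F, hF, fun y hy => hs ?_⟩
    simp only [Finset.mem_insert, Finset.mem_singleton] at hy
    rcases hy with rfl | rfl | rfl
    · exact hρ.2.2
    · exact hρ.2.1 (by simp)
    · exact hρ.2.1 (by simp)

end IsConedNormal

/-- The `2`-faces containing `x` but not `t`. -/
def ridgesAt (𝓕 : Finset (Finset V)) (t x : V) : Finset (Finset V) :=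
  (ridges 𝓕).filter fun ρ => x ∈ ρ ∧ t ∉ ρ

/-- The number of facets containing `x` but not `t`. -/
def outerCount (𝓕 : Finset (Finset V)) (t x : V) : ℕ :=
  (𝓕.filter fun F => x ∈ F ∧ t ∉ F).card

/-- The number of facets containing `x` and `t`. -/
def innerCount (𝓕 : Finset (Finset V)) (t x : V) : ℕ :=
  (𝓕.filter fun F => x ∈ F ∧ t ∈ F).card

/-- A function on the `2`-faces at `x` avoiding `t` that has even sum over every facet at `x`. -/
structure IsEvenAt (𝓕 : Finset (Finset V)) (t x : V) (φ : Finset V → ZMod 2) : Prop where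
  eq_zero : ∀ ρ, ρ ∉ ridgesAt 𝓕 t x → φ ρ = 0
  sum_eq_zero : ∀ F ∈ 𝓕, x ∈ F → ∑ ρ ∈ (ridgesAt 𝓕 t x).filter (· ⊆ F), φ ρ = 0

/-- The incidence matrix between the facets at `x` and the `2`-faces at `x` avoiding `t`. -/
def incidence (𝓕 : Finset (Finset V)) (t x : V) :
    Matrix (𝓕.filter (x ∈ ·)) (ridgesAt 𝓕 t x) (ZMod 2) :=
  fun F ρ => if ρ.1 ⊆ F.1 then 1 else 0

/-- The first Betti number of the link of `x`, as the dimension of the space of even functions. -/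
def bettiAt (𝓕 : Finset (Finset V)) (t x : V) : ℕ :=
  Module.finrank (ZMod 2) (LinearMap.ker (incidence 𝓕 t x).mulVecLin)

theorem mem_ker_incidence {𝓕 : Finset (Finset V)} {t x : V} {φ : Finset V → ZMod 2}
    (h : IsEvenAt 𝓕 t x φ) :
    (fun ρ : ridgesAt 𝓕 t x => φ ρ) ∈ LinearMap.ker (incidence 𝓕 t x).mulVecLin := by
  rw [LinearMap.mem_ker]
  ext F
  have hF := Finset.mem_filter.1 F.2
  rw [Matrix.mulVecLin_apply]
  have e : (incidence 𝓕 t x).mulVec (fun ρ : ridgesAt 𝓕 t x => φ ρ) F =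
      ∑ ρ : ridgesAt 𝓕 t x, if ρ.1 ⊆ F.1 then φ ρ.1 else 0 := by
    simp [Matrix.mulVec, dotProduct, incidence]
  rw [e, Finset.sum_coe_sort (ridgesAt 𝓕 t x) (fun ρ => if ρ ⊆ F.1 then φ ρ else 0),
    ← Finset.sum_filter]
  exact h.sum_eq_zero F.1 hF.1 hF.2

theorem isEvenAt_of_mem_ker {𝓕 : Finset (Finset V)} {t x : V} {φ : ridgesAt 𝓕 t x → ZMod 2}
    (h : φ ∈ LinearMap.ker (incidence 𝓕 t x).mulVecLin) :
    IsEvenAt 𝓕 t x (fun ρ => if hρ : ρ ∈ ridgesAt 𝓕 t x then φ ⟨ρ, hρ⟩ else 0) := by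
  refine ⟨fun ρ hρ => dif_neg hρ, fun F hF hx => ?_⟩
  rw [LinearMap.mem_ker] at h
  have h1 := congrFun h ⟨F, Finset.mem_filter.2 ⟨hF, hx⟩⟩
  rw [Matrix.mulVecLin_apply] at h1
  rw [Finset.sum_filter, ← Finset.sum_coe_sort]
  refine Eq.trans ?_ h1
  simp [Matrix.mulVec, dotProduct, incidence]

theorem bettiAt_eq_zero_of_forall {𝓕 : Finset (Finset V)} {t x : V}
    (h : ∀ φ, IsEvenAt 𝓕 t x φ → φ = 0) : bettiAt 𝓕 t x = 0 := by
  rw [bettiAt, Submodule.finrank_eq_zero, eq_bot_iff]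
  intro φ hφ
  rw [Submodule.mem_bot]
  have h1 := h _ (isEvenAt_of_mem_ker hφ)
  ext ρ
  have := congrFun h1 ρ.1
  simpa using this

theorem exists_isEvenAt_of_bettiAt_ne_zero {𝓕 : Finset (Finset V)} {t x : V}
    (hb : bettiAt 𝓕 t x ≠ 0) : ∃ φ, IsEvenAt 𝓕 t x φ ∧ φ ≠ 0 := by
  by_contra! hn
  exact hb (bettiAt_eq_zero_of_forall hn)

/-- A line over `ZMod 2` has a single nonzero element. -/
theorem eq_zero_or_eq_of_bettiAt_le_one {𝓕 : Finset (Finset V)} {t x : V}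
    (hb : bettiAt 𝓕 t x ≤ 1) {φ ψ : Finset V → ZMod 2} (hφ : IsEvenAt 𝓕 t x φ)
    (hψ : IsEvenAt 𝓕 t x ψ) (h0 : φ ≠ 0) : ψ = 0 ∨ ψ = φ := by
  rw [bettiAt, finrank_le_one_iff] at hb
  obtain ⟨v, hv⟩ := hb
  obtain ⟨a, ha⟩ := hv ⟨_, mem_ker_incidence hφ⟩
  obtain ⟨b, hb⟩ := hv ⟨_, mem_ker_incidence hψ⟩
  have ext : ∀ {χ}, IsEvenAt 𝓕 t x χ → ∀ {χ'}, IsEvenAt 𝓕 t x χ' →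
      (∀ ρ : ridgesAt 𝓕 t x, χ ρ = χ' ρ) → χ = χ' := by
    intro χ hχ χ' hχ' he
    ext ρ
    by_cases hρ : ρ ∈ ridgesAt 𝓕 t x
    · exact he ⟨ρ, hρ⟩
    · rw [hχ.eq_zero ρ hρ, hχ'.eq_zero ρ hρ]
  have hz : IsEvenAt 𝓕 t x 0 := ⟨fun _ _ => rfl, fun _ _ _ => by simp⟩
  have h01 : ∀ a : ZMod 2, a = 0 ∨ a = 1 := by decide
  rcases h01 a with rfl | rfl
  · refine (h0 (ext hφ hz fun ρ => ?_)).elim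
    have := congrFun (congrArg Subtype.val ha) ρ
    simpa using this.symm
  rcases h01 b with rfl | rfl
  · refine Or.inl (ext hψ hz fun ρ => ?_)
    have := congrFun (congrArg Subtype.val hb) ρ
    simpa using this.symm
  · refine Or.inr (ext hψ hφ fun ρ => ?_)
    have := congrFun (congrArg Subtype.val (ha.symm.trans hb)) ρ
    exact this.symm

theorem bettiAt_le_one_of_forall {𝓕 : Finset (Finset V)} {t x : V}
    (h : ∀ φ ψ, IsEvenAt 𝓕 t x φ → IsEvenAt 𝓕 t x ψ → φ = 0 ∨ ψ = 0 ∨ φ = ψ) :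
    bettiAt 𝓕 t x ≤ 1 := by
  by_cases hb : bettiAt 𝓕 t x = 0
  · omega
  obtain ⟨φ, hφ, h0⟩ := exists_isEvenAt_of_bettiAt_ne_zero hb
  rw [bettiAt, finrank_le_one_iff]
  refine ⟨⟨_, mem_ker_incidence hφ⟩, fun w => ?_⟩
  have hw := isEvenAt_of_mem_ker w.2
  rcases h _ _ hφ hw with h1 | h1 | h1
  · exact (h0 h1).elim
  · refine ⟨0, Subtype.ext (funext fun ρ => ?_)⟩
    have := congrFun h1 ρ.1
    simpa using this.symm
  · refine ⟨1, Subtype.ext (funext fun ρ => ?_)⟩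
    have := congrFun h1 ρ.1
    simpa using this

/-- The boundary operator is the transpose of the incidence matrix, so its image is orthogonal to
the kernel of that matrix. -/
theorem sum_mul_bd_eq_zero {𝓕 : Finset (Finset V)} {t x : V} {φ : Finset V → ZMod 2}
    (hφ : IsEvenAt 𝓕 t x φ) (c : Finset V → ZMod 2) :
    ∑ ρ ∈ ridgesAt 𝓕 t x, φ ρ * bd 𝓕 c ρ = 0 := by
  simp only [bd, Finset.mul_sum]
  rw [ridgesAt, sum_ridges_comm]
  refine Finset.sum_eq_zero fun F hF => ?_
  rw [← Finset.sum_mul]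
  by_cases hx : x ∈ F
  · have := hφ.sum_eq_zero F hF hx
    rw [ridgesAt, Finset.filter_filter] at this
    rw [this, zero_mul]
  · rw [Finset.filter_false_of_mem, Finset.sum_empty, zero_mul]
    exact fun ρ _ hρ => hx (hρ.2 hρ.1.1)

namespace IsConedNormal

variable {𝓕 : Finset (Finset V)} {t : V} (h : IsConedNormal 𝓕 t)
include h

/-- By `bd_cone` the boundary then also vanishes on the triangles through `t`, so connectedness of
the star of `x` applies. -/
theorem eq_of_bd_ridgesAt_eq_zero {x : V} (hxt : x ≠ t) {c : Finset V → ZMod 2}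
    (hc : ∀ ρ ∈ ridgesAt 𝓕 t x, bd 𝓕 c ρ = 0) :
    ∀ F ∈ 𝓕, ∀ G ∈ 𝓕, x ∈ F → x ∈ G → c F = c G := by
  have := h.eq_of_bd_eq_zero (σ := {x}) (c := c) (by simp) fun ρ hρ hx => by
    rw [Finset.singleton_subset_iff] at hx
    by_cases ht : t ∈ ρ
    · have h3 := (mem_ridges.1 hρ).1
      have h1 : ((ρ.erase t).erase x).card = 1 := by
        rw [Finset.card_erase_of_mem (Finset.mem_erase.2 ⟨hxt, hx⟩), Finset.card_erase_of_mem ht]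
        omega
      obtain ⟨p, hp⟩ := Finset.card_eq_one.1 h1
      have hp' : p ∈ (ρ.erase t).erase x := by rw [hp]; simp
      simp only [Finset.mem_erase] at hp'
      have e : ρ = {t, x, p} := by
        rw [← Finset.insert_erase ht, ← Finset.insert_erase (Finset.mem_erase.2 ⟨hxt, hx⟩), hp]
      rw [e, h.bd_cone hp'.1.symm hxt hp'.2.1]
      refine Finset.sum_eq_zero fun ρ' hρ' => hc ρ' ?_
      rw [Finset.mem_filter] at hρ'
      exact Finset.mem_filter.2 ⟨hρ'.1, hρ'.2.1 (by simp), hρ'.2.2⟩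
    · exact hc ρ (Finset.mem_filter.2 ⟨hρ, hx, ht⟩)
  simpa using this

/-- Incident pairs are counted twice. A facet at `x` without `t` has three triangles at `x`, and a
facet containing `xt` has one triangle at `x` that avoids `t`. -/
theorem two_mul_card_ridgesAt {x : V} (hxt : x ≠ t) :
    2 * (ridgesAt 𝓕 t x).card = 3 * outerCount 𝓕 t x + innerCount 𝓕 t x := by
  have h1 : ∑ ρ ∈ ridgesAt 𝓕 t x, ∑ F ∈ 𝓕.filter (ρ ⊆ ·), 1 = 2 * (ridgesAt 𝓕 t x).card := by
    rw [mul_comm, ← smul_eq_mul]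
    refine Finset.sum_const_nat fun ρ hρ => ?_
    rw [Finset.sum_const, smul_eq_mul, mul_one]
    have := mem_ridges.1 (Finset.mem_filter.1 hρ).1
    exact h.two_facets ρ this.1 this.2
  rw [← h1, ridgesAt, sum_ridges_comm]
  have h2 : ∀ F ∈ 𝓕, ∑ ρ ∈ (ridges 𝓕).filter (fun ρ => (x ∈ ρ ∧ t ∉ ρ) ∧ ρ ⊆ F), 1 =
      (if x ∈ F ∧ t ∉ F then 3 else 0) + if x ∈ F ∧ t ∈ F then 1 else 0 := by
    intro F hF
    rw [sum_ridges_subset hF (h.card_eq F hF) (fun ρ => x ∈ ρ ∧ t ∉ ρ) (fun _ => 1),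
      Finset.sum_const, smul_eq_mul, mul_one]
    by_cases hx : x ∈ F
    · by_cases ht : t ∈ F
      · simp only [hx, ht, not_true_eq_false, and_false, if_false, and_self, if_true, zero_add]
        rw [Finset.card_eq_one]
        refine ⟨t, ?_⟩
        ext y
        simp only [Finset.mem_filter, Finset.mem_erase, Finset.mem_singleton, hx, ht]
        constructor
        · rintro ⟨-, -, h⟩
          by_contra hne
          exact h ⟨fun e => hne e.symm, trivial⟩
        · rintro rfl
          exact ⟨ht, ⟨hxt, trivial⟩, fun h => h.1 rfl⟩
      · simp only [hx, ht, not_false_eq_true, and_self, if_true, and_false, if_false, add_zero]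
        have : F.filter (fun y => x ∈ F.erase y ∧ t ∉ F.erase y) = F.erase x := by
          ext y
          simp only [Finset.mem_filter, Finset.mem_erase, hx, ht]
          grind
        rw [this, Finset.card_erase_of_mem hx, h.card_eq F hF]
    · simp only [hx, false_and, if_false, add_zero, Finset.card_eq_zero]
      refine Finset.filter_false_of_mem fun y _ hy => hx ?_
      exact Finset.mem_of_mem_erase hy.1
  rw [Finset.sum_congr rfl h2, Finset.sum_add_distrib, ← Finset.sum_filter, ← Finset.sum_filter,
    Finset.sum_const, Finset.sum_const, outerCount, innerCount]
  simp only [smul_eq_mul, mul_one]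
  ring

omit h in
theorem card_filter_mem_eq (x : V) :
    (𝓕.filter (x ∈ ·)).card = outerCount 𝓕 t x + innerCount 𝓕 t x := by
  rw [outerCount, innerCount, ← Finset.card_union_of_disjoint]
  · congr 1
    ext F
    simp only [Finset.mem_filter, Finset.mem_union]
    tauto
  · rw [Finset.disjoint_left]
    intro F h1 h2
    exact (Finset.mem_filter.1 h1).2.2 (Finset.mem_filter.1 h2).2.2

omit h in
theorem transpose_incidence_mulVec (x : V) (c : Finset V → ZMod 2) (ρ : ridgesAt 𝓕 t x) :
    (incidence 𝓕 t x).transpose.mulVec (fun F => c F.1) ρ = bd 𝓕 c ρ.1 := by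
  have e : (incidence 𝓕 t x).transpose.mulVec (fun F => c F.1) ρ =
      ∑ F : 𝓕.filter (x ∈ ·), if ρ.1 ⊆ F.1 then c F.1 else 0 := by
    simp [Matrix.mulVec, dotProduct, incidence]
  have hx := (Finset.mem_filter.1 ρ.2).2.1
  rw [e, Finset.sum_coe_sort (𝓕.filter (x ∈ ·)) (fun F => if ρ.1 ⊆ F then c F else 0),
    ← Finset.sum_filter, Finset.filter_filter, bd]
  refine Finset.sum_congr (Finset.filter_congr fun F _ => ?_) fun _ _ => rfl
  exact ⟨fun h => h.2, fun h => ⟨h hx, h⟩⟩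

/-- Rank-nullity is applied to the incidence matrix and to its transpose, which have the same rank.
-/
theorem bettiAt_add {x : V} (hxt : x ≠ t) (hx : ∃ F ∈ 𝓕, x ∈ F) :
    bettiAt 𝓕 t x + (outerCount 𝓕 t x + innerCount 𝓕 t x) = (ridgesAt 𝓕 t x).card + 1 := by
  obtain ⟨F0, hF0, hx0⟩ := hx
  set A := incidence 𝓕 t x with hA
  have r1 : A.rank + bettiAt 𝓕 t x = (ridgesAt 𝓕 t x).card := by
    have := A.mulVecLin.finrank_range_add_finrank_ker
    rw [Module.finrank_fintype_fun_eq_card, Fintype.card_coe] at this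
    exact this
  have r2 : A.rank + Module.finrank (ZMod 2) (LinearMap.ker A.transpose.mulVecLin) =
      (𝓕.filter (x ∈ ·)).card := by
    have := A.transpose.mulVecLin.finrank_range_add_finrank_ker
    rw [Module.finrank_fintype_fun_eq_card, Fintype.card_coe] at this
    rw [← Matrix.rank_transpose]
    exact this
  -- The kernel of the transpose consists of the functions without boundary, that is, of the
  -- constants on the star of `x`.
  have r3 : Module.finrank (ZMod 2) (LinearMap.ker A.transpose.mulVecLin) = 1 := by
    rw [finrank_eq_one_iff']
    have hm : (fun _ => 1 : 𝓕.filter (x ∈ ·) → ZMod 2) ∈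
        LinearMap.ker A.transpose.mulVecLin := by
      rw [LinearMap.mem_ker, Matrix.mulVecLin_apply]
      ext ρ
      rw [transpose_incidence_mulVec x (fun _ => 1)]
      have := mem_ridges.1 (Finset.mem_filter.1 ρ.2).1
      exact even_card_eq_zero (h.two_facets _ this.1 this.2) 1
    refine ⟨⟨_, hm⟩, fun e => ?_, fun w => ?_⟩
    · have := congrFun (congrArg Subtype.val e) ⟨F0, Finset.mem_filter.2 ⟨hF0, hx0⟩⟩
      exact one_ne_zero this
    · let c : Finset V → ZMod 2 := fun F => if hF : F ∈ 𝓕.filter (x ∈ ·) then w.1 ⟨F, hF⟩ else 0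
      have hc : (fun F : 𝓕.filter (x ∈ ·) => c F.1) = w.1 := by
        ext F
        exact dif_pos F.2
      have hw : A.transpose.mulVec w.1 = 0 := w.2
      have hconst := h.eq_of_bd_ridgesAt_eq_zero hxt (c := c) fun ρ hρ => by
        rw [← transpose_incidence_mulVec x c ⟨ρ, hρ⟩, hc, ← hA, hw]
        rfl
      refine ⟨c F0, Subtype.ext (funext fun F => ?_)⟩
      have hF := Finset.mem_filter.1 F.2
      rw [← hc]
      have := hconst F0 hF0 F.1 hF.1 hx0 hF.2
      simpa using this
  have := card_filter_mem_eq (𝓕 := 𝓕) (t := t) x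
  omega

/-- This is Euler's relation for the link of `x`: there `t` is adjacent to all other vertices, so
`innerCount` counts those vertices as well as the triangles at `t`. -/
theorem outerCount_add_two {x : V} (hxt : x ≠ t) (hx : ∃ F ∈ 𝓕, x ∈ F) :
    outerCount 𝓕 t x + 2 = innerCount 𝓕 t x + 2 * bettiAt 𝓕 t x := by
  have h1 := h.bettiAt_add hxt hx
  have h2 := h.two_mul_card_ridgesAt hxt
  omega

-- With trivial kernel the incidence matrix has full column rank, so its transpose is surjective and
-- every function is a boundary.
omit h in
theorem exists_bd_eq {x : V} (hb : bettiAt 𝓕 t x = 0) (g : Finset V → ZMod 2) :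
    ∃ c, ∀ ρ ∈ ridgesAt 𝓕 t x, bd 𝓕 c ρ = g ρ := by
  set A := incidence 𝓕 t x with hA
  have r1 : A.rank = (ridgesAt 𝓕 t x).card := by
    have := A.mulVecLin.finrank_range_add_finrank_ker
    rw [Module.finrank_fintype_fun_eq_card, Fintype.card_coe] at this
    rw [bettiAt, ← hA] at hb
    rw [hb] at this
    exact this
  have hs : LinearMap.range A.transpose.mulVecLin = ⊤ := by
    apply Submodule.eq_top_of_finrank_eq
    rw [Module.finrank_fintype_fun_eq_card, Fintype.card_coe, ← r1, ← Matrix.rank_transpose]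
    rfl
  obtain ⟨w, hw⟩ := LinearMap.range_eq_top.1 hs fun ρ => g ρ.1
  let c : Finset V → ZMod 2 := fun F => if hF : F ∈ 𝓕.filter (x ∈ ·) then w ⟨F, hF⟩ else 0
  have hc : (fun F : 𝓕.filter (x ∈ ·) => c F.1) = w := by
    ext F
    exact dif_pos F.2
  refine ⟨c, fun ρ hρ => ?_⟩
  rw [← transpose_incidence_mulVec x c ⟨ρ, hρ⟩, hc]
  exact congrFun hw ⟨ρ, hρ⟩

end IsConedNormal

end Coned

/-! ### Even functions as cocycles on a link. -/

noncomputable section CocycleLink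

variable {V : Type*}

/-- The complex with the given facets. -/
def ofFacets (𝓕 : Finset (Finset V)) : PreAbstractSimplicialComplex V where
  faces := {ρ | ρ.Nonempty ∧ ∃ F ∈ 𝓕, ρ ⊆ F}
  isRelLowerSet_faces := by
    rintro ρ ⟨h1, F, hF, h2⟩
    exact ⟨h1, fun τ hτ hn => ⟨hn, F, hF, Finset.Subset.trans hτ h2⟩⟩

theorem mem_ofFacets {𝓕 : Finset (Finset V)} {ρ : Finset V} :
    ρ ∈ ofFacets 𝓕 ↔ ρ.Nonempty ∧ ∃ F ∈ 𝓕, ρ ⊆ F := Iff.rfl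

theorem mem_link_ofFacets {𝓕 : Finset (Finset V)} {σ τ : Finset V} :
    τ ∈ (ofFacets 𝓕).link σ ↔ τ.Nonempty ∧ Disjoint σ τ ∧ ∃ F ∈ 𝓕, σ ∪ τ ⊆ F := by
  constructor
  · rintro ⟨h1, h2, h3⟩
    exact ⟨h1.1, h2, h3.2⟩
  · rintro ⟨h1, h2, F, hF, h3⟩
    exact ⟨⟨h1, F, hF, Finset.subset_union_right.trans h3⟩, h2,
      h1.mono Finset.subset_union_right, F, hF, h3⟩

theorem Finset.card_three_of_ne {x u v : V} (h1 : x ≠ u) (h2 : x ≠ v) (h3 : u ≠ v) :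
    ({x, u, v} : Finset V).card = 3 := Finset.card_eq_three.2 ⟨x, u, v, h1, h2, h3, rfl⟩

theorem Finset.card_four_of_ne {x u v w : V} (h1 : x ≠ u) (h2 : x ≠ v) (h3 : x ≠ w) (h4 : u ≠ v)
    (h5 : u ≠ w) (h6 : v ≠ w) : ({x, u, v, w} : Finset V).card = 4 := by
  rw [Finset.card_insert_of_notMem (by simp [h1, h2, h3]), Finset.card_three_of_ne h4 h5 h6]

/-- For a facet `xuvw` the even sum over its three triangles at `x` is the cocycle rule. Triples
with repetitions are covered by the vanishing of `φ` on sets that are not triangles. -/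
theorem isCocycle_link {𝓕 : Finset (Finset V)} (hc : ∀ F ∈ 𝓕, F.card = 4) {x : V}
    {φ : Finset V → ZMod 2} (h0 : ∀ ρ, ρ ∉ ridges 𝓕 → φ ρ = 0)
    (hs : ∀ F ∈ 𝓕, x ∈ F → ∑ ρ ∈ (ridges 𝓕).filter (fun ρ => x ∈ ρ ∧ ρ ⊆ F), φ ρ = 0) :
    ((ofFacets 𝓕).link {x}).IsCocycle fun u v => φ {x, u, v} := by
  have hdeg : ∀ u, φ {x, u, u} = 0 := fun u => h0 _ fun hm => by
    have h1 := (mem_ridges.1 hm).1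
    have h2 : ({x, u, u} : Finset V).card ≤ 2 := by
      rw [Finset.pair_eq_singleton]; exact Finset.card_le_two
    omega
  intro u v w huvw
  obtain ⟨-, hd, F, hF, hsub⟩ := mem_link_ofFacets.1 huvw
  rw [Finset.disjoint_singleton_left] at hd
  simp only [Finset.mem_insert, Finset.mem_singleton, not_or] at hd
  by_cases huv : u = v
  · subst huv; beta_reduce; rw [hdeg, zero_add]
  by_cases hvw : v = w
  · subst hvw; beta_reduce; rw [hdeg, add_zero]
  by_cases huw : u = w
  · subst huw
    beta_reduce
    rw [hdeg, Finset.pair_comm v u, CharTwo.add_self_eq_zero]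
  have hFe : F = {x, u, v, w} := by
    symm
    refine Finset.eq_of_subset_of_card_le hsub ?_
    rw [hc F hF]
    exact (Finset.card_four_of_ne hd.1 hd.2.1 hd.2.2 huv huw hvw).ge
  have hxF : x ∈ F := by rw [hFe]; simp
  have h1 := hs F hF hxF
  rw [sum_ridges_subset hF (hc F hF) (fun ρ => x ∈ ρ)] at h1
  have h2 : F.filter (fun y => x ∈ F.erase y) = {u, v, w} := by
    ext y
    simp only [Finset.mem_filter, Finset.mem_erase, hFe, Finset.mem_insert, Finset.mem_singleton]
    constructor
    · rintro ⟨h3, h4, -⟩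
      exact h3.resolve_left fun e => h4 e.symm
    · rintro h3
      refine ⟨Or.inr h3, ?_, Or.inl trivial⟩
      rintro rfl
      tauto
  rw [h2, Finset.sum_insert (by simp [huv, huw]), Finset.sum_insert (by simp [hvw]),
    Finset.sum_singleton] at h1
  have e1 : F.erase u = {x, v, w} := by
    rw [hFe]; ext y; simp only [Finset.mem_erase, Finset.mem_insert, Finset.mem_singleton]; grind
  have e2 : F.erase v = {x, u, w} := by
    rw [hFe]; ext y; simp only [Finset.mem_erase, Finset.mem_insert, Finset.mem_singleton]; grind
  have e3 : F.erase w = {x, u, v} := by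
    rw [hFe]; ext y; simp only [Finset.mem_erase, Finset.mem_insert, Finset.mem_singleton]; grind
  rw [e1, e2, e3] at h1
  beta_reduce
  revert h1
  generalize φ {x, v, w} = a
  generalize φ {x, u, w} = b
  generalize φ {x, u, v} = c
  revert a b c
  decide

theorem IsEvenAt.isCocycle {𝓕 : Finset (Finset V)} (hc : ∀ F ∈ 𝓕, F.card = 4) {t x : V}
    {φ : Finset V → ZMod 2} (hφ : IsEvenAt 𝓕 t x φ) :
    ((ofFacets 𝓕).link {x}).IsCocycle fun u v => φ {x, u, v} := by
  refine isCocycle_link hc (fun ρ hρ => hφ.eq_zero ρ fun h => hρ (Finset.mem_filter.1 h).1)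
    fun F hF hx => ?_
  rw [← hφ.sum_eq_zero F hF hx]
  symm
  refine Finset.sum_subset ?_ fun ρ hρ hn => ?_
  · intro ρ hρ
    rw [Finset.mem_filter, ridgesAt, Finset.mem_filter] at hρ
    exact Finset.mem_filter.2 ⟨hρ.1.1, hρ.1.2.1, hρ.2⟩
  · refine hφ.eq_zero ρ fun hm => hn (Finset.mem_filter.2 ⟨hm, (Finset.mem_filter.1 hρ).2.2⟩)

namespace IsConedNormal

variable {𝓕 : Finset (Finset V)} {t : V} (h : IsConedNormal 𝓕 t)
include h

/-- Every vertex of a triangle at `x` spans a triangle with `x` and `t`. -/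
theorem cone_mem {F : Finset V} (hF : F ∈ 𝓕) {x y : V} (hx : x ∈ F) (hy : y ∈ F) :
    ∃ G ∈ 𝓕, t ∈ G ∧ x ∈ G ∧ y ∈ G := by
  obtain ⟨G, hG, hs⟩ := h.cone F hF x hx y hy
  exact ⟨G, hG, hs (by simp), hs (by simp), hs (by simp)⟩

/-- In the link of `x` every vertex is joined to `t` by an edge on which `φ` vanishes. The potential
`f` is therefore constant, and even functions inject into cohomology. -/
theorem eq_zero_of_isCoboundary {x : V} (hxt : x ≠ t) {φ : Finset V → ZMod 2}
    (hφ : IsEvenAt 𝓕 t x φ)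
    (hb : ((ofFacets 𝓕).link {x}).IsCoboundary fun u v => φ {x, u, v}) : φ = 0 := by
  obtain ⟨f, hf⟩ := hb
  have key : ∀ F ∈ 𝓕, ∀ p ∈ F, x ∈ F → x ≠ p → f t = f p := by
    intro F hF p hp hx hxp
    obtain ⟨G, hG, htG, hxG, hpG⟩ := h.cone_mem hF hx hp
    have h1 := hf t p (mem_link_ofFacets.2 ⟨by simp, by simp [hxt, hxp], G, hG, by
      intro y hy
      simp only [Finset.mem_union, Finset.mem_insert, Finset.mem_singleton] at hy
      rcases hy with rfl | rfl | rfl <;> assumption⟩)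
    beta_reduce at h1
    rw [hφ.eq_zero _ fun hm => (Finset.mem_filter.1 hm).2.2 (by simp)] at h1
    exact zmod_two_eq_of_add_eq_zero h1.symm
  ext ρ
  by_cases hρ : ρ ∈ ridgesAt 𝓕 t x
  · have hρ' := Finset.mem_filter.1 hρ
    obtain ⟨hc, F, hF, hs⟩ := mem_ridges.1 hρ'.1
    have h1 : (ρ.erase x).card = 2 := by rw [Finset.card_erase_of_mem hρ'.2.1]; omega
    obtain ⟨u, v, huv, he⟩ := Finset.card_eq_two.1 h1
    have e : ρ = {x, u, v} := by rw [← he, Finset.insert_erase hρ'.2.1]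
    have hu : u ∈ ρ.erase x := by rw [he]; simp
    have hv : v ∈ ρ.erase x := by rw [he]; simp
    rw [Finset.mem_erase] at hu hv
    have h2 := hf u v (mem_link_ofFacets.2 ⟨by simp, by simp [hu.1.symm, hv.1.symm], F, hF, by
      refine Finset.Subset.trans (fun y hy => ?_) hs
      rw [e]; exact hy⟩)
    rw [e]
    refine h2.trans ?_
    have hx : x ∈ F := hs hρ'.2.1
    rw [← key F hF u (hs hu.2) hx hu.1.symm, ← key F hF v (hs hv.2) hx hv.1.symm,
      CharTwo.add_self_eq_zero]
    rfl
  · exact hφ.eq_zero ρ hρ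

theorem bettiAt_eq_zero_of_homeomorph [Fintype V] {x : V} (hxt : x ≠ t)
    (e : ((ofFacets 𝓕).link {x}).carrier ≃ₜ Sphere2) : bettiAt 𝓕 t x = 0 :=
  bettiAt_eq_zero_of_forall fun _ hφ =>
    h.eq_zero_of_isCoboundary hxt hφ ((hφ.isCocycle h.card_eq).isCoboundary_of_homeomorph_sphere e)

omit h in
theorem _root_.IsEvenAt.add {x : V} {φ ψ : Finset V → ZMod 2} (hφ : IsEvenAt 𝓕 t x φ)
    (hψ : IsEvenAt 𝓕 t x ψ) : IsEvenAt 𝓕 t x (φ + ψ) := by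
  refine ⟨fun ρ hρ => ?_, fun F hF hx => ?_⟩
  · rw [Pi.add_apply, hφ.eq_zero ρ hρ, hψ.eq_zero ρ hρ, add_zero]
  · simp only [Pi.add_apply]
    rw [Finset.sum_add_distrib, hφ.sum_eq_zero F hF hx, hψ.sum_eq_zero F hF hx, add_zero]

theorem bettiAt_le_one_of_homeomorph [Fintype V] {x : V} (hxt : x ≠ t)
    (e : ((ofFacets 𝓕).link {x}).carrier ≃ₜ RP2) : bettiAt 𝓕 t x ≤ 1 := by
  refine bettiAt_le_one_of_forall fun φ ψ hφ hψ => ?_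
  rcases (hφ.isCocycle h.card_eq).isCoboundary_or_of_homeomorph_RP2 e (hψ.isCocycle h.card_eq)
    with h1 | h1 | h1
  · exact Or.inl (h.eq_zero_of_isCoboundary hxt hφ h1)
  · exact Or.inr (Or.inl (h.eq_zero_of_isCoboundary hxt hψ h1))
  · refine Or.inr (Or.inr ?_)
    have := h.eq_zero_of_isCoboundary hxt (hφ.add hψ) h1
    ext ρ
    exact zmod_two_eq_of_add_eq_zero (congrFun this ρ)

end IsConedNormal

end CocycleLink

/-! ### The link of `t` bounds `bettiAt` at the other vertices. -/

noncomputable section LinkBound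

/-- The functional `φ ↦ φ ⬝ᵥ z` vanishes on the kernel of `A`, hence factors through `A`. -/
theorem Matrix.exists_transpose_mulVec_eq {I J K : Type*} [Fintype I] [Fintype J] [Field K]
    (A : Matrix I J K) (z : J → K) (hz : ∀ φ, A.mulVec φ = 0 → φ ⬝ᵥ z = 0) :
    ∃ c, A.transpose.mulVec c = z := by
  let f : (J → K) →ₗ[K] K :=
    { toFun := fun φ => φ ⬝ᵥ z
      map_add' := fun a b => add_dotProduct a b z
      map_smul' := fun a b => smul_dotProduct a b z }
  have hf : f ∈ (LinearMap.ker A.mulVecLin).dualAnnihilator := by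
    rw [Submodule.mem_dualAnnihilator]
    exact fun φ hφ => hz φ hφ
  rw [← LinearMap.range_dualMap_eq_dualAnnihilator_ker] at hf
  obtain ⟨g, hg⟩ := hf
  refine ⟨fun i => g (Pi.single i 1), ?_⟩
  ext j
  have h1 : f (Pi.single j 1) = z j := by
    change Pi.single j 1 ⬝ᵥ z = z j
    rw [single_one_dotProduct]
  rw [← h1, ← hg]
  change _ = g (A.mulVec (Pi.single j 1))
  rw [Matrix.mulVec_single_one]
  conv_rhs => rw [LinearMap.pi_apply_eq_sum_univ g]
  simp only [Matrix.mulVec, dotProduct, Matrix.transpose_apply, Matrix.col_apply, smul_eq_mul]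
  refine Finset.sum_congr rfl fun i _ => ?_
  congr 2
  ext k
  simp [Pi.single_apply, eq_comm]

variable {V : Type*}

theorem exists_ne_of_sum_eq_zero {ι : Type*} {s : Finset ι} {f : ι → ZMod 2}
    (h : ∑ i ∈ s, f i = 0) {a : ι} (ha : a ∈ s) (hf : f a ≠ 0) : ∃ b ∈ s, b ≠ a ∧ f b ≠ 0 := by
  by_contra! hn
  rw [Finset.sum_eq_single_of_mem a ha hn] at h
  exact hf h

/-- An even function on the triangles at `t`, viewed as a cocycle on the link of `t`. -/
structure IsEvenLink (𝓕 : Finset (Finset V)) (t : V) (φ : Finset V → ZMod 2) : Prop where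
  eq_zero : ∀ ρ, ρ ∉ ridges 𝓕 → φ ρ = 0
  sum_eq_zero : ∀ F ∈ 𝓕, t ∈ F → ∑ ρ ∈ (ridges 𝓕).filter (fun ρ => t ∈ ρ ∧ ρ ⊆ F), φ ρ = 0

/-- The triangles containing `t`. -/
def coneRidges (𝓕 : Finset (Finset V)) (t : V) : Finset (Finset V) := (ridges 𝓕).filter (t ∈ ·)

/-- This is duality in the link of `t`: a set of edges orthogonal to all cocycles bounds a set of
triangles. -/
theorem exists_bd_eq_on_coneRidges {𝓕 : Finset (Finset V)} {t : V} (z : Finset V → ZMod 2)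
    (hz : ∀ φ, IsEvenLink 𝓕 t φ → ∑ ρ ∈ coneRidges 𝓕 t, φ ρ * z ρ = 0) :
    ∃ c, ∀ ρ ∈ coneRidges 𝓕 t, bd 𝓕 c ρ = z ρ := by
  let A : Matrix (𝓕.filter (t ∈ ·)) (coneRidges 𝓕 t) (ZMod 2) :=
    fun F ρ => if ρ.1 ⊆ F.1 then 1 else 0
  obtain ⟨w, hw⟩ := A.exists_transpose_mulVec_eq (fun ρ => z ρ.1) fun φ hφ => by
    have := hz (fun ρ => if hρ : ρ ∈ coneRidges 𝓕 t then φ ⟨ρ, hρ⟩ else 0) ⟨fun ρ hρ => ?_,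
      fun F hF ht => ?_⟩
    · rw [← Finset.sum_coe_sort] at this
      simpa [dotProduct] using this
    · exact dif_neg fun h => hρ (Finset.mem_filter.1 h).1
    · have h1 := congrFun hφ ⟨F, Finset.mem_filter.2 ⟨hF, ht⟩⟩
      rw [← Finset.filter_filter]
      change ∑ ρ ∈ (coneRidges 𝓕 t).filter (· ⊆ F), _ = _
      rw [Finset.sum_filter, ← Finset.sum_coe_sort]
      refine Eq.trans ?_ h1
      simp [Matrix.mulVec, dotProduct, A]
  let c : Finset V → ZMod 2 := fun F => if hF : F ∈ 𝓕.filter (t ∈ ·) then w ⟨F, hF⟩ else 0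
  have hc : (fun F : 𝓕.filter (t ∈ ·) => c F.1) = w := by
    ext F
    exact dif_pos F.2
  refine ⟨c, fun ρ hρ => ?_⟩
  have h1 := congrFun hw ⟨ρ, hρ⟩
  rw [← hc] at h1
  rw [← show _ = z ρ from h1]
  have e : A.transpose.mulVec (fun F => c F.1) ⟨ρ, hρ⟩ =
      ∑ F : 𝓕.filter (t ∈ ·), if ρ ⊆ F.1 then c F.1 else 0 := by
    refine Finset.sum_congr rfl fun F _ => ?_
    change (if ρ ⊆ F.1 then (1 : ZMod 2) else 0) * c F.1 = _
    split_ifs <;> simp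
  have ht := (Finset.mem_filter.1 hρ).2
  rw [e, Finset.sum_coe_sort (𝓕.filter (t ∈ ·)) (fun F => if ρ ⊆ F then c F else 0),
    ← Finset.sum_filter, Finset.filter_filter, bd]
  refine Finset.sum_congr (Finset.filter_congr fun F _ => ?_) fun _ _ => rfl
  exact ⟨fun h => ⟨h ht, h⟩, fun h => h.2⟩

/-- The sum of a function on the link of `t` over the edges of a triangle avoiding `t`. -/
def circuitSum (𝓕 : Finset (Finset V)) (t : V) (φ : Finset V → ZMod 2) (τ : Finset V) : ZMod 2 :=
  ∑ ρ ∈ (coneRidges 𝓕 t).filter (fun ρ => ρ.erase t ⊆ τ), φ ρ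

theorem circuitSum_add {𝓕 : Finset (Finset V)} {t : V} (φ ψ : Finset V → ZMod 2)
    (τ : Finset V) : circuitSum 𝓕 t (φ + ψ) τ = circuitSum 𝓕 t φ τ + circuitSum 𝓕 t ψ τ := by
  simp only [circuitSum, Pi.add_apply, Finset.sum_add_distrib]

/-- The cycle in the link of `t` that is the sum of the boundaries of triangles with weights `y`. -/
def weightedCycle (𝓕 : Finset (Finset V)) (t w : V) (y : Finset V → ZMod 2) (ρ : Finset V) :
    ZMod 2 :=
  ∑ τ ∈ (ridgesAt 𝓕 t w).filter (fun τ => ρ.erase t ⊆ τ), y τ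

theorem sum_mul_weightedCycle {𝓕 : Finset (Finset V)} {t w : V} (φ y : Finset V → ZMod 2) :
    ∑ ρ ∈ coneRidges 𝓕 t, φ ρ * weightedCycle 𝓕 t w y ρ =
      ∑ τ ∈ ridgesAt 𝓕 t w, circuitSum 𝓕 t φ τ * y τ := by
  simp only [circuitSum, weightedCycle, Finset.sum_mul, Finset.mul_sum]
  refine Finset.sum_comm' fun ρ τ => ?_
  simp only [Finset.mem_filter]
  tauto

/-- The edges of the link of `t` covered by the triangles at `w` avoiding `t`. -/
def coveredRidges (𝓕 : Finset (Finset V)) (t w : V) : Finset (Finset V) :=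
  (coneRidges 𝓕 t).filter fun ρ => ∃ τ ∈ ridgesAt 𝓕 t w, ρ.erase t ⊆ τ

/-- The dual graph of the link of `t`, cut along the covered edges. -/
def cutGraph (𝓕 : Finset (Finset V)) (t w : V) : SimpleGraph (𝓕.filter (t ∈ ·)) where
  Adj F G := F ≠ G ∧ (F.1 ∩ G.1).card = 3 ∧ F.1 ∩ G.1 ∉ coveredRidges 𝓕 t w
  symm := ⟨fun F G h => ⟨h.1.symm, by rw [Finset.inter_comm]; exact h.2⟩⟩
  loopless := ⟨fun _ h => h.1 rfl⟩

/-- Extension by zero of a function on the components of the cut link. -/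
def extendComponent (𝓕 : Finset (Finset V)) (t w : V)
    (d : (cutGraph 𝓕 t w).ConnectedComponent → ZMod 2) (F : Finset V) : ZMod 2 :=
  if hF : F ∈ 𝓕.filter (t ∈ ·) then d ((cutGraph 𝓕 t w).connectedComponentMk ⟨F, hF⟩) else 0

theorem bd_add (𝓕 : Finset (Finset V)) (c d : Finset V → ZMod 2) (ρ : Finset V) :
    bd 𝓕 (c + d) ρ = bd 𝓕 c ρ + bd 𝓕 d ρ := by
  simp only [bd, Pi.add_apply, Finset.sum_add_distrib]

theorem bd_congr {𝓕 : Finset (Finset V)} {c d : Finset V → ZMod 2} {ρ : Finset V}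
    (h : ∀ F ∈ 𝓕, ρ ⊆ F → c F = d F) : bd 𝓕 c ρ = bd 𝓕 d ρ :=
  Finset.sum_congr rfl fun F hF => h F (Finset.mem_filter.1 hF).1 (Finset.mem_filter.1 hF).2

/-- The boundary of a union of components of the cut link, read on the triangles at `w`. -/
def componentBd (𝓕 : Finset (Finset V)) (t w : V) :
    ((cutGraph 𝓕 t w).ConnectedComponent → ZMod 2) →ₗ[ZMod 2] (ridgesAt 𝓕 t w → ZMod 2) :=
  AddMonoidHom.toZModLinearMap 2 <| AddMonoidHom.mk'
    (fun d τ => bd 𝓕 (extendComponent 𝓕 t w d) (insert t (τ.1.erase w))) fun a b => by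
      ext τ
      rw [Pi.add_apply, ← bd_add]
      refine bd_congr fun F hF _ => ?_
      simp only [extendComponent, Pi.add_apply]
      split_ifs <;> simp

namespace IsConedNormal

variable {𝓕 : Finset (Finset V)} {t : V} (h : IsConedNormal 𝓕 t)
include h

theorem isCocycle_of_isEvenLink {φ : Finset V → ZMod 2} (hφ : IsEvenLink 𝓕 t φ) :
    ((ofFacets 𝓕).link {t}).IsCocycle fun u v => φ {t, u, v} :=
  isCocycle_link h.card_eq hφ.eq_zero hφ.sum_eq_zero

theorem insert_mem_coneRidges {τ : Finset V} (hτ : τ ∈ ridges 𝓕) (ht : t ∉ τ) {y : V}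
    (hy : y ∈ τ) : insert t (τ.erase y) ∈ coneRidges 𝓕 t := by
  obtain ⟨hc, F, hF, hs⟩ := mem_ridges.1 hτ
  have h1 : (τ.erase y).card = 2 := by rw [Finset.card_erase_of_mem hy]; omega
  obtain ⟨u, v, huv, he⟩ := Finset.card_eq_two.1 h1
  have hu : u ∈ τ.erase y := by rw [he]; simp
  have hv : v ∈ τ.erase y := by rw [he]; simp
  rw [Finset.mem_erase] at hu hv
  obtain ⟨G, hG, hGs⟩ := h.cone F hF u (hs hu.2) v (hs hv.2)
  refine Finset.mem_filter.2 ⟨mem_ridges.2 ⟨?_, G, hG, by rw [he]; exact hGs⟩, by simp⟩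
  rw [Finset.card_insert_of_notMem fun h => ht (Finset.mem_of_mem_erase h), h1]

/-- By coning, all three edges of `τ` are edges of the link of `t`. -/
theorem circuitSum_eq {τ : Finset V} (hτ : τ ∈ ridges 𝓕) (ht : t ∉ τ) (φ : Finset V → ZMod 2) :
    circuitSum 𝓕 t φ τ = ∑ y ∈ τ, φ (insert t (τ.erase y)) := by
  symm
  refine Finset.sum_bij (fun y _ => insert t (τ.erase y)) ?_ ?_ ?_ fun _ _ => rfl
  · intro y hy
    refine Finset.mem_filter.2 ⟨h.insert_mem_coneRidges hτ ht hy, ?_⟩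
    rw [Finset.erase_insert fun h => ht (Finset.mem_of_mem_erase h)]
    exact Finset.erase_subset _ _
  · intro y hy z hz he
    have := congrArg (Finset.erase · t) he
    beta_reduce at this
    rw [Finset.erase_insert fun h => ht (Finset.mem_of_mem_erase h),
      Finset.erase_insert fun h => ht (Finset.mem_of_mem_erase h)] at this
    exact Finset.erase_injOn τ hy hz this
  · intro ρ hρ
    obtain ⟨hρ, hs⟩ := Finset.mem_filter.1 hρ
    obtain ⟨hρ, htρ⟩ := Finset.mem_filter.1 hρ
    have hρc := (mem_ridges.1 hρ).1
    obtain ⟨y, hy, he⟩ := Finset.exists_erase_of_card (F := τ) (ρ := ρ.erase t) (n := 2)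
      (mem_ridges.1 hτ).1 (by rw [Finset.card_erase_of_mem htρ]; omega) hs
    exact ⟨y, hy, by rw [← he, Finset.insert_erase htρ]⟩

/-- Each vertex of the circuit contributes its potential twice. -/
theorem circuitSum_eq_zero {τ : Finset V} (hτ : τ ∈ ridges 𝓕) (ht : t ∉ τ)
    {φ : Finset V → ZMod 2}
    (hφ : ((ofFacets 𝓕).link {t}).IsCoboundary fun u v => φ {t, u, v}) :
    circuitSum 𝓕 t φ τ = 0 := by
  obtain ⟨f, hf⟩ := hφ
  have hc := (mem_ridges.1 hτ).1
  rw [h.circuitSum_eq hτ ht]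
  have key : ∀ y ∈ τ, φ (insert t (τ.erase y)) = ∑ z ∈ τ.erase y, f z := by
    intro y hy
    have h1 : (τ.erase y).card = 2 := by rw [Finset.card_erase_of_mem hy]; omega
    obtain ⟨u, v, huv, he⟩ := Finset.card_eq_two.1 h1
    have hm := h.insert_mem_coneRidges hτ ht hy
    obtain ⟨-, G, hG, hs⟩ := mem_ridges.1 (Finset.mem_filter.1 hm).1
    rw [he, Finset.sum_pair huv]
    refine hf u v (mem_link_ofFacets.2 ⟨by simp, ?_, G, hG, ?_⟩)
    · rw [← he, Finset.disjoint_singleton_left]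
      exact fun h => ht (Finset.mem_of_mem_erase h)
    · rw [← he]; exact hs
  rw [Finset.sum_congr rfl key]
  have h2 : ∀ y ∈ τ, ∑ z ∈ τ.erase y, f z = f y + ∑ z ∈ τ, f z := by
    intro y hy
    rw [← Finset.add_sum_erase τ f hy, zmod_two_add_cancel]
  rw [Finset.sum_congr rfl h2, Finset.sum_add_distrib, Finset.sum_const, hc]
  generalize ∑ z ∈ τ, f z = a
  revert a; decide

/-- Every triangle at `tw` lies in two facets and every facet at `tw` has two such triangles: the
link of `tw` has as many vertices as edges. -/
theorem card_ridges_pair {w : V} (hwt : w ≠ t) :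
    ((coneRidges 𝓕 t).filter (w ∈ ·)).card = innerCount 𝓕 t w := by
  have h1 : ∑ ρ ∈ (ridges 𝓕).filter (fun ρ => t ∈ ρ ∧ w ∈ ρ), ∑ F ∈ 𝓕.filter (ρ ⊆ ·), 1 =
      2 * ((ridges 𝓕).filter (fun ρ => t ∈ ρ ∧ w ∈ ρ)).card := by
    rw [mul_comm, ← smul_eq_mul]
    refine Finset.sum_const_nat fun ρ hρ => ?_
    rw [Finset.sum_const, smul_eq_mul, mul_one]
    have := mem_ridges.1 (Finset.mem_filter.1 hρ).1
    exact h.two_facets ρ this.1 this.2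
  rw [sum_ridges_comm] at h1
  have h2 : ∀ F ∈ 𝓕, ∑ ρ ∈ (ridges 𝓕).filter (fun ρ => (t ∈ ρ ∧ w ∈ ρ) ∧ ρ ⊆ F), 1 =
      if w ∈ F ∧ t ∈ F then 2 else 0 := by
    intro F hF
    rw [sum_ridges_subset hF (h.card_eq F hF) (fun ρ => t ∈ ρ ∧ w ∈ ρ) (fun _ => 1),
      Finset.sum_const, smul_eq_mul, mul_one]
    split_ifs with hm
    · have : F.filter (fun y => t ∈ F.erase y ∧ w ∈ F.erase y) = (F.erase t).erase w := by
        ext y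
        simp only [Finset.mem_filter, Finset.mem_erase, hm.1, hm.2]
        grind
      rw [this, Finset.card_erase_of_mem (Finset.mem_erase.2 ⟨hwt, hm.1⟩),
        Finset.card_erase_of_mem hm.2, h.card_eq F hF]
    · rw [Finset.card_eq_zero]
      refine Finset.filter_false_of_mem fun y _ hy => hm ?_
      exact ⟨Finset.mem_of_mem_erase hy.2, Finset.mem_of_mem_erase hy.1⟩
  rw [Finset.sum_congr rfl h2, ← Finset.sum_filter, Finset.sum_const, smul_eq_mul] at h1
  rw [coneRidges, Finset.filter_filter, innerCount]
  omega

/-- A covered edge of the link of `t` either passes through `w` or is the side opposite to `w` of a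
triangle at `w`. -/
theorem card_coveredRidges_le {w : V} (hwt : w ≠ t) :
    (coveredRidges 𝓕 t w).card ≤ innerCount 𝓕 t w + (ridgesAt 𝓕 t w).card := by
  rw [← h.card_ridges_pair hwt]
  refine le_trans (Finset.card_le_card (t := (coneRidges 𝓕 t).filter (w ∈ ·) ∪
    (ridgesAt 𝓕 t w).image fun τ => insert t (τ.erase w)) ?_)
    ((Finset.card_union_le _ _).trans (Nat.add_le_add_left Finset.card_image_le _))
  intro ρ hρ
  obtain ⟨hρ, τ, hτ, hs⟩ := Finset.mem_filter.1 hρ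
  rw [Finset.mem_union]
  by_cases hw : w ∈ ρ
  · exact Or.inl (Finset.mem_filter.2 ⟨hρ, hw⟩)
  · refine Or.inr (Finset.mem_image.2 ⟨τ, hτ, ?_⟩)
    have ht := (Finset.mem_filter.1 hρ).2
    have hρc := (mem_ridges.1 (Finset.mem_filter.1 hρ).1).1
    have hτ' := Finset.mem_filter.1 hτ
    have hτc := (mem_ridges.1 hτ'.1).1
    have : ρ.erase t = τ.erase w := by
      refine Finset.eq_of_subset_of_card_le (fun y hy => Finset.mem_erase.2 ⟨?_, hs hy⟩) ?_
      · rintro rfl; exact hw (Finset.mem_of_mem_erase hy)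
      · rw [Finset.card_erase_of_mem hτ'.2.1, Finset.card_erase_of_mem ht]; omega
    rw [← this, Finset.insert_erase ht]

-- Only `τ` itself, among the triangles at `w`, contains its side opposite to `w`. The weights can
-- thus be read off from the cycle.
omit h in
theorem weightedCycle_eq {w : V} {y : Finset V → ZMod 2} {τ : Finset V}
    (hτ : τ ∈ ridgesAt 𝓕 t w) :
    weightedCycle 𝓕 t w y (insert t (τ.erase w)) = y τ := by
  have hτ' := Finset.mem_filter.1 hτ
  have hτc := (mem_ridges.1 hτ'.1).1
  rw [weightedCycle, Finset.erase_insert fun h => hτ'.2.2 (Finset.mem_of_mem_erase h)]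
  refine Finset.sum_eq_single_of_mem τ (Finset.mem_filter.2 ⟨hτ, Finset.erase_subset _ _⟩) ?_
  intro τ1 h1 hne
  obtain ⟨h1, hs⟩ := Finset.mem_filter.1 h1
  have h1' := Finset.mem_filter.1 h1
  refine (hne (Finset.eq_of_subset_of_card_le ?_ ?_).symm).elim
  · rw [← Finset.insert_erase hτ'.2.1, Finset.insert_subset_iff]
    exact ⟨h1'.2.1, hs⟩
  · rw [hτc, (mem_ridges.1 h1'.1).1]

/-- Weighted cycles that pair to zero with the even functions bound unions of components. -/
theorem mem_range_componentBd {w : V} {y : Finset V → ZMod 2}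
    (hy : ∀ φ, IsEvenLink 𝓕 t φ → ∑ τ ∈ ridgesAt 𝓕 t w, circuitSum 𝓕 t φ τ * y τ = 0) :
    (fun τ : ridgesAt 𝓕 t w => y τ.1) ∈ LinearMap.range (componentBd 𝓕 t w) := by
  obtain ⟨c, hc⟩ := exists_bd_eq_on_coneRidges (weightedCycle 𝓕 t w y) fun φ hφ => by
    rw [sum_mul_weightedCycle, hy φ hφ]
  have hadj : ∀ F G, (cutGraph 𝓕 t w).Adj F G → c F.1 = c G.1 := by
    rintro ⟨F, hF⟩ ⟨G, hG⟩ ⟨-, h3, hn⟩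
    rw [Finset.mem_filter] at hF hG
    have hm : F ∩ G ∈ coneRidges 𝓕 t := Finset.mem_filter.2
      ⟨mem_ridges.2 ⟨h3, F, hF.1, Finset.inter_subset_left⟩, Finset.mem_inter.2 ⟨hF.2, hG.2⟩⟩
    have h4 := hc _ hm
    rw [h.bd_inter c hF.1 hG.1 h3, weightedCycle, Finset.filter_false_of_mem,
      Finset.sum_empty] at h4
    · exact zmod_two_eq_of_add_eq_zero h4
    · exact fun τ hτ hs => hn (Finset.mem_filter.2 ⟨hm, τ, hτ, hs⟩)
  have hwalk : ∀ F G, (cutGraph 𝓕 t w).Walk F G → c F.1 = c G.1 := by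
    intro F G p
    induction p with
    | nil => rfl
    | cons e _ ih => exact (hadj _ _ e).trans ih
  -- The weighted cycle is supported on covered edges, so `c` is constant on each component of the
  -- cut link and descends to the components.
  let d : (cutGraph 𝓕 t w).ConnectedComponent → ZMod 2 :=
    SimpleGraph.ConnectedComponent.lift (fun F => c F.1) fun F G p _ => hwalk F G p
  refine ⟨d, ?_⟩
  ext τ
  have hτ := Finset.mem_filter.1 τ.2
  change bd 𝓕 (extendComponent 𝓕 t w d) (insert t (τ.1.erase w)) = y τ.1
  rw [← weightedCycle_eq (y := y) τ.2, ← hc _ (h.insert_mem_coneRidges hτ.1 hτ.2.2 hτ.2.1)]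
  refine bd_congr fun F hF hs => ?_
  have hF' : F ∈ 𝓕.filter (t ∈ ·) := Finset.mem_filter.2 ⟨hF, hs (by simp)⟩
  rw [extendComponent, dif_pos hF']
  rfl

/-- A nonzero boundary in the link of `t` has at least three edges. -/
theorem three_le_card_bd {c : Finset V → ZMod 2} {ρ : Finset V} (hρ : ρ ∈ coneRidges 𝓕 t)
    (hb : bd 𝓕 c ρ ≠ 0) :
    3 ≤ ((coneRidges 𝓕 t).filter fun ρ => bd 𝓕 c ρ ≠ 0).card := by
  obtain ⟨hρr, ht⟩ := Finset.mem_filter.1 hρ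
  have hcard := (mem_ridges.1 hρr).1
  have h1 : (ρ.erase t).card = 2 := by rw [Finset.card_erase_of_mem ht]; omega
  obtain ⟨p, q, hpq, he⟩ := Finset.card_eq_two.1 h1
  have hp : p ∈ ρ.erase t := by rw [he]; simp
  have hq : q ∈ ρ.erase t := by rw [he]; simp
  rw [Finset.mem_erase] at hp hq
  have other : ∀ r, r ≠ t → r ∈ ρ → ∃ ρ' ∈ coneRidges 𝓕 t, ρ' ≠ ρ ∧ r ∈ ρ' ∧ bd 𝓕 c ρ' ≠ 0 := by
    intro r hrt hr
    obtain ⟨ρ', h2, h3, h4⟩ := exists_ne_of_sum_eq_zero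
      (h.sum_bd_eq_zero (σ := {t, r}) (Finset.card_pair hrt.symm) c) (a := ρ)
      (Finset.mem_filter.2 ⟨hρr, by
        intro z hz; simp only [Finset.mem_insert, Finset.mem_singleton] at hz
        rcases hz with rfl | rfl <;> assumption⟩) hb
    obtain ⟨h5, h6⟩ := Finset.mem_filter.1 h2
    exact ⟨ρ', Finset.mem_filter.2 ⟨h5, h6 (by simp)⟩, h3, h6 (by simp), h4⟩
  obtain ⟨ρ1, a1, b1, c1, d1⟩ := other p hp.1 hp.2
  obtain ⟨ρ2, a2, b2, c2, d2⟩ := other q hq.1 hq.2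
  have h12 : ρ1 ≠ ρ2 := by
    rintro rfl
    refine b1 (Finset.eq_of_subset_of_card_le ?_ ?_).symm
    · rw [← Finset.insert_erase ht, he]
      intro z hz; simp only [Finset.mem_insert, Finset.mem_singleton] at hz
      rcases hz with rfl | rfl | rfl
      · exact (Finset.mem_filter.1 a1).2
      · exact c1
      · exact c2
    · rw [hcard, (mem_ridges.1 (Finset.mem_filter.1 a1).1).1]
  rw [← Finset.card_three_of_ne b1.symm b2.symm h12]
  refine Finset.card_le_card ?_
  intro z hz; simp only [Finset.mem_insert, Finset.mem_singleton] at hz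
  rcases hz with rfl | rfl | rfl
  · exact Finset.mem_filter.2 ⟨hρ, hb⟩
  · exact Finset.mem_filter.2 ⟨a1, d1⟩
  · exact Finset.mem_filter.2 ⟨a2, d2⟩

/-- Pairs of a component and a boundary edge are counted twice: a component has at least three
boundary edges, all of them covered, and an edge borders at most two components. -/
theorem three_mul_card_component_le {w : V}
    (h2 : 2 ≤ Fintype.card (cutGraph 𝓕 t w).ConnectedComponent) :
    3 * Fintype.card (cutGraph 𝓕 t w).ConnectedComponent ≤ 2 * (coveredRidges 𝓕 t w).card := by
  let χ : (cutGraph 𝓕 t w).ConnectedComponent → Finset V → ZMod 2 := fun C =>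
    extendComponent 𝓕 t w (Pi.single C 1)
  have hχ : ∀ C F (hF : F ∈ 𝓕.filter (t ∈ ·)), χ C F ≠ 0 ↔
      (cutGraph 𝓕 t w).connectedComponentMk ⟨F, hF⟩ = C := by
    intro C F hF
    simp only [χ, extendComponent, dif_pos hF, Pi.single_apply]
    split_ifs with he <;> simp [he]
  have lower : ∀ C, 3 ≤ ((coveredRidges 𝓕 t w).filter fun ρ => bd 𝓕 (χ C) ρ ≠ 0).card := by
    intro C
    have hcov : (coneRidges 𝓕 t).filter (fun ρ => bd 𝓕 (χ C) ρ ≠ 0) ⊆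
        (coveredRidges 𝓕 t w).filter fun ρ => bd 𝓕 (χ C) ρ ≠ 0 := by
      intro ρ hρ
      obtain ⟨hρ, hb⟩ := Finset.mem_filter.1 hρ
      refine Finset.mem_filter.2 ⟨?_, hb⟩
      by_contra hn
      obtain ⟨hρr, ht⟩ := Finset.mem_filter.1 hρ
      obtain ⟨hc3, F, hF, hs⟩ := mem_ridges.1 hρr
      obtain ⟨G, hG, hne, hsG, hi, -⟩ := h.exists_other hF hc3 hs
      rw [← hi, h.bd_inter _ hF hG (by rw [hi]; exact hc3)] at hb
      apply hb
      have hFm : F ∈ 𝓕.filter (t ∈ ·) := Finset.mem_filter.2 ⟨hF, hs ht⟩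
      have hGm : G ∈ 𝓕.filter (t ∈ ·) := Finset.mem_filter.2 ⟨hG, hsG ht⟩
      have hadj : (cutGraph 𝓕 t w).Adj ⟨F, hFm⟩ ⟨G, hGm⟩ :=
        ⟨fun e => hne (congrArg Subtype.val e).symm, by
          rw [hi]; exact ⟨hc3, hn⟩⟩
      have : χ C F = χ C G := by
        simp only [χ, extendComponent, dif_pos hFm, dif_pos hGm,
          SimpleGraph.ConnectedComponent.sound hadj.reachable]
      rw [this, CharTwo.add_self_eq_zero]
    -- A component other than `C` exists, so the indicator of `C` is not constant on the connected
    -- link of `t` and must have a boundary.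
    have hex : ∃ ρ ∈ coneRidges 𝓕 t, bd 𝓕 (χ C) ρ ≠ 0 := by
      by_contra! hn
      have hconst := h.eq_of_bd_eq_zero (σ := {t}) (c := χ C) (by simp) fun ρ hρ hs =>
        hn ρ (Finset.mem_filter.2 ⟨hρ, by simpa using hs⟩)
      obtain ⟨D, hD⟩ := Fintype.exists_ne_of_one_lt_card h2 C
      obtain ⟨⟨F, hF⟩, hFC⟩ := C.exists_rep
      obtain ⟨⟨G, hG⟩, hGD⟩ := D.exists_rep
      have h3 := (hχ C F hF).2 hFC
      have h4 : ¬ χ C G ≠ 0 := fun h => hD (((hχ C G hG).1 h).symm.trans hGD).symm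
      rw [not_not] at h4
      have hF' := Finset.mem_filter.1 hF
      have hG' := Finset.mem_filter.1 hG
      rw [hconst F hF'.1 G hG'.1 (by simpa using hF'.2) (by simpa using hG'.2)] at h3
      exact h3 h4
    obtain ⟨ρ, hρ, hb⟩ := hex
    exact (h.three_le_card_bd hρ hb).trans (Finset.card_le_card hcov)
  have upper : ∀ ρ ∈ coveredRidges 𝓕 t w,
      (Finset.univ.filter fun C => bd 𝓕 (χ C) ρ ≠ 0).card ≤ 2 := by
    intro ρ hρ
    obtain ⟨hρr, ht⟩ := Finset.mem_filter.1 (Finset.mem_filter.1 hρ).1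
    obtain ⟨hc3, F, hF, hs⟩ := mem_ridges.1 hρr
    obtain ⟨G, hG, hne, hsG, hi, -⟩ := h.exists_other hF hc3 hs
    have hFm : F ∈ 𝓕.filter (t ∈ ·) := Finset.mem_filter.2 ⟨hF, hs ht⟩
    have hGm : G ∈ 𝓕.filter (t ∈ ·) := Finset.mem_filter.2 ⟨hG, hsG ht⟩
    refine le_trans (Finset.card_le_card (t := {(cutGraph 𝓕 t w).connectedComponentMk ⟨F, hFm⟩,
      (cutGraph 𝓕 t w).connectedComponentMk ⟨G, hGm⟩}) ?_) Finset.card_le_two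
    intro C hC
    have hb := (Finset.mem_filter.1 hC).2
    rw [← hi, h.bd_inter _ hF hG (by rw [hi]; exact hc3)] at hb
    rw [Finset.mem_insert, Finset.mem_singleton, eq_comm, ← hχ C F hFm, eq_comm (a := C),
      ← hχ C G hGm]
    by_contra! hn
    rw [hn.1, hn.2, add_zero] at hb
    exact hb rfl
  calc 3 * Fintype.card (cutGraph 𝓕 t w).ConnectedComponent
      = ∑ C : (cutGraph 𝓕 t w).ConnectedComponent, 3 := by
        rw [Finset.sum_const, smul_eq_mul, Finset.card_univ, mul_comm]
    _ ≤ ∑ C, ((coveredRidges 𝓕 t w).filter fun ρ => bd 𝓕 (χ C) ρ ≠ 0).card :=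
        Finset.sum_le_sum fun C _ => lower C
    _ = ∑ ρ ∈ coveredRidges 𝓕 t w, (Finset.univ.filter fun C => bd 𝓕 (χ C) ρ ≠ 0).card := by
        simp only [Finset.card_eq_sum_ones]
        refine Finset.sum_comm' fun C ρ => ?_
        simp only [Finset.mem_filter, Finset.mem_univ, true_and]
        tauto
    _ ≤ ∑ ρ ∈ coveredRidges 𝓕 t w, 2 := Finset.sum_le_sum upper
    _ = 2 * (coveredRidges 𝓕 t w).card := by
        rw [Finset.sum_const, smul_eq_mul, mul_comm]

theorem outerCount_pos {x : V} (hxt : x ≠ t) (hx : ∃ F ∈ 𝓕, x ∈ F) : 0 < outerCount 𝓕 t x := by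
  obtain ⟨F, hF, hxF⟩ := hx
  rw [outerCount, Finset.card_pos]
  by_cases ht : t ∈ F
  · obtain ⟨G, hG, hne, hs, -⟩ := h.exists_other hF (ρ := F.erase t)
      (by rw [Finset.card_erase_of_mem ht, h.card_eq F hF]) (Finset.erase_subset _ _)
    refine ⟨G, Finset.mem_filter.2 ⟨hG, hs (Finset.mem_erase.2 ⟨hxt, hxF⟩), fun htG => hne ?_⟩⟩
    refine (Finset.eq_of_subset_of_card_le ?_ (by rw [h.card_eq F hF, h.card_eq G hG])).symm
    rw [← Finset.insert_erase ht]
    exact Finset.insert_subset htG hs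
  · exact ⟨F, Finset.mem_filter.2 ⟨hF, hxF, ht⟩⟩

/-- The first Betti number of the link of `t` bounds those of the other vertex links. -/
theorem bettiAt_le_of_isEvenLink {w : V} (hwt : w ≠ t) (hw : ∃ F ∈ 𝓕, w ∈ F) {κ : ℕ}
    (hκ : κ ≤ 1) {φ₀ : Finset V → ZMod 2} (h0 : κ = 0 → φ₀ = 0)
    (hcob : ∀ φ, IsEvenLink 𝓕 t φ →
      ((ofFacets 𝓕).link {t}).IsCoboundary (fun u v => φ {t, u, v}) ∨
      ((ofFacets 𝓕).link {t}).IsCoboundary (fun u v => (φ + φ₀) {t, u, v})) :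
    bettiAt 𝓕 t w ≤ κ := by
  let ℓ : (ridgesAt 𝓕 t w → ZMod 2) →ₗ[ZMod 2] ZMod 2 :=
    { toFun := fun y => (fun τ : ridgesAt 𝓕 t w => circuitSum 𝓕 t φ₀ τ.1) ⬝ᵥ y
      map_add' := fun a b => dotProduct_add _ a b
      map_smul' := fun a b => dotProduct_smul a _ b }
  -- Up to coboundaries `φ₀` is the only possible nonzero cocycle on the link of `t`. Orthogonality
  -- to `φ₀` thus makes a weighted cycle a boundary of components.
  have hsub : LinearMap.ker ℓ ≤ LinearMap.range (componentBd 𝓕 t w) := by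
    intro y hy
    let y' : Finset V → ZMod 2 := fun τ => if hτ : τ ∈ ridgesAt 𝓕 t w then y ⟨τ, hτ⟩ else 0
    have hy' : (fun τ : ridgesAt 𝓕 t w => y' τ.1) = y := by
      ext τ
      exact dif_pos τ.2
    rw [← hy'] at hy ⊢
    have hy2 : ∑ τ ∈ ridgesAt 𝓕 t w, circuitSum 𝓕 t φ₀ τ * y' τ = 0 := by
      rw [← Finset.sum_coe_sort]
      exact hy
    refine h.mem_range_componentBd fun φ hφ => ?_
    rcases hcob φ hφ with h1 | h1
    · refine Finset.sum_eq_zero fun τ hτ => ?_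
      have hτ' := Finset.mem_filter.1 hτ
      rw [h.circuitSum_eq_zero hτ'.1 hτ'.2.2 h1, zero_mul]
    · rw [← hy2]
      refine Finset.sum_congr rfl fun τ hτ => ?_
      have hτ' := Finset.mem_filter.1 hτ
      have h2 := h.circuitSum_eq_zero hτ'.1 hτ'.2.2 h1
      rw [circuitSum_add] at h2
      rw [zmod_two_eq_of_add_eq_zero h2]
  have hker : (ridgesAt 𝓕 t w).card ≤ Module.finrank (ZMod 2) (LinearMap.ker ℓ) + κ := by
    have h1 := ℓ.finrank_range_add_finrank_ker
    rw [Module.finrank_fintype_fun_eq_card, Fintype.card_coe] at h1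
    have h2 : Module.finrank (ZMod 2) (LinearMap.range ℓ) ≤ κ := by
      by_cases hk : κ = 0
      · have : ℓ = 0 := by
          ext τ
          simp [ℓ, circuitSum, h0 hk]
        rw [this, LinearMap.range_zero, finrank_bot]
        omega
      · have := Submodule.finrank_le (LinearMap.range ℓ)
        rw [Module.finrank_self] at this
        omega
    omega
  -- The union of all components has no boundary, which costs one dimension.
  have hcomp : Module.finrank (ZMod 2) (LinearMap.ker ℓ) + 1 ≤
      Fintype.card (cutGraph 𝓕 t w).ConnectedComponent := by
    have h1 := (componentBd 𝓕 t w).finrank_range_add_finrank_ker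
    rw [Module.finrank_fintype_fun_eq_card] at h1
    have h2 := Submodule.finrank_mono hsub
    have h3 : 0 < Module.finrank (ZMod 2) (LinearMap.ker (componentBd 𝓕 t w)) := by
      rw [Module.finrank_pos_iff_exists_ne_zero]
      have hm : (fun _ => 1) ∈ LinearMap.ker (componentBd 𝓕 t w) := by
        rw [LinearMap.mem_ker]
        ext τ
        have hτ := Finset.mem_filter.1 τ.2
        have hm := h.insert_mem_coneRidges hτ.1 hτ.2.2 hτ.2.1
        have hm' := mem_ridges.1 (Finset.mem_filter.1 hm).1
        change bd 𝓕 _ _ = 0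
        rw [bd_congr (d := fun _ => 1)]
        · exact even_card_eq_zero (h.two_facets _ hm'.1 hm'.2) 1
        · intro F hF hs
          exact dif_pos (Finset.mem_filter.2 ⟨hF, hs (by simp)⟩)
      refine ⟨⟨_, hm⟩, fun e => ?_⟩
      obtain ⟨F, hF, hwF⟩ := hw
      obtain ⟨G, hG, htG, -⟩ := h.cone_mem hF hwF hwF
      have := congrFun (congrArg Subtype.val e) ((cutGraph 𝓕 t w).connectedComponentMk
        ⟨G, Finset.mem_filter.2 ⟨hG, htG⟩⟩)
      exact one_ne_zero this
    omega
  -- Let `E` be the number of triangles at `w` off `t`, `i` the inner count, `b` the value of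
  -- `bettiAt` and `C` the number of components. Euler's relation gives `E = 2i + 3b - 3`, while
  -- `3(E - κ + 1) ≤ 3C ≤ 2(i + E)`; hence `b ≤ κ`. Positivity of the outer count gives `E ≥ 2`, so
  -- `C ≥ 2`.
  have e1 := h.bettiAt_add hwt hw
  have e2 := h.two_mul_card_ridgesAt hwt
  have e3 := h.outerCount_pos hwt hw
  have e4 := h.card_coveredRidges_le hwt
  have e5 := h.three_mul_card_component_le (w := w) (by omega)
  omega

theorem bettiAt_eq_zero_of_link_sphere [Fintype V] {w : V} (hwt : w ≠ t) (hw : ∃ F ∈ 𝓕, w ∈ F)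
    (e : ((ofFacets 𝓕).link {t}).carrier ≃ₜ Sphere2) : bettiAt 𝓕 t w = 0 := by
  have := h.bettiAt_le_of_isEvenLink hwt hw (κ := 0) (by omega) (φ₀ := 0) (fun _ => rfl)
    fun φ hφ => Or.inl ((h.isCocycle_of_isEvenLink hφ).isCoboundary_of_homeomorph_sphere e)
  omega

/-- If some cocycle `φ₀` on the link of `t` is not a coboundary, every other one is a coboundary or
becomes one after adding `φ₀`. -/
theorem bettiAt_le_one_of_link_RP2 [Fintype V] {w : V} (hwt : w ≠ t) (hw : ∃ F ∈ 𝓕, w ∈ F)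
    (e : ((ofFacets 𝓕).link {t}).carrier ≃ₜ RP2) : bettiAt 𝓕 t w ≤ 1 := by
  by_cases hall : ∀ φ, IsEvenLink 𝓕 t φ →
      ((ofFacets 𝓕).link {t}).IsCoboundary (fun u v => φ {t, u, v})
  · exact h.bettiAt_le_of_isEvenLink hwt hw le_rfl (φ₀ := 0) (fun _ => rfl)
      fun φ hφ => Or.inl (hall φ hφ)
  · push Not at hall
    obtain ⟨φ₀, h1, h2⟩ := hall
    refine h.bettiAt_le_of_isEvenLink hwt hw le_rfl (φ₀ := φ₀) (by omega) fun φ hφ => ?_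
    rcases (h.isCocycle_of_isEvenLink hφ).isCoboundary_or_of_homeomorph_RP2 e
      (h.isCocycle_of_isEvenLink h1) with h3 | h3 | h3
    · exact Or.inl h3
    · exact (h2 h3).elim
    · exact Or.inr h3

end IsConedNormal

end LinkBound

/-! ### Two explicit homeomorphisms of carriers. -/

noncomputable section Carrier

namespace PreAbstractSimplicialComplex

variable {V : Type*} [Fintype V]

theorem isCompact_carrier (K : PreAbstractSimplicialComplex V) : IsCompact K.carrier := by
  have e : K.carrier = stdSimplex ℝ V ∩ ⋃ σ ∈ {σ : Finset V | σ ∈ K}, ⋂ v ∈ {v | v ∉ σ},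
      {x : V → ℝ | x v = 0} := by
    ext x
    simp only [carrier, Set.mem_ofPred_eq, Set.mem_inter_iff, Set.mem_iUnion, Set.mem_iInter,
      exists_prop]
  rw [e]
  refine (isCompact_stdSimplex ℝ V).inter_right ?_
  refine (Set.toFinite _).isClosed_biUnion fun σ _ => ?_
  refine isClosed_biInter fun v _ => ?_
  exact isClosed_eq (continuous_apply v) continuous_const

instance (K : PreAbstractSimplicialComplex V) : CompactSpace K.carrier :=
  isCompact_iff_compactSpace.1 K.isCompact_carrier

/-- The point moved by collapsing the barycentre `q` of `C` affinely. -/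
def collapsePoint (C : Finset V) (q : V) (m : ℝ) (x : V → ℝ) (v : V) : ℝ :=
  x v + m * ((if v ∈ C then 1 / 3 else 0) - if v = q then 1 else 0)

theorem sum_collapsePoint {C : Finset V} (hC : C.card = 3) (q : V) (m : ℝ) (x : V → ℝ) :
    ∑ v, collapsePoint C q m x v = ∑ v, x v := by
  simp only [collapsePoint]
  rw [Finset.sum_add_distrib, ← Finset.mul_sum, Finset.sum_sub_distrib]
  simp [hC]

/-- Starring a triangle does not change the homeomorphism type of the carrier. -/
theorem nonempty_homeomorph_of_starring {K K' : PreAbstractSimplicialComplex V} {C : Finset V}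
    {q : V} (hC : C.card = 3) (hq : q ∉ C) (h1 : ∀ σ ∈ K, q ∈ σ → σ ⊆ insert q C)
    (h2 : ∀ σ ∈ K, ¬ C ⊆ σ) (h3 : ∀ σ ∈ K, q ∉ σ → σ ∈ K') (h4 : C ∈ K')
    (h5 : ∀ σ ∈ K', σ ⊆ C ∨ σ ∈ K ∧ q ∉ σ)
    (h6 : ∀ σ ⊆ insert q C, σ.Nonempty → ¬ C ⊆ σ → σ ∈ K) :
    Nonempty (K.carrier ≃ₜ K'.carrier) := by
  -- No simplex of `K` contains `C`, so some coordinate in `C` vanishes. This makes the weight moved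
  -- away from `q` recoverable.
  have zero : ∀ x ∈ K.carrier, ∃ u ∈ C, x u = 0 := by
    rintro x ⟨-, σ, hσ, h0⟩
    have := h2 σ hσ
    rw [Finset.not_subset] at this
    obtain ⟨u, hu, hn⟩ := this
    exact ⟨u, hu, h0 u hn⟩
  have maps : ∀ x ∈ K.carrier, collapsePoint C q (x q) x ∈ K'.carrier := by
    rintro x ⟨⟨hx0, hx1⟩, σ, hσ, h0⟩
    refine ⟨⟨fun v => ?_, by rw [sum_collapsePoint hC, hx1]⟩, ?_⟩
    · have ha := hx0 v
      have hb := hx0 q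
      simp only [collapsePoint]
      by_cases hv : v = q
      · subst hv; simp [hq]
      · rw [if_neg hv]
        split_ifs
        · linarith
        · simpa using ha
    · by_cases hqσ : q ∈ σ
      · refine ⟨C, h4, fun v hv => ?_⟩
        simp only [collapsePoint, if_neg hv]
        by_cases hvq : v = q
        · subst hvq; simp
        · have : v ∉ σ := fun hm => by
            have := h1 σ hσ hqσ hm
            rw [Finset.mem_insert] at this
            exact this.elim hvq hv
          simp [hvq, h0 v this]
      · refine ⟨σ, h3 σ hσ hqσ, fun v hv => ?_⟩
        simp [collapsePoint, h0 q hqσ, h0 v hv]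
  let f : K.carrier → K'.carrier := fun x => ⟨_, maps x.1 x.2⟩
  have hf : Continuous f := by
    refine Continuous.subtype_mk ?_ _
    refine continuous_pi fun v => ?_
    have hc : ∀ v, Continuous fun x : K.carrier => x.1 v :=
      fun v => (continuous_apply v).comp continuous_subtype_val
    exact (hc v).add ((hc q).mul continuous_const)
  have hinj : Function.Injective f := by
    intro x y hxy
    have e : ∀ v, collapsePoint C q (x.1 q) x.1 v = collapsePoint C q (y.1 q) y.1 v :=
      fun v => congrFun (congrArg Subtype.val hxy) v
    -- At a vertex of `C` where `a` vanishes, the common image has coordinate `a q / 3`, and this is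
    -- at least `b q / 3`.
    have comp : ∀ a b : K.carrier,
        (∀ v, collapsePoint C q (a.1 q) a.1 v = collapsePoint C q (b.1 q) b.1 v) →
        b.1 q ≤ a.1 q := by
      intro a b he
      obtain ⟨u, hu, h0⟩ := zero a.1 a.2
      have hne : u ≠ q := fun e => hq (e ▸ hu)
      have := he u
      simp only [collapsePoint, if_pos hu, if_neg hne, h0] at this
      have hb := b.2.1.1 u
      linarith
    have hqe : x.1 q = y.1 q := le_antisymm (comp y x fun v => (e v).symm) (comp x y e)
    refine Subtype.ext (funext fun v => ?_)
    have := e v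
    simp only [collapsePoint, hqe] at this
    linarith
  have hsurj : Function.Surjective f := by
    rintro ⟨y, ⟨hy0, hy1⟩, σ, hσ, h0⟩
    rcases h5 σ hσ with hs | ⟨hK, hqσ⟩
    · have hyq : y q = 0 := h0 q fun h => hq (hs h)
      obtain ⟨u, hu, hmin⟩ := Finset.exists_min_image C y (Finset.card_pos.1 (by omega))
      have hne : u ≠ q := fun e => hq (e ▸ hu)
      -- The preimage subtracts the least coordinate `y u` on `C` from all three and gives the total
      -- `3 * y u` to `q`.
      have hval : ∀ v, collapsePoint C q (-(3 * y u)) y v =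
          if v = q then 3 * y u else if v ∈ C then y v - y u else y v := by
        intro v
        simp only [collapsePoint]
        by_cases hvq : v = q
        · subst hvq; simp [hq, hyq]
        · by_cases hv : v ∈ C
          · simp only [hvq, hv, if_true, if_false]; ring
          · simp [hvq, hv]
      refine ⟨⟨collapsePoint C q (-(3 * y u)) y, ⟨fun v => ?_, ?_⟩,
        (insert q C).erase u, h6 _ (Finset.erase_subset _ _) ?_ ?_, fun v hv => ?_⟩, ?_⟩
      · rw [hval]
        split_ifs with ha hb
        · have := hy0 u; positivity
        · have := hmin v hb; linarith
        · exact hy0 v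
      · rw [sum_collapsePoint hC, hy1]
      · exact ⟨q, by simp [hne.symm]⟩
      · intro hsub
        exact Finset.notMem_erase u _ (hsub hu)
      · rw [hval]
        rw [Finset.mem_erase, Finset.mem_insert, not_and_or, not_not, not_or] at hv
        rcases hv with rfl | ⟨ha, hb⟩
        · simp [hne, hu]
        · rw [if_neg ha, if_neg hb]
          exact h0 v fun h => hb (hs h)
      · refine Subtype.ext (funext fun v => ?_)
        change collapsePoint C q (collapsePoint C q (-(3 * y u)) y q) _ v = y v
        rw [hval q, if_pos rfl]
        simp only [collapsePoint]
        ring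
    · refine ⟨⟨y, ⟨hy0, hy1⟩, σ, hK, h0⟩, Subtype.ext (funext fun v => ?_)⟩
      change collapsePoint C q (y q) y v = y v
      simp [collapsePoint, h0 q hqσ]
  exact ⟨Continuous.homeoOfEquivCompactToT2 (f := Equiv.ofBijective f ⟨hinj, hsurj⟩) hf⟩

/-- The carrier of the boundary of a tetrahedron is a sphere. -/
theorem nonempty_homeomorph_sphere_of_tetrahedron {K : PreAbstractSimplicialComplex V}
    {a b c d : V} (hab : a ≠ b) (hac : a ≠ c) (had : a ≠ d) (hbc : b ≠ c) (hbd : b ≠ d)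
    (hcd : c ≠ d)
    (hK : ∀ σ, σ ∈ K ↔ σ.Nonempty ∧ σ ⊆ {a, b, c, d} ∧ σ ≠ {a, b, c, d}) :
    Nonempty (K.carrier ≃ₜ Sphere2) := by
  have sum4 : ∀ x : V → ℝ, (∀ v, v ∉ ({a, b, c, d} : Finset V) → x v = 0) →
      ∑ v, x v = x a + x b + x c + x d := by
    intro x hx
    rw [← Finset.sum_subset (Finset.subset_univ {a, b, c, d}) fun v _ hv => hx v hv,
      Finset.sum_insert (by simp [hab, hac, had]), Finset.sum_insert (by simp [hbc, hbd]),
      Finset.sum_insert (by simp [hcd]), Finset.sum_singleton]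
    ring
  have supp : ∀ x ∈ K.carrier, ∀ v, v ∉ ({a, b, c, d} : Finset V) → x v = 0 := by
    rintro x ⟨-, σ, hσ, h0⟩ v hv
    exact h0 v fun h => hv (((hK σ).1 hσ).2.1 h)
  have zero : ∀ x ∈ K.carrier, x a = 0 ∨ x b = 0 ∨ x c = 0 ∨ x d = 0 := by
    rintro x ⟨-, σ, hσ, h0⟩
    by_contra! hn
    have hσ' := (hK σ).1 hσ
    refine hσ'.2.2 (Finset.Subset.antisymm hσ'.2.1 fun v hv => ?_)
    simp only [Finset.mem_insert, Finset.mem_singleton] at hv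
    by_contra hm
    have := h0 v hm
    rcases hv with rfl | rfl | rfl | rfl
    · exact hn.1 this
    · exact hn.2.1 this
    · exact hn.2.2.1 this
    · exact hn.2.2.2 this
  have sum1 : ∀ x ∈ K.carrier, x a + x b + x c + x d = 1 := fun x hx => by
    rw [← sum4 x (supp x hx), hx.1.2]
  -- The map `w` forgets the common part of the four coordinates, so the barycentre goes to the
  -- origin. After normalization this is radial projection.
  let w : (V → ℝ) → EuclideanSpace ℝ (Fin 3) := fun x => !₂[x a - x d, x b - x d, x c - x d]
  have hw0 : ∀ x ∈ K.carrier, w x ≠ 0 := by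
    intro x hx e
    have e0 : x a - x d = 0 := congrFun (congrArg WithLp.ofLp e) 0
    have e1 : x b - x d = 0 := congrFun (congrArg WithLp.ofLp e) 1
    have e2 : x c - x d = 0 := congrFun (congrArg WithLp.ofLp e) 2
    have := sum1 x hx
    rcases zero x hx with h | h | h | h <;> linarith
  let f : K.carrier → Sphere2 := fun x => ⟨‖w x.1‖⁻¹ • w x.1, by
    rw [mem_sphere_zero_iff_norm, norm_smul, norm_inv, norm_norm,
      inv_mul_cancel₀ (norm_ne_zero_iff.2 (hw0 x.1 x.2))]⟩
  have hwc : Continuous fun x : K.carrier => w x.1 := by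
    refine (PiLp.continuous_toLp 2 _).comp ?_
    refine continuous_pi fun i => ?_
    have hc : ∀ v, Continuous fun x : K.carrier => x.1 v :=
      fun v => (continuous_apply v).comp continuous_subtype_val
    fin_cases i
    · exact (hc a).sub (hc d)
    · exact (hc b).sub (hc d)
    · exact (hc c).sub (hc d)
  have hf : Continuous f := by
    refine Continuous.subtype_mk ?_ _
    exact (hwc.norm.inv₀ fun x => norm_ne_zero_iff.2 (hw0 x.1 x.2)).smul hwc
  have hinj : Function.Injective f := by
    intro x y hxy
    have e : ‖w x.1‖⁻¹ • w x.1 = ‖w y.1‖⁻¹ • w y.1 := congrArg Subtype.val hxy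
    have px := norm_pos_iff.2 (hw0 x.1 x.2)
    have py := norm_pos_iff.2 (hw0 y.1 y.2)
    obtain ⟨l, hl, e'⟩ : ∃ l : ℝ, 0 < l ∧ w x.1 = l • w y.1 := by
      refine ⟨‖w x.1‖ * ‖w y.1‖⁻¹, by positivity, ?_⟩
      rw [mul_smul, ← e, smul_smul, mul_inv_cancel₀ px.ne', one_smul]
    have e0 : x.1 a - x.1 d = l * (y.1 a - y.1 d) := congrFun (congrArg WithLp.ofLp e') 0
    have e1 : x.1 b - x.1 d = l * (y.1 b - y.1 d) := congrFun (congrArg WithLp.ofLp e') 1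
    have e2 : x.1 c - x.1 d = l * (y.1 c - y.1 d) := congrFun (congrArg WithLp.ofLp e') 2
    have sx := sum1 x.1 x.2
    have sy := sum1 y.1 y.2
    have nx := x.2.1.1
    have ny := y.2.1.1
    -- The points `x` and `l • y` differ by a multiple of `(1, 1, 1, 1)` and both have least
    -- coordinate 0, so they coincide.
    have hk : x.1 d = l * y.1 d := by
      have ha := mul_nonneg hl.le (ny a)
      have hb := mul_nonneg hl.le (ny b)
      have hc := mul_nonneg hl.le (ny c)
      have hd := mul_nonneg hl.le (ny d)
      have na := nx a
      have nb := nx b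
      have nc := nx c
      have nd := nx d
      have up : x.1 d ≤ l * y.1 d := by
        rcases zero x.1 x.2 with h | h | h | h <;> linarith
      have lo : l * y.1 d ≤ x.1 d := by
        rw [mul_sub] at e0 e1 e2
        have hz : l * y.1 a = 0 ∨ l * y.1 b = 0 ∨ l * y.1 c = 0 ∨ l * y.1 d = 0 := by
          rcases zero y.1 y.2 with h | h | h | h <;> simp [h]
        rcases hz with h | h | h | h <;> linarith
      exact le_antisymm up lo
    have hl1 : l = 1 := by
      have : x.1 a + x.1 b + x.1 c + x.1 d = l * (y.1 a + y.1 b + y.1 c + y.1 d) := by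
        linarith
      rw [sx, sy, mul_one] at this
      exact this.symm
    rw [hl1] at e0 e1 e2 hk
    refine Subtype.ext (funext fun v => ?_)
    by_cases hv : v ∈ ({a, b, c, d} : Finset V)
    · simp only [Finset.mem_insert, Finset.mem_singleton] at hv
      rcases hv with rfl | rfl | rfl | rfl <;> linarith
    · rw [supp x.1 x.2 v hv, supp y.1 y.2 v hv]
  have hsurj : Function.Surjective f := by
    rintro ⟨z, hz⟩
    rw [mem_sphere_zero_iff_norm] at hz
    -- Subtracting the least of `z 0`, `z 1`, `z 2`, `0` makes all four coordinates nonnegative with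
    -- one of them zero. Division by `s` then normalizes their sum to 1.
    obtain ⟨m, hm0, hm1, hm2, hm3, hmz⟩ : ∃ m : ℝ, m ≤ z 0 ∧ m ≤ z 1 ∧ m ≤ z 2 ∧ m ≤ 0 ∧
        (z 0 = m ∨ z 1 = m ∨ z 2 = m ∨ 0 = m) := by
      refine ⟨min (min (z 0) (z 1)) (min (z 2) 0), by simp, by simp, by simp, by simp, ?_⟩
      rcases min_choice (min (z 0) (z 1)) (min (z 2) 0) with h | h <;> rw [h]
      · rcases min_choice (z 0) (z 1) with h | h <;> rw [h] <;> simp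
      · rcases min_choice (z 2) 0 with h | h <;> rw [h] <;> simp
    have hs : 0 < z 0 + z 1 + z 2 - 4 * m := by
      by_contra hn
      have hm : m = 0 := by linarith
      have z0 : z 0 = 0 := by linarith
      have z1 : z 1 = 0 := by linarith
      have z2 : z 2 = 0 := by linarith
      have : z = 0 := by
        ext i; fin_cases i
        · exact z0
        · exact z1
        · exact z2
      rw [this, norm_zero] at hz
      exact zero_ne_one hz
    set s := z 0 + z 1 + z 2 - 4 * m with hsdef
    let x : V → ℝ := fun v => if v = a then (z 0 - m) / s else if v = b then (z 1 - m) / s else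
      if v = c then (z 2 - m) / s else if v = d then (0 - m) / s else 0
    have xa : x a = (z 0 - m) / s := if_pos rfl
    have xb : x b = (z 1 - m) / s := by simp [x, hab.symm]
    have xc : x c = (z 2 - m) / s := by simp [x, hac.symm, hbc.symm]
    have xd : x d = (0 - m) / s := by simp [x, had.symm, hbd.symm, hcd.symm]
    have xo : ∀ v, v ∉ ({a, b, c, d} : Finset V) → x v = 0 := by
      intro v hv
      simp only [Finset.mem_insert, Finset.mem_singleton, not_or] at hv
      simp [x, hv]
    have key : ∀ u ∈ ({a, b, c, d} : Finset V), x u = 0 → x ∈ K.carrier := by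
      intro u hu hu0
      refine ⟨⟨fun v => ?_, ?_⟩, ({a, b, c, d} : Finset V).erase u, (hK _).2 ⟨?_, ?_, ?_⟩, ?_⟩
      · simp only [x]
        split_ifs
        · exact div_nonneg (by linarith) hs.le
        · exact div_nonneg (by linarith) hs.le
        · exact div_nonneg (by linarith) hs.le
        · exact div_nonneg (by linarith) hs.le
        · exact le_rfl
      · rw [sum4 x xo, xa, xb, xc, xd, ← add_div, ← add_div, ← add_div, div_eq_one_iff_eq hs.ne',
          hsdef]
        ring
      · rw [← Finset.card_pos, Finset.card_erase_of_mem hu,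
          Finset.card_four_of_ne hab hac had hbc hbd hcd]
        norm_num
      · exact Finset.erase_subset _ _
      · exact fun e => Finset.notMem_erase u _ (e.symm ▸ hu)
      · intro v hv
        rw [Finset.mem_erase, not_and_or, not_not] at hv
        rcases hv with rfl | hv
        · exact hu0
        · exact xo v hv
    have hx : x ∈ K.carrier := by
      rcases hmz with h | h | h | h
      · exact key a (by simp) (by rw [xa, h]; simp)
      · exact key b (by simp) (by rw [xb, h]; simp)
      · exact key c (by simp) (by rw [xc, h]; simp)
      · exact key d (by simp) (by rw [xd, ← h]; simp)
    refine ⟨⟨x, hx⟩, Subtype.ext ?_⟩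
    have hwx : w x = s⁻¹ • z := by
      ext i
      fin_cases i
      · change x a - x d = s⁻¹ * z 0
        rw [xa, xd]; field_simp; ring
      · change x b - x d = s⁻¹ * z 1
        rw [xb, xd]; field_simp; ring
      · change x c - x d = s⁻¹ * z 2
        rw [xc, xd]; field_simp; ring
    change ‖w x‖⁻¹ • w x = z
    rw [hwx, norm_smul, hz, mul_one, norm_inv, Real.norm_of_nonneg hs.le, inv_inv, smul_smul,
      mul_inv_cancel₀ hs.ne', one_smul]
  exact ⟨Continuous.homeoOfEquivCompactToT2 (f := Equiv.ofBijective f ⟨hinj, hsurj⟩) hf⟩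

end PreAbstractSimplicialComplex

end Carrier

/-! ### Spheres recognized by removing vertices of degree three. -/

noncomputable section Ear

variable {V : Type*}

/-- The triangles of a triangulated sphere in which every vertex is adjacent to `t`. -/
structure IsConedSphere (𝒯 : Finset (Finset V)) (t : V) : Prop where
  card_eq : ∀ A ∈ 𝒯, A.card = 3
  two_facets : ∀ e : Finset V, e.card = 2 → (∃ A ∈ 𝒯, e ⊆ A) → (𝒯.filter (e ⊆ ·)).card = 2
  conn : ∀ σ : Finset V, σ.card ≤ 1 → ∀ c : Finset V → ZMod 2,
    (∀ A ∈ 𝒯, ∀ B ∈ 𝒯, σ ⊆ A → σ ⊆ B → (A ∩ B).card = 2 → c A = c B) →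
    ∀ A ∈ 𝒯, ∀ B ∈ 𝒯, σ ⊆ A → σ ⊆ B → c A = c B
  cone : ∀ A ∈ 𝒯, ∀ x ∈ A, ∃ B ∈ 𝒯, t ∈ B ∧ x ∈ B
  count : (𝒯.filter (t ∉ ·)).card + 2 = (𝒯.filter (t ∈ ·)).card

theorem Finset.filter_eq_pair_of_card_two {α : Type*} {s : Finset α} {p : α → Prop}
    [DecidablePred p] (h : (s.filter p).card = 2) {a b : α} (hab : a ≠ b) (ha : a ∈ s) (hb : b ∈ s)
    (pa : p a) (pb : p b) : s.filter p = {a, b} := by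
  symm
  refine Finset.eq_of_subset_of_card_le ?_ (by rw [h, Finset.card_pair hab])
  intro x hx
  simp only [Finset.mem_insert, Finset.mem_singleton] at hx
  rcases hx with rfl | rfl <;> simp [*]

namespace IsConedSphere

variable {𝒯 : Finset (Finset V)} {t : V} (h : IsConedSphere 𝒯 t)
include h

theorem edge_eq {A B e : Finset V} (he : e.card = 2) (hA : A ∈ 𝒯) (hB : B ∈ 𝒯) (hne : A ≠ B)
    (h1 : e ⊆ A) (h2 : e ⊆ B) {X : Finset V} (hX : X ∈ 𝒯) (h3 : e ⊆ X) : X = A ∨ X = B := by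
  have h4 : X ∈ 𝒯.filter (e ⊆ ·) := Finset.mem_filter.2 ⟨hX, h3⟩
  rw [Finset.filter_eq_pair_of_card_two (h.two_facets e he ⟨A, hA, h1⟩) hne hA hB h1 h2] at h4
  simpa using h4

/-- There is a vertex lying in exactly three triangles. -/
theorem exists_ear : ∃ p q r : V, p ≠ q ∧ q ≠ r ∧ p ≠ r ∧ p ≠ t ∧ q ≠ t ∧ r ≠ t ∧
    {t, p, q} ∈ 𝒯 ∧ {t, q, r} ∈ 𝒯 ∧ {p, q, r} ∈ 𝒯 := by
  -- The partner is the triangle across the edge opposite to `t`. It avoids `t`, as otherwise it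
  -- would be the same triangle.
  have partner : ∀ A ∈ 𝒯.filter (t ∈ ·), ∃ B ∈ 𝒯.filter (t ∉ ·), A.erase t ⊆ B := by
    intro A hA
    obtain ⟨hA, ht⟩ := Finset.mem_filter.1 hA
    have hc : (A.erase t).card = 2 := by rw [Finset.card_erase_of_mem ht, h.card_eq A hA]
    have h2 := h.two_facets _ hc ⟨A, hA, Finset.erase_subset _ _⟩
    obtain ⟨B, hB, hne⟩ := Finset.exists_mem_ne (by omega) A (s := 𝒯.filter (A.erase t ⊆ ·))
    obtain ⟨hB, hs⟩ := Finset.mem_filter.1 hB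
    refine ⟨B, Finset.mem_filter.2 ⟨hB, fun htB => hne ?_⟩, hs⟩
    refine (Finset.eq_of_subset_of_card_le ?_ (by rw [h.card_eq A hA, h.card_eq B hB])).symm
    rw [← Finset.insert_erase ht]
    exact Finset.insert_subset htB hs
  choose! f hf hfs using partner
  -- There are two more triangles at `t` than away from it, so two of them share a partner. The
  -- common vertex `q` of the two shared edges then has degree three.
  obtain ⟨A, hA, A', hA', hne, he⟩ := Finset.exists_ne_map_eq_of_card_lt_of_maps_to
    (s := 𝒯.filter (t ∈ ·)) (t := 𝒯.filter (t ∉ ·)) (by have := h.count; omega) hf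
  have hB := Finset.mem_filter.1 (hf A hA)
  have hs := hfs A hA
  have hs' := hfs A' hA'
  rw [← he] at hs'
  have hAm := Finset.mem_filter.1 hA
  have hAm' := Finset.mem_filter.1 hA'
  obtain ⟨r, hr, er⟩ := Finset.exists_erase_of_card (n := 2) (h.card_eq _ hB.1)
    (by rw [Finset.card_erase_of_mem hAm.2, h.card_eq A hAm.1]) hs
  obtain ⟨p, hp, ep⟩ := Finset.exists_erase_of_card (n := 2) (h.card_eq _ hB.1)
    (by rw [Finset.card_erase_of_mem hAm'.2, h.card_eq A' hAm'.1]) hs'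
  have hpr : p ≠ r := by
    rintro rfl
    apply hne
    rw [← Finset.insert_erase hAm.2, ← Finset.insert_erase hAm'.2, er, ep]
  obtain ⟨q, hq⟩ := Finset.card_eq_one.1 (show (((f A).erase p).erase r).card = 1 by
    rw [Finset.card_erase_of_mem (Finset.mem_erase.2 ⟨hpr.symm, hr⟩), Finset.card_erase_of_mem hp,
      h.card_eq _ hB.1])
  have hq' : q ∈ ((f A).erase p).erase r := by rw [hq]; simp
  simp only [Finset.mem_erase] at hq'
  have hBe : f A = {p, q, r} := by
    rw [← Finset.insert_erase hp, ← Finset.insert_erase (Finset.mem_erase.2 ⟨hpr.symm, hr⟩), hq,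
      Finset.pair_comm r q]
  refine ⟨p, q, r, hq'.2.1.symm, hq'.1, hpr, ?_, ?_, ?_, ?_, ?_, hBe ▸ hB.1⟩
  · rintro rfl; exact hB.2 hp
  · rintro rfl; exact hB.2 hq'.2.2
  · rintro rfl; exact hB.2 hr
  · convert hAm.1
    rw [← Finset.insert_erase hAm.2, er, hBe]
    congr 1
    ext z; simp only [Finset.mem_erase, Finset.mem_insert, Finset.mem_singleton]
    grind
  · convert hAm'.1
    rw [← Finset.insert_erase hAm'.2, ep, hBe]
    congr 1
    ext z; simp only [Finset.mem_erase, Finset.mem_insert, Finset.mem_singleton]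
    grind

end IsConedSphere

theorem Finset.eq_pair_of_subset_three {e : Finset V} {a b c : V} (he : e.card = 2)
    (hs : e ⊆ {a, b, c}) : e = {a, b} ∨ e = {b, c} ∨ e = {a, c} := by
  obtain ⟨x, y, hxy, rfl⟩ := Finset.card_eq_two.1 he
  have hx := hs (Finset.mem_insert_self x _)
  have hy := hs (Finset.mem_insert_of_mem (Finset.mem_singleton_self y))
  simp only [Finset.mem_insert, Finset.mem_singleton] at hx hy
  rcases hx with rfl | rfl | rfl <;> rcases hy with rfl | rfl | rfl <;>
    simp_all [Finset.pair_comm]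

/-- An ear: a vertex `q` of degree three adjacent to `t`. -/
structure IsEar (𝒯 : Finset (Finset V)) (t p q r : V) : Prop where
  pq : p ≠ q
  qr : q ≠ r
  pr : p ≠ r
  pt : p ≠ t
  qt : q ≠ t
  rt : r ≠ t
  mem1 : {t, p, q} ∈ 𝒯
  mem2 : {t, q, r} ∈ 𝒯
  mem3 : {p, q, r} ∈ 𝒯

namespace IsConedSphere

variable {𝒯 : Finset (Finset V)} {t p q r : V} (h : IsConedSphere 𝒯 t) (e : IsEar 𝒯 t p q r)
include h e

theorem ear_ne : ({t, p, q} : Finset V) ≠ {t, q, r} ∧ ({t, p, q} : Finset V) ≠ {p, q, r} ∧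
    ({t, q, r} : Finset V) ≠ {p, q, r} := by
  have h1 := e.pq; have h2 := e.qr; have h3 := e.pr; have h4 := e.pt; have h5 := e.qt
  have h6 := e.rt
  refine ⟨fun he => ?_, fun he => ?_, fun he => ?_⟩
  · have : p ∈ ({t, q, r} : Finset V) := by rw [← he]; simp
    simp [h1, h3, h4] at this
  · have : t ∈ ({p, q, r} : Finset V) := by rw [← he]; simp
    simp [h4.symm, h5.symm, h6.symm] at this
  · have : t ∈ ({p, q, r} : Finset V) := by rw [← he]; simp
    simp [h4.symm, h5.symm, h6.symm] at this

/-- The three triangles of the ear close up around `q`: adjacency at `q` never leaves them, and the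
star of `q` is connected. -/
theorem eq_of_mem_ear {F : Finset V} (hF : F ∈ 𝒯) (hq : q ∈ F) :
    F = {t, p, q} ∨ F = {t, q, r} ∨ F = {p, q, r} := by
  obtain ⟨n1, n2, n3⟩ := h.ear_ne e
  let S : Finset (Finset V) := {{t, p, q}, {t, q, r}, {p, q, r}}
  have step : ∀ A ∈ 𝒯, ∀ B ∈ 𝒯, q ∈ A → q ∈ B → (A ∩ B).card = 2 → A ∈ S → B ∈ S := by
    intro A hA B hB hqA hqB hc hAS
    obtain ⟨z, hz⟩ := Finset.card_eq_one.1 (show ((A ∩ B).erase q).card = 1 by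
      rw [Finset.card_erase_of_mem (Finset.mem_inter.2 ⟨hqA, hqB⟩), hc])
    have hze : A ∩ B = {q, z} := by
      rw [← Finset.insert_erase (Finset.mem_inter.2 ⟨hqA, hqB⟩), hz]
    have hzm : z ∈ (A ∩ B).erase q := by rw [hz]; simp
    rw [Finset.mem_erase, Finset.mem_inter] at hzm
    have hsub : {q, z} ⊆ B := by rw [← hze]; exact Finset.inter_subset_right
    have hcz : ({q, z} : Finset V).card = 2 := Finset.card_pair hzm.1.symm
    have hz3 : z = t ∨ z = p ∨ z = r := by
      simp only [S, Finset.mem_insert, Finset.mem_singleton] at hAS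
      rcases hAS with rfl | rfl | rfl <;>
      · have := hzm.2.1
        simp only [Finset.mem_insert, Finset.mem_singleton] at this
        have := hzm.1
        tauto
    simp only [S, Finset.mem_insert, Finset.mem_singleton]
    rcases hz3 with rfl | rfl | rfl
    · have := h.edge_eq hcz e.mem1 e.mem2 n1 (by simp [Finset.insert_subset_iff])
        (by simp [Finset.insert_subset_iff]) hB hsub
      tauto
    · have := h.edge_eq hcz e.mem1 e.mem3 n2 (by simp [Finset.insert_subset_iff])
        (by simp [Finset.insert_subset_iff]) hB hsub
      tauto
    · have := h.edge_eq hcz e.mem2 e.mem3 n3 (by simp)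
        (by simp) hB hsub
      tauto
  have := h.conn {q} (by simp) (fun F => if F ∈ S then 1 else 0) (by
    intro A hA B hB hqA hqB hc
    rw [Finset.singleton_subset_iff] at hqA hqB
    have : A ∈ S ↔ B ∈ S := ⟨step A hA B hB hqA hqB hc,
      step B hB A hA hqB hqA (by rwa [Finset.inter_comm])⟩
    simp only [this]) {t, p, q} e.mem1 F hF (by simp) (by simpa using hq)
  rw [if_pos (by simp [S])] at this
  have hFS : F ∈ S := by
    by_contra hn
    rw [if_neg hn] at this
    exact one_ne_zero this
  simpa [S] using hFS

/-- Together with `tpr` the ear forms the boundary of a tetrahedron. It is closed under adjacency,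
hence everything. -/
theorem eq_of_ear_closed (hC : {t, p, r} ∈ 𝒯) {F : Finset V} (hF : F ∈ 𝒯) :
    F = {t, p, q} ∨ F = {t, q, r} ∨ F = {p, q, r} ∨ F = {t, p, r} := by
  let S : Finset (Finset V) := {{t, p, q}, {t, q, r}, {p, q, r}, {t, p, r}}
  have hqC : q ∉ ({t, p, r} : Finset V) := by simp [e.qt, e.pq.symm, e.qr]
  have hneC : ∀ A : Finset V, q ∈ A → A ≠ {t, p, r} := fun A hA he => hqC (he ▸ hA)
  have step : ∀ A ∈ 𝒯, ∀ B ∈ 𝒯, (A ∩ B).card = 2 → A ∈ S → B ∈ S := by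
    intro A hA B hB hc hAS
    by_cases hqB : q ∈ B
    · have := h.eq_of_mem_ear e hB hqB
      simp only [S, Finset.mem_insert, Finset.mem_singleton]
      tauto
    have hsub : A ∩ B ⊆ {t, p, r} := by
      intro z hz
      obtain ⟨hzA, hzB⟩ := Finset.mem_inter.1 hz
      have hzq : z ≠ q := fun e => hqB (e ▸ hzB)
      simp only [S, Finset.mem_insert, Finset.mem_singleton] at hAS
      rcases hAS with rfl | rfl | rfl | rfl <;>
      · simp only [Finset.mem_insert, Finset.mem_singleton] at hzA ⊢
        tauto
    have hsB : A ∩ B ⊆ B := Finset.inter_subset_right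
    simp only [S, Finset.mem_insert, Finset.mem_singleton]
    rcases Finset.eq_pair_of_subset_three hc hsub with he | he | he <;> rw [he] at hc hsB
    · have := h.edge_eq hc e.mem1 hC (hneC _ (by simp)) (by simp [Finset.insert_subset_iff])
        (by simp [Finset.insert_subset_iff]) hB hsB
      tauto
    · have := h.edge_eq hc e.mem3 hC (hneC _ (by simp)) (by simp [Finset.insert_subset_iff])
        (by simp) hB hsB
      tauto
    · have := h.edge_eq hc e.mem2 hC (hneC _ (by simp)) (by simp [Finset.insert_subset_iff])
        (by simp [Finset.insert_subset_iff]) hB hsB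
      tauto
  have := h.conn ∅ (by simp) (fun F => if F ∈ S then 1 else 0) (by
    intro A hA B hB _ _ hc
    have : A ∈ S ↔ B ∈ S := ⟨step A hA B hB hc, step B hB A hA (by rwa [Finset.inter_comm])⟩
    simp only [this]) {t, p, q} e.mem1 F hF (by simp) (by simp)
  rw [if_pos (by simp [S])] at this
  have hFS : F ∈ S := by
    by_contra hn
    rw [if_neg hn] at this
    exact one_ne_zero this
  simpa [S] using hFS

theorem carrier_closed [Fintype V] (hC : {t, p, r} ∈ 𝒯) :
    Nonempty ((ofFacets 𝒯).carrier ≃ₜ Sphere2) := by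
  have h1 := e.pq; have h2 := e.qr; have h3 := e.pr; have h4 := e.pt; have h5 := e.qt
  have h6 := e.rt
  refine PreAbstractSimplicialComplex.nonempty_homeomorph_sphere_of_tetrahedron (a := t) (b := p)
    (c := q) (d := r) h4.symm h5.symm h6.symm h1 h3 h2 fun σ => ?_
  rw [mem_ofFacets]
  have hcard : ({t, p, q, r} : Finset V).card = 4 :=
    Finset.card_four_of_ne h4.symm h5.symm h6.symm h1 h3 h2
  constructor
  · rintro ⟨hn, F, hF, hs⟩
    refine ⟨hn, hs.trans ?_, ?_⟩
    · rcases h.eq_of_ear_closed e hC hF with rfl | rfl | rfl | rfl <;>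
        simp [Finset.insert_subset_iff]
    · rintro rfl
      have := Finset.card_le_card hs
      rw [hcard, h.card_eq F hF] at this
      omega
  · rintro ⟨hn, hs, hne⟩
    refine ⟨hn, ?_⟩
    have : ¬ ({t, p, q, r} : Finset V) ⊆ σ := fun h => hne (hs.antisymm h)
    rw [Finset.not_subset] at this
    obtain ⟨z, hz, hzσ⟩ := this
    have key : ∀ F, (∀ y ∈ ({t, p, q, r} : Finset V), y ≠ z → y ∈ F) → σ ⊆ F :=
      fun F hF y hy => hF y (hs hy) fun e => hzσ (e ▸ hy)
    simp only [Finset.mem_insert, Finset.mem_singleton] at hz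
    rcases hz with rfl | rfl | rfl | rfl
    · exact ⟨_, e.mem3, key _ fun y hy hne => by
        simp only [Finset.mem_insert, Finset.mem_singleton] at hy ⊢; tauto⟩
    · exact ⟨_, e.mem2, key _ fun y hy hne => by
        simp only [Finset.mem_insert, Finset.mem_singleton] at hy ⊢; tauto⟩
    · exact ⟨_, hC, key _ fun y hy hne => by
        simp only [Finset.mem_insert, Finset.mem_singleton] at hy ⊢; tauto⟩
    · exact ⟨_, e.mem1, key _ fun y hy hne => by
        simp only [Finset.mem_insert, Finset.mem_singleton] at hy ⊢; tauto⟩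

/-- Removing an ear gives a smaller coned sphere. -/
theorem removeEar (hC : {t, p, r} ∉ 𝒯) :
    IsConedSphere (insert {t, p, r} (𝒯.filter (q ∉ ·))) t := by
  have h1 := e.pq; have h2 := e.qr; have h3 := e.pr; have h4 := e.pt; have h5 := e.qt
  have h6 := e.rt
  obtain ⟨n1, n2, n3⟩ := h.ear_ne e
  set C : Finset V := {t, p, r} with hCdef
  have hqC : q ∉ C := by simp [C, e.qt, e.pq.symm, e.qr]
  have hCcard : C.card = 3 := Finset.card_three_of_ne h4.symm h6.symm h3
  have memT : ∀ F, F ∈ insert C (𝒯.filter (q ∉ ·)) ↔ F = C ∨ F ∈ 𝒯 ∧ q ∉ F := by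
    intro F; simp
  have sub : ∀ F ∈ 𝒯, q ∈ F → ∀ z ∈ F, z ≠ q → z ∈ C := by
    intro F hF hq z hz hzq
    rcases h.eq_of_mem_ear e hF hq with rfl | rfl | rfl <;>
    · simp only [Finset.mem_insert, Finset.mem_singleton, C] at hz ⊢
      tauto
  have hcard : ∀ F ∈ insert C (𝒯.filter (q ∉ ·)), F.card = 3 := by
    intro F hF
    rcases (memT F).1 hF with rfl | hF
    · exact hCcard
    · exact h.card_eq F hF.1
  have tw : ∀ s : Finset V, s.card = 2 → ∀ A ∈ 𝒯, s ⊆ A → q ∈ A → s ⊆ C →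
      ((insert C (𝒯.filter (q ∉ ·))).filter (s ⊆ ·)).card = 2 := by
    intro s hs A hA hsA hqA hsC
    have huniq : ∀ X ∈ 𝒯, q ∈ X → s ⊆ X → X = A := by
      intro X hX hqX hsX
      have hqs : q ∉ s := fun hh => hqC (hsC hh)
      have c1 : insert q s = X := Finset.eq_of_subset_of_card_le (Finset.insert_subset hqX hsX)
        (by rw [Finset.card_insert_of_notMem hqs, hs, h.card_eq X hX])
      have c2 : insert q s = A := Finset.eq_of_subset_of_card_le (Finset.insert_subset hqA hsA)
        (by rw [Finset.card_insert_of_notMem hqs, hs, h.card_eq A hA])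
      exact c1.symm.trans c2
    have e1 : (insert C (𝒯.filter (q ∉ ·))).filter (s ⊆ ·) =
        insert C ((𝒯.filter (s ⊆ ·)).erase A) := by
      ext X
      simp only [Finset.mem_filter, Finset.mem_insert, Finset.mem_erase]
      constructor
      · rintro ⟨rfl | ⟨hX, hqX⟩, hsX⟩
        · exact Or.inl rfl
        · exact Or.inr ⟨fun e => hqX (e ▸ hqA), hX, hsX⟩
      · rintro (rfl | ⟨hXA, hX, hsX⟩)
        · exact ⟨Or.inl rfl, hsC⟩
        · exact ⟨Or.inr ⟨hX, fun hqX => hXA (huniq X hX hqX hsX)⟩, hsX⟩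
    rw [e1, Finset.card_insert_of_notMem, Finset.card_erase_of_mem, h.two_facets s hs ⟨A, hA, hsA⟩]
    · exact Finset.mem_filter.2 ⟨hA, hsA⟩
    · intro hm
      exact hC (Finset.mem_filter.1 (Finset.mem_of_mem_erase hm)).1
  refine ⟨hcard, ?_, ?_, ?_, ?_⟩
  · rintro s hs ⟨F, hF, hsF⟩
    by_cases hsC : s ⊆ C
    · obtain ⟨A, hA, hqA, hsA⟩ : ∃ A ∈ 𝒯, q ∈ A ∧ s ⊆ A := by
        rcases Finset.eq_pair_of_subset_three hs hsC with rfl | rfl | rfl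
        · exact ⟨_, e.mem1, by simp, by simp [Finset.insert_subset_iff]⟩
        · exact ⟨_, e.mem3, by simp, by simp [Finset.insert_subset_iff]⟩
        · exact ⟨_, e.mem2, by simp, by simp [Finset.insert_subset_iff]⟩
      exact tw s hs A hA hsA hqA hsC
    · rcases (memT F).1 hF with rfl | ⟨hF, hqF⟩
      · exact (hsC hsF).elim
      rw [← h.two_facets s hs ⟨F, hF, hsF⟩]
      congr 1
      ext X
      simp only [Finset.mem_filter, Finset.mem_insert]
      constructor
      · rintro ⟨rfl | hX, hsX⟩
        · exact (hsC hsX).elim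
        · exact ⟨hX.1, hsX⟩
      · rintro ⟨hX, hsX⟩
        refine ⟨Or.inr ⟨hX, fun hqX => hsC fun z hz => ?_⟩, hsX⟩
        exact sub X hX hqX z (hsX hz) fun e => hqF (e ▸ hsF hz)
  · intro σ hσ c hc
    -- Giving the removed triangles the colour of `C` turns a colouring of the smaller sphere into
    -- one of the original, whose connectedness can be used.
    let c' : Finset V → ZMod 2 := fun F => if q ∈ F then c C else c F
    have cross : ∀ F ∈ 𝒯, ∀ G ∈ 𝒯, σ ⊆ F → σ ⊆ G → (F ∩ G).card = 2 → q ∈ F → q ∉ G →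
        c C = c G := by
      intro F hF G hG hσF hσG hFG hqF hqG
      have hsub : F ∩ G ⊆ C := fun z hz => by
        obtain ⟨hzF, hzG⟩ := Finset.mem_inter.1 hz
        exact sub F hF hqF z hzF fun e => hqG (e ▸ hzG)
      refine hc C ((memT _).2 (Or.inl rfl)) G ((memT _).2 (Or.inr ⟨hG, hqG⟩))
        ((Finset.subset_inter hσF hσG).trans hsub) hσG ?_
      have hle : F ∩ G ⊆ C ∩ G := Finset.subset_inter hsub Finset.inter_subset_right
      have l1 := Finset.card_le_card hle
      have l2 : (C ∩ G).card ≤ C.card := Finset.card_le_card Finset.inter_subset_left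
      by_contra hn
      have l3 : (C ∩ G).card = 3 := by omega
      have m1 : C ∩ G = C := Finset.eq_of_subset_of_card_le Finset.inter_subset_left (by omega)
      have m2 : C ∩ G = G := Finset.eq_of_subset_of_card_le Finset.inter_subset_right
        (by rw [h.card_eq G hG]; omega)
      exact hC (m1.symm.trans m2 ▸ hG)
    have hconst := h.conn σ hσ c' (by
      intro F hF G hG hσF hσG hFG
      by_cases hqF : q ∈ F <;> by_cases hqG : q ∈ G
      · simp only [c', if_pos hqF, if_pos hqG]
      · simp only [c', if_pos hqF, if_neg hqG]
        exact cross F hF G hG hσF hσG hFG hqF hqG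
      · simp only [c', if_neg hqF, if_pos hqG]
        exact (cross G hG F hF hσG hσF (by rwa [Finset.inter_comm]) hqG hqF).symm
      · simp only [c', if_neg hqF, if_neg hqG]
        exact hc F ((memT _).2 (Or.inr ⟨hF, hqF⟩)) G ((memT _).2 (Or.inr ⟨hG, hqG⟩)) hσF hσG hFG)
    have rep : ∀ F ∈ insert C (𝒯.filter (q ∉ ·)), σ ⊆ F → ∃ G ∈ 𝒯, σ ⊆ G ∧ c' G = c F := by
      intro F hF hσF
      rcases (memT F).1 hF with rfl | ⟨hF, hqF⟩
      · rcases Finset.eq_empty_or_nonempty σ with rfl | ⟨z, hz⟩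
        · exact ⟨_, e.mem1, by simp, by simp [c']⟩
        · have hσz : σ = {z} :=
            (Finset.eq_of_subset_of_card_le (Finset.singleton_subset_iff.2 hz) (by simpa)).symm
          subst hσz
          rw [Finset.singleton_subset_iff] at hσF
          simp only [C, Finset.mem_insert, Finset.mem_singleton] at hσF
          rcases hσF with rfl | rfl | rfl
          · exact ⟨_, e.mem1, by simp, by simp [c']⟩
          · exact ⟨_, e.mem1, by simp, by simp [c']⟩
          · exact ⟨_, e.mem2, by simp, by simp [c']⟩
      · exact ⟨F, hF, hσF, by simp [c', hqF]⟩
    intro F hF G hG hσF hσG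
    obtain ⟨F', hF', hσF', eF⟩ := rep F hF hσF
    obtain ⟨G', hG', hσG', eG⟩ := rep G hG hσG
    rw [← eF, ← eG]
    exact hconst F' hF' G' hG' hσF' hσG'
  · intro F hF x hx
    have hCm : C ∈ insert C (𝒯.filter (q ∉ ·)) := (memT _).2 (Or.inl rfl)
    rcases (memT F).1 hF with rfl | ⟨hF, hqF⟩
    · exact ⟨C, hCm, by simp [C], hx⟩
    · obtain ⟨B, hB, htB, hxB⟩ := h.cone F hF x hx
      by_cases hqB : q ∈ B
      · exact ⟨C, hCm, by simp [C], sub B hB hqB x hxB fun e => hqF (e ▸ hx)⟩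
      · exact ⟨B, (memT _).2 (Or.inr ⟨hB, hqB⟩), htB, hxB⟩
  · have t1 : (insert C (𝒯.filter (q ∉ ·))).filter (t ∈ ·) =
        insert C (((𝒯.filter (t ∈ ·)).erase {t, p, q}).erase {t, q, r}) := by
      ext X
      simp only [Finset.mem_filter, Finset.mem_insert, Finset.mem_erase]
      constructor
      · rintro ⟨rfl | ⟨hX, hqX⟩, htX⟩
        · exact Or.inl rfl
        · exact Or.inr ⟨by rintro rfl; simp at hqX, by rintro rfl; simp at hqX, hX, htX⟩
      · rintro (rfl | ⟨hX1, hX2, hX, htX⟩)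
        · exact ⟨Or.inl rfl, by simp [C]⟩
        · refine ⟨Or.inr ⟨hX, fun hqX => ?_⟩, htX⟩
          rcases h.eq_of_mem_ear e hX hqX with rfl | rfl | rfl
          · exact hX2 rfl
          · exact hX1 rfl
          · simp [h4.symm, h5.symm, h6.symm] at htX
    have t2 : (insert C (𝒯.filter (q ∉ ·))).filter (t ∉ ·) =
        (𝒯.filter (t ∉ ·)).erase {p, q, r} := by
      ext X
      simp only [Finset.mem_filter, Finset.mem_insert, Finset.mem_erase]
      constructor
      · rintro ⟨rfl | ⟨hX, hqX⟩, htX⟩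
        · simp [C] at htX
        · exact ⟨by rintro rfl; simp at hqX, hX, htX⟩
      · rintro ⟨hX1, hX, htX⟩
        refine ⟨Or.inr ⟨hX, fun hqX => ?_⟩, htX⟩
        rcases h.eq_of_mem_ear e hX hqX with rfl | rfl | rfl
        · simp at htX
        · simp at htX
        · exact hX1 rfl
    have m1 : {t, p, q} ∈ 𝒯.filter (t ∈ ·) := Finset.mem_filter.2 ⟨e.mem1, by simp⟩
    have m2 : {t, q, r} ∈ 𝒯.filter (t ∈ ·) := Finset.mem_filter.2 ⟨e.mem2, by simp⟩
    have m3 : {p, q, r} ∈ 𝒯.filter (t ∉ ·) :=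
      Finset.mem_filter.2 ⟨e.mem3, by simp [h4.symm, h5.symm, h6.symm]⟩
    have m2' : {t, q, r} ∈ (𝒯.filter (t ∈ ·)).erase {t, p, q} :=
      Finset.mem_erase.2 ⟨n1.symm, m2⟩
    have mC : C ∉ ((𝒯.filter (t ∈ ·)).erase {t, p, q}).erase {t, q, r} := fun hm => hC
      (Finset.mem_filter.1 (Finset.mem_of_mem_erase (Finset.mem_of_mem_erase hm))).1
    rw [t1, t2, Finset.card_insert_of_notMem mC, Finset.card_erase_of_mem m2',
      Finset.card_erase_of_mem m1, Finset.card_erase_of_mem m3]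
    have := h.count
    have p3 : 0 < (𝒯.filter (t ∉ ·)).card := Finset.card_pos.2 ⟨_, m3⟩
    omega

/-- The star of `q` is the triangle `tpr` starred at an interior point. -/
theorem carrier_removeEar [Fintype V] (hC : {t, p, r} ∉ 𝒯) :
    Nonempty ((ofFacets 𝒯).carrier ≃ₜ
      (ofFacets (insert {t, p, r} (𝒯.filter (q ∉ ·)))).carrier) := by
  have h1 := e.pq; have h2 := e.qr; have h3 := e.pr; have h4 := e.pt; have h5 := e.qt
  have h6 := e.rt
  set C : Finset V := {t, p, r} with hCdef
  have hqC : q ∉ C := by simp [C, e.qt, e.pq.symm, e.qr]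
  have hCcard : C.card = 3 := Finset.card_three_of_ne h4.symm h6.symm h3
  have sub : ∀ F ∈ 𝒯, q ∈ F → F ⊆ insert q C := by
    intro F hF hq z hz
    rcases h.eq_of_mem_ear e hF hq with rfl | rfl | rfl <;>
    · simp only [Finset.mem_insert, Finset.mem_singleton, C] at hz ⊢
      tauto
  refine PreAbstractSimplicialComplex.nonempty_homeomorph_of_starring hCcard hqC ?_ ?_ ?_ ?_ ?_ ?_
  · rintro σ ⟨hn, F, hF, hs⟩ hq
    exact hs.trans (sub F hF (hs hq))
  · rintro σ ⟨hn, F, hF, hs⟩ hCσ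
    have : C = F := Finset.eq_of_subset_of_card_le (hCσ.trans hs) (by rw [h.card_eq F hF, hCcard])
    exact hC (this ▸ hF)
  · rintro σ ⟨hn, F, hF, hs⟩ hq
    by_cases hqF : q ∈ F
    · refine ⟨hn, C, Finset.mem_insert_self _ _, fun z hz => ?_⟩
      have := sub F hF hqF (hs hz)
      rw [Finset.mem_insert] at this
      exact this.resolve_left fun e => hq (e ▸ hz)
    · exact ⟨hn, F, Finset.mem_insert_of_mem (Finset.mem_filter.2 ⟨hF, hqF⟩), hs⟩
  · exact ⟨⟨t, by simp [C]⟩, C, Finset.mem_insert_self _ _, Finset.Subset.refl _⟩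
  · rintro σ ⟨hn, F, hF, hs⟩
    rw [Finset.mem_insert, Finset.mem_filter] at hF
    rcases hF with rfl | ⟨hF, hqF⟩
    · exact Or.inl hs
    · exact Or.inr ⟨⟨hn, F, hF, hs⟩, fun hq => hqF (hs hq)⟩
  · intro σ hσ hn hCσ
    rw [Finset.not_subset] at hCσ
    obtain ⟨z, hz, hzσ⟩ := hCσ
    refine ⟨hn, ?_⟩
    have key : ∀ F, (∀ y ∈ insert q C, y ≠ z → y ∈ F) → σ ⊆ F :=
      fun F hF y hy => hF y (hσ hy) fun e => hzσ (e ▸ hy)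
    simp only [C, Finset.mem_insert, Finset.mem_singleton] at hz
    rcases hz with rfl | rfl | rfl
    · exact ⟨_, e.mem3, key _ fun y hy hne => by
        simp only [C, Finset.mem_insert, Finset.mem_singleton] at hy ⊢; tauto⟩
    · exact ⟨_, e.mem2, key _ fun y hy hne => by
        simp only [C, Finset.mem_insert, Finset.mem_singleton] at hy ⊢; tauto⟩
    · exact ⟨_, e.mem1, key _ fun y hy hne => by
        simp only [C, Finset.mem_insert, Finset.mem_singleton] at hy ⊢; tauto⟩

omit e in
theorem nonempty_homeomorph_sphere [Fintype V] :
    Nonempty ((ofFacets 𝒯).carrier ≃ₜ Sphere2) := by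
  induction hn : 𝒯.card using Nat.strong_induction_on generalizing 𝒯 with
  | _ n ih =>
    obtain ⟨p, q, r, a1, a2, a3, a4, a5, a6, a7, a8, a9⟩ := h.exists_ear
    have e : IsEar 𝒯 t p q r := ⟨a1, a2, a3, a4, a5, a6, a7, a8, a9⟩
    by_cases hC : {t, p, r} ∈ 𝒯
    · exact h.carrier_closed e hC
    · obtain ⟨f⟩ := h.carrier_removeEar e hC
      have hlt : (insert {t, p, r} (𝒯.filter (q ∉ ·))).card < n := by
        have h1 := Finset.card_insert_le ({t, p, r} : Finset V) (𝒯.filter (q ∉ ·))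
        have h2 : ({{t, p, q}, {t, q, r}} : Finset (Finset V)) ⊆ 𝒯.filter (¬ q ∉ ·) := by
          intro X hX
          simp only [Finset.mem_insert, Finset.mem_singleton] at hX
          rcases hX with rfl | rfl
          · exact Finset.mem_filter.2 ⟨a7, by simp⟩
          · exact Finset.mem_filter.2 ⟨a8, by simp⟩
        have h3 := Finset.card_le_card h2
        rw [Finset.card_pair (h.ear_ne e).1] at h3
        have h4 := Finset.card_filter_add_card_filter_not (s := 𝒯) (fun F => q ∉ F)
        omega
      obtain ⟨g⟩ := ih _ hlt (h.removeEar e hC) rfl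
      exact ⟨f.trans g⟩

end IsConedSphere

/-- The hypothesis on the counts is Euler's relation with `bettiAt` equal to zero. -/
theorem IsConedNormal.isConedSphere_link {𝓕 : Finset (Finset V)} {t : V}
    (h : IsConedNormal 𝓕 t) {x : V} (hxt : x ≠ t)
    (hc : outerCount 𝓕 t x + 2 = innerCount 𝓕 t x) :
    IsConedSphere ((𝓕.filter (x ∈ ·)).image (Finset.erase · x)) t := by
  have mem : ∀ A, A ∈ (𝓕.filter (x ∈ ·)).image (Finset.erase · x) ↔
      x ∉ A ∧ insert x A ∈ 𝓕 := by
    intro A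
    simp only [Finset.mem_image, Finset.mem_filter]
    constructor
    · rintro ⟨F, ⟨hF, hx⟩, rfl⟩
      exact ⟨Finset.notMem_erase _ _, by rwa [Finset.insert_erase hx]⟩
    · rintro ⟨hx, hA⟩
      exact ⟨insert x A, ⟨hA, by simp⟩, Finset.erase_insert hx⟩
  have cardA : ∀ A, x ∉ A → insert x A ∈ 𝓕 → A.card = 3 := by
    intro A hx hA
    have := h.card_eq _ hA
    rw [Finset.card_insert_of_notMem hx] at this
    omega
  have count : ∀ (P : Finset V → Prop) [DecidablePred P], (((𝓕.filter (x ∈ ·)).image (Finset.erase · x)).filter P).card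
      = (𝓕.filter fun F => x ∈ F ∧ P (F.erase x)).card := by
    intro P _
    rw [Finset.filter_image, Finset.card_image_of_injOn, Finset.filter_filter]
    intro F hF G hG he
    simp only [Finset.coe_filter, Finset.mem_filter, Set.mem_ofPred_eq] at hF hG
    have he' : F.erase x = G.erase x := he
    rw [← Finset.insert_erase hF.1.2, he', Finset.insert_erase hG.1.2]
  refine ⟨fun A hA => ?_, ?_, ?_, ?_, ?_⟩
  · exact cardA A ((mem A).1 hA).1 ((mem A).1 hA).2
  · rintro s hs ⟨A, hA, hsA⟩
    obtain ⟨hx, hA⟩ := (mem A).1 hA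
    have hxs : x ∉ s := fun hh => hx (hsA hh)
    have := h.two_facets (insert x s) (by rw [Finset.card_insert_of_notMem hxs, hs])
      ⟨_, hA, Finset.insert_subset_insert x hsA⟩
    rw [← this]
    refine (count (s ⊆ ·)).trans ?_
    congr 1
    refine Finset.filter_congr fun F _ => ?_
    rw [Finset.insert_subset_iff, Finset.subset_erase]
    tauto
  · intro σ hσ c hcc
    by_cases hxσ : x ∈ σ
    · intro A hA B hB hσA
      exact (((mem A).1 hA).1 (hσA hxσ)).elim
    have := h.conn (insert x σ) (by rw [Finset.card_insert_of_notMem hxσ]; omega)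
      (fun F => c (F.erase x)) (by
        intro F hF G hG hσF hσG hFG
        rw [Finset.insert_subset_iff] at hσF hσG
        refine hcc _ ((mem _).2 ⟨Finset.notMem_erase _ _, by rwa [Finset.insert_erase hσF.1]⟩) _
          ((mem _).2 ⟨Finset.notMem_erase _ _, by rwa [Finset.insert_erase hσG.1]⟩)
          (Finset.subset_erase.2 ⟨hσF.2, hxσ⟩) (Finset.subset_erase.2 ⟨hσG.2, hxσ⟩) ?_
        have e : F.erase x ∩ G.erase x = (F ∩ G).erase x := by
          ext z; simp only [Finset.mem_inter, Finset.mem_erase]; tauto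
        rw [e, Finset.card_erase_of_mem (Finset.mem_inter.2 ⟨hσF.1, hσG.1⟩), hFG])
    intro A hA B hB hσA hσB
    obtain ⟨hxA, hA⟩ := (mem A).1 hA
    obtain ⟨hxB, hB⟩ := (mem B).1 hB
    have := this _ hA _ hB (Finset.insert_subset_insert x hσA) (Finset.insert_subset_insert x hσB)
    simpa only [Finset.erase_insert hxA, Finset.erase_insert hxB] using this
  · intro A hA y hy
    obtain ⟨hxA, hA⟩ := (mem A).1 hA
    obtain ⟨G, hG, htG, hxG, hyG⟩ := h.cone_mem hA (x := x) (y := y) (by simp) (by simp [hy])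
    refine ⟨G.erase x, (mem _).2 ⟨Finset.notMem_erase _ _, by rwa [Finset.insert_erase hxG]⟩,
      Finset.mem_erase.2 ⟨hxt.symm, htG⟩, Finset.mem_erase.2 ⟨?_, hyG⟩⟩
    rintro rfl
    exact hxA hy
  · refine ((congrArg (· + 2) (count (t ∉ ·))).trans (Eq.trans ?_ hc)).trans
      (Eq.trans ?_ (count (t ∈ ·)).symm)
    · rw [outerCount]
      congr 2
      refine Finset.filter_congr fun F _ => ?_
      simp [hxt.symm]
    · rw [innerCount]
      congr 1
      refine Finset.filter_congr fun F _ => ?_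
      simp [hxt.symm]

theorem link_ofFacets_eq (𝓕 : Finset (Finset V)) (x : V) :
    (ofFacets 𝓕).link {x} = ofFacets ((𝓕.filter (x ∈ ·)).image (Finset.erase · x)) := by
  ext τ
  change τ ∈ (ofFacets 𝓕).link {x} ↔ τ ∈ ofFacets _
  rw [mem_link_ofFacets, mem_ofFacets]
  refine and_congr_right fun hn => ?_
  simp only [Finset.mem_image, Finset.mem_filter, Finset.disjoint_singleton_left]
  constructor
  · rintro ⟨hx, F, hF, hs⟩
    refine ⟨F.erase x, ⟨F, ⟨hF, hs (by simp)⟩, rfl⟩, ?_⟩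
    exact Finset.subset_erase.2 ⟨Finset.subset_union_right.trans hs, hx⟩
  · rintro ⟨_, ⟨F, ⟨hF, hx⟩, rfl⟩, hs⟩
    rw [Finset.subset_erase] at hs
    exact ⟨hs.2, F, hF, Finset.union_subset (by simpa using hx) hs.1⟩

theorem IsConedNormal.nonempty_link_homeomorph_sphere [Fintype V] {𝓕 : Finset (Finset V)} {t : V}
    (h : IsConedNormal 𝓕 t) {x : V} (hxt : x ≠ t)
    (hc : outerCount 𝓕 t x + 2 = innerCount 𝓕 t x) :
    Nonempty (((ofFacets 𝓕).link {x}).carrier ≃ₜ Sphere2) := by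
  rw [link_ofFacets_eq]
  exact (h.isConedSphere_link hxt hc).nonempty_homeomorph_sphere

end Ear

/-! ### Unfolding along a missing tetrahedron preserves normality and coning. -/

noncomputable section Unfold

variable {V W : Type*}

/-- The set `F` with its vertices `a` and `b` replaced by their copies labelled `β`. -/
def decorate (a b : V) (e : V × ZMod 2 ≃ W) (β : ZMod 2) (F : Finset V) : Finset W :=
  F.image fun x => e (x, if x = a ∨ x = b then β else 0)

theorem mem_decorate {a b : V} {e : V × ZMod 2 ≃ W} {β : ZMod 2} {F : Finset V} {x : V}
    {γ : ZMod 2} : e (x, γ) ∈ decorate a b e β F ↔ x ∈ F ∧ γ = if x = a ∨ x = b then β else 0 := by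
  simp only [decorate, Finset.mem_image, EmbeddingLike.apply_eq_iff_eq, Prod.mk.injEq]
  constructor
  · rintro ⟨y, hy, rfl, rfl⟩
    exact ⟨hy, rfl⟩
  · rintro ⟨hx, rfl⟩
    exact ⟨x, hx, rfl, rfl⟩

theorem card_decorate (a b : V) (e : V × ZMod 2 ≃ W) (β : ZMod 2) (F : Finset V) :
    (decorate a b e β F).card = F.card := by
  refine Finset.card_image_of_injective _ fun x y hxy => ?_
  rw [EmbeddingLike.apply_eq_iff_eq, Prod.mk.injEq] at hxy
  exact hxy.1

theorem image_decorate (a b : V) (e : V × ZMod 2 ≃ W) (β : ZMod 2) (F : Finset V) :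
    (decorate a b e β F).image (fun w => (e.symm w).1) = F := by
  rw [decorate, Finset.image_image]
  simp [Function.comp_def]

theorem decorate_subset {a b : V} {e : V × ZMod 2 ≃ W} {β β' : ZMod 2} {ρ F : Finset V} :
    decorate a b e β ρ ⊆ decorate a b e β' F ↔ ρ ⊆ F ∧ (a ∈ ρ ∨ b ∈ ρ → β = β') := by
  constructor
  · intro h
    have h1 : ∀ x ∈ ρ, x ∈ F ∧ (if x = a ∨ x = b then β else 0) =
        if x = a ∨ x = b then β' else 0 := fun x hx =>
      mem_decorate.1 (h (mem_decorate.2 ⟨hx, rfl⟩))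
    refine ⟨fun x hx => (h1 x hx).1, ?_⟩
    rintro (ha | hb)
    · simpa using (h1 a ha).2
    · simpa using (h1 b hb).2
  · rintro ⟨h1, h2⟩ w hw
    obtain ⟨x, hx, rfl⟩ := Finset.mem_image.1 hw
    refine mem_decorate.2 ⟨h1 hx, ?_⟩
    split_ifs with hab
    · rcases hab with rfl | rfl
      · exact h2 (Or.inl hx)
      · exact h2 (Or.inr hx)
    · rfl

theorem exists_decorate_of_subset {a b : V} {e : V × ZMod 2 ≃ W} {β : ZMod 2} {F : Finset V}
    {A : Finset W} (h : A ⊆ decorate a b e β F) : ∃ ρ ⊆ F, A = decorate a b e β ρ := by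
  refine ⟨A.image fun w => (e.symm w).1, ?_, ?_⟩
  · rw [← image_decorate a b e β F]
    exact Finset.image_subset_image h
  · ext w
    constructor
    · intro hw
      obtain ⟨x, hx, rfl⟩ := Finset.mem_image.1 (h hw)
      exact mem_decorate.2 ⟨Finset.mem_image.2 ⟨_, hw, by simp⟩, rfl⟩
    · intro hw
      obtain ⟨x, hx, rfl⟩ := Finset.mem_image.1 hw
      obtain ⟨w, hwA, rfl⟩ := Finset.mem_image.1 hx
      obtain ⟨y, -, rfl⟩ := Finset.mem_image.1 (h hwA)
      simpa using hwA

/-- The facets of the complex obtained from `𝓕` by cutting along the boundary of the missing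
tetrahedron `tvab` and filling in two tetrahedra; `s` tells the two sides of the cut apart. -/
def unfoldFacets (𝓕 : Finset (Finset V)) (t v a b : V) (s : Finset V → ZMod 2)
    (e : V × ZMod 2 ≃ W) : Finset (Finset W) :=
  𝓕.image (fun F => decorate a b e (s F) F) ∪
    {decorate a b e 0 {t, v, a, b}, decorate a b e 1 {t, v, a, b}}

/-- The hypotheses under which the complex with facets `𝓕` can be unfolded along `tvab`. -/
structure UnfoldData (𝓕 : Finset (Finset V)) (t v a b : V) (s : Finset V → ZMod 2) : Prop where
  good : IsConedNormal 𝓕 t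
  tv : t ≠ v
  ta : t ≠ a
  tb : t ≠ b
  va : v ≠ a
  vb : v ≠ b
  ab : a ≠ b
  notMem : {t, v, a, b} ∉ 𝓕
  ridge : ∀ ρ ⊆ {t, v, a, b}, ρ.card = 3 → ∃ F ∈ 𝓕, ρ ⊆ F
  -- Around `a` and `b` the side changes exactly when a triangle of `tvab` is crossed.
  side : ∀ F ∈ 𝓕, ∀ G ∈ 𝓕, (F ∩ G).card = 3 → (a ∈ F ∩ G ∨ b ∈ F ∩ G) →
    s F + s G = if F ∩ G ⊆ {t, v, a, b} then 1 else 0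
  -- Around the edge `tv` the sides seen at `a` and at `b` cannot be continued consistently. Without
  -- this the star of `tv` would fall apart into two stars after cutting.
  oneSided : ∀ d : Finset V → ZMod 2,
    (∀ F ∈ 𝓕, ∀ G ∈ 𝓕, t ∈ F ∩ G → v ∈ F ∩ G → (F ∩ G).card = 3 →
      d F + d G = if F ∩ G ⊆ {t, v, a, b} then 1 else 0) →
    (∀ F ∈ 𝓕, t ∈ F → v ∈ F → (a ∈ F ∨ b ∈ F) → d F = s F) → False

theorem zmod_two_eq_zero_or_one (a : ZMod 2) : a = 0 ∨ a = 1 := by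
  revert a; decide

theorem zmod_two_eq_of_ne {a b c : ZMod 2} (h1 : a ≠ c) (h2 : b ≠ c) : a = b := by
  revert a b c; decide

/-- Connectedness of the stars of edges and of `t` implies that of all stars. -/
theorem conn_of_conn_edges {𝓕 : Finset (Finset V)} {t : V} (hc : ∀ F ∈ 𝓕, F.card = 4)
    (cone : ∀ F ∈ 𝓕, ∀ x ∈ F, ∀ y ∈ F, ∃ G ∈ 𝓕, {t, x, y} ⊆ G)
    (he : ∀ σ : Finset V, σ.card = 2 → ∀ c : Finset V → ZMod 2,
      (∀ F ∈ 𝓕, ∀ G ∈ 𝓕, σ ⊆ F → σ ⊆ G → (F ∩ G).card = 3 → c F = c G) →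
      ∀ F ∈ 𝓕, ∀ G ∈ 𝓕, σ ⊆ F → σ ⊆ G → c F = c G)
    (ht : ∀ c : Finset V → ZMod 2,
      (∀ F ∈ 𝓕, ∀ G ∈ 𝓕, t ∈ F → t ∈ G → (F ∩ G).card = 3 → c F = c G) →
      ∀ F ∈ 𝓕, ∀ G ∈ 𝓕, t ∈ F → t ∈ G → c F = c G) :
    ∀ σ : Finset V, σ.card ≤ 2 → ∀ c : Finset V → ZMod 2,
      (∀ F ∈ 𝓕, ∀ G ∈ 𝓕, σ ⊆ F → σ ⊆ G → (F ∩ G).card = 3 → c F = c G) →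
      ∀ F ∈ 𝓕, ∀ G ∈ 𝓕, σ ⊆ F → σ ⊆ G → c F = c G := by
  have hv : ∀ x, ∀ c : Finset V → ZMod 2,
      (∀ F ∈ 𝓕, ∀ G ∈ 𝓕, x ∈ F → x ∈ G → (F ∩ G).card = 3 → c F = c G) →
      ∀ F ∈ 𝓕, ∀ G ∈ 𝓕, x ∈ F → x ∈ G → c F = c G := by
    intro x c hloc
    by_cases hxt : x = t
    · subst hxt; exact ht c hloc
    have hedge : ∀ y, y ≠ x → ∀ F ∈ 𝓕, ∀ G ∈ 𝓕, x ∈ F → x ∈ G → y ∈ F → y ∈ G → c F = c G := by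
      intro y hyx F hF G hG h1 h2 h3 h4
      refine he {x, y} (Finset.card_pair (Ne.symm hyx)) c ?_ F hF G hG ?_ ?_
      · intro A hA B hB hsA hsB
        exact hloc A hA B hB (hsA (by simp)) (hsB (by simp))
      · simp [Finset.insert_subset_iff, h1, h3]
      · simp [Finset.insert_subset_iff, h2, h4]
    have tot : ∀ F ∈ 𝓕, x ∈ F → ∃ G ∈ 𝓕, x ∈ G ∧ t ∈ G ∧ c F = c G := by
      intro F hF hx
      obtain ⟨y, hy, hyx⟩ := Finset.exists_mem_ne (s := F) (by rw [hc F hF]; omega) x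
      obtain ⟨G, hG, hs⟩ := cone F hF x hx y hy
      have hxG : x ∈ G := hs (by simp)
      exact ⟨G, hG, hxG, hs (by simp), hedge y hyx F hF G hG hx hxG hy (hs (by simp))⟩
    intro F hF G hG hxF hxG
    obtain ⟨F', hF', h1, h2, e1⟩ := tot F hF hxF
    obtain ⟨G', hG', h3, h4, e2⟩ := tot G hG hxG
    rw [e1, e2]
    exact hedge t (Ne.symm hxt) F' hF' G' hG' h1 h3 h2 h4
  intro σ hσ c hloc F hF G hG hσF hσG
  have h012 : σ.card = 0 ∨ σ.card = 1 ∨ σ.card = 2 := by omega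
  rcases h012 with h0 | h1 | h2
  · rw [Finset.card_eq_zero] at h0
    subst h0
    have hloc' : ∀ x, ∀ F ∈ 𝓕, ∀ G ∈ 𝓕, x ∈ F → x ∈ G → (F ∩ G).card = 3 → c F = c G :=
      fun x A hA B hB _ _ => hloc A hA B hB (by simp) (by simp)
    have tot : ∀ F ∈ 𝓕, ∃ G ∈ 𝓕, t ∈ G ∧ c F = c G := by
      intro F hF
      obtain ⟨x, hx⟩ := Finset.card_pos.1 (show 0 < F.card by rw [hc F hF]; omega)
      obtain ⟨G, hG, hs⟩ := cone F hF x hx x hx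
      exact ⟨G, hG, hs (by simp), hv x c (hloc' x) F hF G hG hx (hs (by simp))⟩
    obtain ⟨F', hF', h1, e1⟩ := tot F hF
    obtain ⟨G', hG', h2, e2⟩ := tot G hG
    rw [e1, e2]
    exact hv t c (hloc' t) F' hF' G' hG' h1 h2
  · obtain ⟨x, rfl⟩ := Finset.card_eq_one.1 h1
    simp only [Finset.singleton_subset_iff] at *
    exact hv x c hloc F hF G hG hσF hσG
  · exact he σ h2 c hloc F hF G hG hσF hσG

theorem mem_unfoldFacets {𝓕 : Finset (Finset V)} {t v a b : V} {s : Finset V → ZMod 2}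
    {e : V × ZMod 2 ≃ W} {A : Finset W} :
    A ∈ unfoldFacets 𝓕 t v a b s e ↔ ∃ β F, A = decorate a b e β F ∧
      (F ∈ 𝓕 ∧ s F = β ∨ F = {t, v, a, b}) := by
  simp only [unfoldFacets, Finset.mem_union, Finset.mem_image, Finset.mem_insert,
    Finset.mem_singleton]
  constructor
  · rintro (⟨F, hF, rfl⟩ | rfl | rfl)
    · exact ⟨_, F, rfl, Or.inl ⟨hF, rfl⟩⟩
    · exact ⟨_, _, rfl, Or.inr rfl⟩
    · exact ⟨_, _, rfl, Or.inr rfl⟩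
  · rintro ⟨β, F, rfl, ⟨hF, rfl⟩ | rfl⟩
    · exact Or.inl ⟨F, hF, rfl⟩
    · rcases zmod_two_eq_zero_or_one β with rfl | rfl
      · exact Or.inr (Or.inl rfl)
      · exact Or.inr (Or.inr rfl)

theorem not_mem_of_not_or {a b : V} {ρ : Finset V} (h : ¬ (a ∈ ρ ∨ b ∈ ρ)) (e : V × ZMod 2 ≃ W)
    (β β' : ZMod 2) : decorate a b e β ρ = decorate a b e β' ρ :=
  Finset.Subset.antisymm (decorate_subset.2 ⟨Finset.Subset.refl _, fun h' => (h h').elim⟩)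
    (decorate_subset.2 ⟨Finset.Subset.refl _, fun h' => (h h').elim⟩)

namespace UnfoldData

variable {𝓕 : Finset (Finset V)} {t v a b : V} {s : Finset V → ZMod 2}
  (h : UnfoldData 𝓕 t v a b s) (e : V × ZMod 2 ≃ W)
include h

theorem card_tetra : ({t, v, a, b} : Finset V).card = 4 :=
  Finset.card_four_of_ne h.tv h.ta h.tb h.va h.vb h.ab

theorem mem_lift {F : Finset V} (hF : F ∈ 𝓕) :
    decorate a b e (s F) F ∈ unfoldFacets 𝓕 t v a b s e :=
  mem_unfoldFacets.2 ⟨_, F, rfl, Or.inl ⟨hF, rfl⟩⟩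

omit h in
theorem mem_cap (β : ZMod 2) :
    decorate a b e β {t, v, a, b} ∈ unfoldFacets 𝓕 t v a b s e :=
  mem_unfoldFacets.2 ⟨β, _, rfl, Or.inr rfl⟩

theorem card_unfold {A : Finset W} (hA : A ∈ unfoldFacets 𝓕 t v a b s e) : A.card = 4 := by
  obtain ⟨β, F, rfl, ⟨hF, -⟩ | rfl⟩ := mem_unfoldFacets.1 hA
  · rw [card_decorate, h.good.card_eq F hF]
  · rw [card_decorate, h.card_tetra]

theorem or_mem_of_subset_tetra {ρ : Finset V} (hρ : ρ ⊆ {t, v, a, b}) (hc : ρ.card = 3) :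
    a ∈ ρ ∨ b ∈ ρ := by
  by_contra hn
  rw [not_or] at hn
  have : ρ ⊆ {t, v} := by
    intro z hz
    have := hρ hz
    simp only [Finset.mem_insert, Finset.mem_singleton] at this ⊢
    rcases this with rfl | rfl | rfl | rfl
    · exact Or.inl rfl
    · exact Or.inr rfl
    · exact (hn.1 hz).elim
    · exact (hn.2 hz).elim
  have := (Finset.card_le_card this).trans Finset.card_le_two
  omega

omit h in
theorem inter_card {F G ρ : Finset V} {β β' : ZMod 2} (hF : F.card = 4) (hG : G.card = 4)
    (hne : F ≠ G) (hρ : ρ.card = 3) (h1 : ρ ⊆ F) (h2 : ρ ⊆ G) (hβ : a ∈ ρ ∨ b ∈ ρ → β = β') :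
    (decorate a b e β F ∩ decorate a b e β' G).card = 3 := by
  have hs1 : decorate a b e β ρ ⊆ decorate a b e β F := decorate_subset.2 ⟨h1, fun _ => rfl⟩
  have hs2 : decorate a b e β ρ ⊆ decorate a b e β' G := decorate_subset.2 ⟨h2, hβ⟩
  rw [Finset.eq_inter_of_card_three (ρ := decorate a b e β ρ) (by rw [card_decorate, hF])
    (by rw [card_decorate, hG]) ?_ (by rw [card_decorate, hρ]) hs1 hs2, card_decorate, hρ]
  intro he
  apply hne
  rw [← image_decorate a b e β F, he, image_decorate]

/-- The side is constant on the star of a face that meets `ab` and is not in `tvab`. -/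
theorem side_eq {x y : V} (hx : x = a ∨ x = b) (hy : y ∉ ({t, v, a, b} : Finset V)) {F G : Finset V}
    (hF : F ∈ 𝓕) (hG : G ∈ 𝓕) (hxF : x ∈ F) (hyF : y ∈ F) (hxG : x ∈ G) (hyG : y ∈ G) :
    s F = s G := by
  have hxy : x ≠ y := by
    rintro rfl
    apply hy
    rcases hx with rfl | rfl <;> simp
  refine h.good.conn {x, y} (by rw [Finset.card_pair hxy]) s ?_ F hF G hG
    (by simp [Finset.insert_subset_iff, *]) (by simp [Finset.insert_subset_iff, *])
  intro A hA B hB hsA hsB hc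
  have hs := Finset.subset_inter hsA hsB
  have hxi : x ∈ A ∩ B := hs (by simp)
  have hyi : y ∈ A ∩ B := hs (by simp)
  have := h.side A hA B hB hc (by rcases hx with rfl | rfl <;> simp only [hxi, true_or, or_true])
  rw [if_neg fun hsub => hy (hsub hyi)] at this
  exact zmod_two_eq_of_add_eq_zero this

/-- The two facets at a triangle of `tvab` lie on different sides, so each side owns exactly one. -/
theorem exists_side {ρ : Finset V} (hρ : ρ ⊆ {t, v, a, b}) (hc : ρ.card = 3) (β : ZMod 2) :
    ∃ F ∈ 𝓕, ρ ⊆ F ∧ s F = β ∧ ∀ G ∈ 𝓕, ρ ⊆ G → s G = β → G = F := by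
  obtain ⟨F, hF, hs⟩ := h.ridge ρ hρ hc
  obtain ⟨G, hG, hne, hsG, hi, hfilter⟩ := h.good.exists_other hF hc hs
  have hside := h.side F hF G hG (by rw [hi, hc]) (by rw [hi]; exact h.or_mem_of_subset_tetra hρ hc)
  rw [if_pos (by rw [hi]; exact hρ)] at hside
  have hall : ∀ H ∈ 𝓕, ρ ⊆ H → H = F ∨ H = G := by
    intro H hH hsH
    have : H ∈ 𝓕.filter (ρ ⊆ ·) := Finset.mem_filter.2 ⟨hH, hsH⟩
    rw [hfilter] at this
    simpa using this
  by_cases hF1 : s F = β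
  · refine ⟨F, hF, hs, hF1, fun H hH hsH hHβ => (hall H hH hsH).resolve_right ?_⟩
    rintro rfl
    rw [hF1, hHβ, CharTwo.add_self_eq_zero] at hside
    exact zero_ne_one hside
  · refine ⟨G, hG, hsG, ?_, fun H hH hsH hHβ => (hall H hH hsH).resolve_left ?_⟩
    · by_contra hG1
      rw [zmod_two_eq_of_ne hF1 hG1, CharTwo.add_self_eq_zero] at hside
      exact zero_ne_one hside
    · rintro rfl
      exact hF1 hHβ

/-- Edges inside `tvab` are coned by the new tetrahedra. Any other edge at a copy of `a` or `b` has
a well-defined side by `side_eq`, so a coning facet of `𝓕` lifts to the correct copy. -/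
theorem cone_unfold : ∀ A ∈ unfoldFacets 𝓕 t v a b s e, ∀ x ∈ A, ∀ y ∈ A,
    ∃ B ∈ unfoldFacets 𝓕 t v a b s e, {e (t, 0), x, y} ⊆ B := by
  intro A hA x' hx' y' hy'
  have ht0 : ∀ β F, t ∈ F → e (t, 0) ∈ decorate a b e β F := fun β F hF =>
    mem_decorate.2 ⟨hF, by simp [h.ta, h.tb]⟩
  obtain ⟨β, F, rfl, hFo⟩ := mem_unfoldFacets.1 hA
  obtain ⟨x, hx, rfl⟩ := Finset.mem_image.1 hx'
  obtain ⟨y, hy, rfl⟩ := Finset.mem_image.1 hy'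
  by_cases hF' : F = {t, v, a, b}
  · subst hF'
    refine ⟨_, hA, ?_⟩
    rw [Finset.insert_subset_iff, Finset.insert_subset_iff, Finset.singleton_subset_iff]
    exact ⟨ht0 _ _ (by simp), mem_decorate.2 ⟨hx, rfl⟩, mem_decorate.2 ⟨hy, rfl⟩⟩
  obtain ⟨hF, rfl⟩ := hFo.resolve_right hF'
  by_cases hτ : x ∈ ({t, v, a, b} : Finset V) ∧ y ∈ ({t, v, a, b} : Finset V)
  · refine ⟨_, mem_cap e (s F), ?_⟩
    rw [Finset.insert_subset_iff, Finset.insert_subset_iff, Finset.singleton_subset_iff]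
    exact ⟨ht0 _ _ (by simp), mem_decorate.2 ⟨hτ.1, rfl⟩, mem_decorate.2 ⟨hτ.2, rfl⟩⟩
  obtain ⟨G, hG, hs⟩ := h.good.cone F hF x hx y hy
  have hxG : x ∈ G := hs (by simp)
  have hyG : y ∈ G := hs (by simp)
  have hside : (x = a ∨ x = b) ∨ (y = a ∨ y = b) → s F = s G := by
    have mem : ∀ z, z = a ∨ z = b → z ∈ ({t, v, a, b} : Finset V) := by
      rintro z (rfl | rfl) <;> simp
    rintro (hxx | hyy)
    · exact h.side_eq hxx (fun hyτ => hτ ⟨mem x hxx, hyτ⟩) hF hG hx hy hxG hyG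
    · exact h.side_eq hyy (fun hxτ => hτ ⟨hxτ, mem y hyy⟩) hF hG hy hx hyG hxG
  refine ⟨_, h.mem_lift e hG, ?_⟩
  rw [Finset.insert_subset_iff, Finset.insert_subset_iff, Finset.singleton_subset_iff]
  refine ⟨ht0 _ _ (hs (by simp)), mem_decorate.2 ⟨hxG, ?_⟩, mem_decorate.2 ⟨hyG, ?_⟩⟩
  · split_ifs with hc
    · exact hside (Or.inl hc)
    · rfl
  · split_ifs with hc
    · exact hside (Or.inr hc)
    · rfl

/-- At a copy of a triangle of `tvab` one lifted facet and one new tetrahedron meet. All other pairs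
of adjacent facets lift unchanged. -/
theorem two_facets_unfold (A : Finset W) (hA : A.card = 3)
    (hex : ∃ B ∈ unfoldFacets 𝓕 t v a b s e, A ⊆ B) :
    ((unfoldFacets 𝓕 t v a b s e).filter (A ⊆ ·)).card = 2 := by
  obtain ⟨B, hB, hAB⟩ := hex
  obtain ⟨β, F, rfl, hFo⟩ := mem_unfoldFacets.1 hB
  obtain ⟨ρ, hρF, rfl⟩ := exists_decorate_of_subset hAB
  rw [card_decorate] at hA
  by_cases hτ : ρ ⊆ {t, v, a, b}
  · have hm := h.or_mem_of_subset_tetra hτ hA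
    obtain ⟨G, hG, hsG, hβ, huniq⟩ := h.exists_side hτ hA β
    have e1 : (unfoldFacets 𝓕 t v a b s e).filter (decorate a b e β ρ ⊆ ·) =
        {decorate a b e β G, decorate a b e β {t, v, a, b}} := by
      ext X
      simp only [Finset.mem_filter, Finset.mem_insert, Finset.mem_singleton]
      constructor
      · rintro ⟨hX, hs⟩
        obtain ⟨β', H, rfl, hH⟩ := mem_unfoldFacets.1 hX
        obtain ⟨hs1, hs2⟩ := decorate_subset.1 hs
        obtain rfl := hs2 hm
        rcases hH with ⟨hH, hH'⟩ | rfl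
        · exact Or.inl (by rw [huniq H hH hs1 hH'])
        · exact Or.inr rfl
      · rintro (rfl | rfl)
        · exact ⟨by rw [← hβ]; exact h.mem_lift e hG, decorate_subset.2 ⟨hsG, fun _ => rfl⟩⟩
        · exact ⟨mem_cap e β, decorate_subset.2 ⟨hτ, fun _ => rfl⟩⟩
    rw [e1, Finset.card_pair]
    intro he
    apply h.notMem
    rw [← image_decorate a b e β {t, v, a, b}, ← he, image_decorate]
    exact hG
  · have hF' : F ∈ 𝓕 ∧ s F = β := hFo.resolve_right fun e => hτ (e ▸ hρF)
    obtain ⟨hF, rfl⟩ := hF'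
    rw [← h.good.two_facets ρ hA ⟨F, hF, hρF⟩]
    have e1 : (unfoldFacets 𝓕 t v a b s e).filter (decorate a b e (s F) ρ ⊆ ·) =
        (𝓕.filter (ρ ⊆ ·)).image fun G => decorate a b e (s G) G := by
      ext X
      simp only [Finset.mem_filter, Finset.mem_image]
      constructor
      · rintro ⟨hX, hs⟩
        obtain ⟨β', H, rfl, hHo⟩ := mem_unfoldFacets.1 hX
        obtain ⟨hs1, hs2⟩ := decorate_subset.1 hs
        obtain ⟨hH, rfl⟩ := hHo.resolve_right fun e => hτ (e ▸ hs1)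
        exact ⟨H, ⟨hH, hs1⟩, rfl⟩
      · rintro ⟨G, ⟨hG, hsG⟩, rfl⟩
        refine ⟨h.mem_lift e hG, decorate_subset.2 ⟨hsG, fun hm => ?_⟩⟩
        rw [Finset.not_subset] at hτ
        obtain ⟨y, hy, hyτ⟩ := hτ
        rcases hm with hm | hm
        · exact h.side_eq (Or.inl rfl) hyτ hF hG (hρF hm) (hρF hy) (hsG hm) (hsG hy)
        · exact h.side_eq (Or.inr rfl) hyτ hF hG (hρF hm) (hρF hy) (hsG hm) (hsG hy)
    rw [e1, Finset.card_image_of_injOn]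
    intro G _ G' _ he
    have he' : decorate a b e (s G) G = decorate a b e (s G') G' := he
    rw [← image_decorate a b e (s G) G, he', image_decorate]

theorem ne_tetra {F : Finset V} (hF : F ∈ 𝓕) : F ≠ {t, v, a, b} := fun e => h.notMem (e ▸ hF)

/-- Adjacent facets whose common triangle is not in `tvab` have adjacent lifts. -/
theorem inter_card_lift {F G : Finset V} (hF : F ∈ 𝓕) (hG : G ∈ 𝓕) (hc : (F ∩ G).card = 3)
    (hτ : ¬ F ∩ G ⊆ {t, v, a, b}) :
    (decorate a b e (s F) F ∩ decorate a b e (s G) G).card = 3 := by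
  refine inter_card e (h.good.card_eq F hF) (h.good.card_eq G hG)
    (h.good.filter_eq_pair hF hG hc).1 hc Finset.inter_subset_left Finset.inter_subset_right
    fun hm => ?_
  have := h.side F hF G hG hc hm
  rw [if_neg hτ] at this
  exact zmod_two_eq_of_add_eq_zero this

/-- The lift of a facet meeting `tvab` in a triangle is adjacent to the tetrahedron on its side. -/
theorem inter_card_cap {F ρ : Finset V} (hF : F ∈ 𝓕) (hc : ρ.card = 3) (hρF : ρ ⊆ F)
    (hτ : ρ ⊆ {t, v, a, b}) :
    (decorate a b e (s F) F ∩ decorate a b e (s F) {t, v, a, b}).card = 3 :=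
  inter_card e (h.good.card_eq F hF) h.card_tetra (h.ne_tetra hF) hc hρF hτ fun _ => rfl

/-- A colouring near the copy `β` becomes a colouring of `𝓕` when all facets of the opposite side
receive the colour of the tetrahedron labelled `β`: crossing the cut now leads into that
tetrahedron. -/
theorem conn_edge_of_mem {σ : Finset V} (hσ : σ.card = 2) (hm : a ∈ σ ∨ b ∈ σ) (β : ZMod 2)
    (c : Finset W → ZMod 2)
    (hc : ∀ F ∈ unfoldFacets 𝓕 t v a b s e, ∀ G ∈ unfoldFacets 𝓕 t v a b s e,
      decorate a b e β σ ⊆ F → decorate a b e β σ ⊆ G → (F ∩ G).card = 3 → c F = c G) :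
    ∀ F ∈ unfoldFacets 𝓕 t v a b s e, ∀ G ∈ unfoldFacets 𝓕 t v a b s e,
      decorate a b e β σ ⊆ F → decorate a b e β σ ⊆ G → c F = c G := by
  let c' : Finset V → ZMod 2 := fun F =>
    if s F = β then c (decorate a b e β F) else c (decorate a b e β {t, v, a, b})
  have sub : ∀ {F : Finset V}, σ ⊆ F → decorate a b e β σ ⊆ decorate a b e β F :=
    fun hs => decorate_subset.2 ⟨hs, fun _ => rfl⟩
  have cap : ∀ F ∈ 𝓕, ∀ ρ, ρ.card = 3 → σ ⊆ ρ → ρ ⊆ F → ρ ⊆ {t, v, a, b} → s F = β →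
      c (decorate a b e β F) = c (decorate a b e β {t, v, a, b}) := by
    intro F hF ρ hρ hσρ hρF hρτ hs
    have h1 := h.inter_card_cap e hF hρ hρF hρτ
    have h2 := h.mem_lift e hF
    rw [hs] at h1 h2
    exact hc _ h2 _ (mem_cap e β) (sub (hσρ.trans hρF)) (sub (hσρ.trans hρτ)) h1
  have hconst := h.good.conn σ hσ.le c' (by
    intro F hF G hG hσF hσG hFG
    have hσi := Finset.subset_inter hσF hσG
    have hside := h.side F hF G hG hFG (hm.imp (fun hh => hσi hh) (fun hh => hσi hh))
    split_ifs at hside with hτ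
    · by_cases hsF : s F = β <;> by_cases hsG : s G = β
      · rw [hsF, hsG, CharTwo.add_self_eq_zero] at hside
        exact (zero_ne_one hside).elim
      · simp only [c', if_pos hsF, if_neg hsG]
        exact cap F hF _ hFG hσi Finset.inter_subset_left hτ hsF
      · simp only [c', if_neg hsF, if_pos hsG]
        exact (cap G hG _ hFG hσi Finset.inter_subset_right hτ hsG).symm
      · simp only [c', if_neg hsF, if_neg hsG]
    · have he := zmod_two_eq_of_add_eq_zero hside
      by_cases hsF : s F = β
      · have hsG : s G = β := he ▸ hsF
        simp only [c', if_pos hsF, if_pos hsG]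
        have h1 := h.inter_card_lift e hF hG hFG hτ
        have h2 := h.mem_lift e hF
        have h3 := h.mem_lift e hG
        rw [hsF] at h1 h2
        rw [hsG] at h1 h3
        exact hc _ h2 _ h3 (sub hσF) (sub hσG) h1
      · have hsG : ¬ s G = β := fun hh => hsF (he.trans hh)
        simp only [c', if_neg hsF, if_neg hsG])
  have rep : ∀ A ∈ unfoldFacets 𝓕 t v a b s e, decorate a b e β σ ⊆ A →
      ∃ F ∈ 𝓕, σ ⊆ F ∧ c A = c' F := by
    intro A hA hs
    obtain ⟨β', F, rfl, hF⟩ := mem_unfoldFacets.1 hA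
    obtain ⟨hs1, hs2⟩ := decorate_subset.1 hs
    obtain rfl := hs2 hm
    rcases hF with ⟨hF, hsF⟩ | rfl
    · exact ⟨F, hF, hs1, (if_pos hsF).symm⟩
    · obtain ⟨ρ, hσρ, hρτ, hρ⟩ := Finset.exists_subsuperset_card_eq (n := 3) hs1 (by omega)
        (by rw [h.card_tetra]; omega)
      obtain ⟨F, hF, hρF, hsF, -⟩ := h.exists_side hρτ hρ (β + 1)
      refine ⟨F, hF, hσρ.trans hρF, (if_neg ?_).symm⟩
      rw [hsF]
      exact fun hh => one_ne_zero (left_eq_add.1 hh.symm)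
  intro A hA B hB hsA hsB
  obtain ⟨F, hF, hσF, e1⟩ := rep A hA hsA
  obtain ⟨G, hG, hσG, e2⟩ := rep B hB hsB
  rw [e1, e2]
  exact hconst F hF G hG hσF hσG

/-- Facets on opposite sides of the cut see different new tetrahedra, so the essential point is that
the two tetrahedra get the same colour. This matters for `tv`, the only edge they share. -/
theorem conn_edge_of_not_mem {σ : Finset V} (hσ : σ.card = 2) (hm : ¬ (a ∈ σ ∨ b ∈ σ))
    (c : Finset W → ZMod 2)
    (hc : ∀ F ∈ unfoldFacets 𝓕 t v a b s e, ∀ G ∈ unfoldFacets 𝓕 t v a b s e,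
      decorate a b e 0 σ ⊆ F → decorate a b e 0 σ ⊆ G → (F ∩ G).card = 3 → c F = c G) :
    ∀ F ∈ unfoldFacets 𝓕 t v a b s e, ∀ G ∈ unfoldFacets 𝓕 t v a b s e,
      decorate a b e 0 σ ⊆ F → decorate a b e 0 σ ⊆ G → c F = c G := by
  let c' : Finset V → ZMod 2 := fun F => c (decorate a b e (s F) F)
  have sub : ∀ {F : Finset V} {β}, σ ⊆ F → decorate a b e 0 σ ⊆ decorate a b e β F :=
    fun hs => decorate_subset.2 ⟨hs, fun hh => (hm hh).elim⟩
  have adj : ∀ F ∈ 𝓕, ∀ G ∈ 𝓕, σ ⊆ F → σ ⊆ G → (F ∩ G).card = 3 →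
      ¬ F ∩ G ⊆ {t, v, a, b} → c' F = c' G := by
    intro F hF G hG hσF hσG hFG hτ
    exact hc _ (h.mem_lift e hF) _ (h.mem_lift e hG) (sub hσF) (sub hσG)
      (h.inter_card_lift e hF hG hFG hτ)
  have cap : ∀ F ∈ 𝓕, ∀ ρ, ρ.card = 3 → σ ⊆ ρ → ρ ⊆ F → ρ ⊆ {t, v, a, b} →
      c' F = c (decorate a b e (s F) {t, v, a, b}) := by
    intro F hF ρ hρ hσρ hρF hρτ
    exact hc _ (h.mem_lift e hF) _ (mem_cap e _) (sub (hσρ.trans hρF)) (sub (hσρ.trans hρτ))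
      (h.inter_card_cap e hF hρ hρF hρτ)
  -- With different colours on the two tetrahedra, the colouring around `tv` would continue the
  -- sides at `a` and `b`, contrary to one-sidedness.
  have hcaps : σ ⊆ {t, v, a, b} →
      c (decorate a b e 0 {t, v, a, b}) = c (decorate a b e 1 {t, v, a, b}) := by
    intro hστ
    have hσe : σ = {t, v} := by
      refine Finset.eq_of_subset_of_card_le (fun z hz => ?_) (by rw [hσ, Finset.card_pair h.tv])
      have := hστ hz
      simp only [Finset.mem_insert, Finset.mem_singleton] at this ⊢
      rcases this with rfl | rfl | rfl | rfl
      · exact Or.inl rfl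
      · exact Or.inr rfl
      · exact (hm (Or.inl hz)).elim
      · exact (hm (Or.inr hz)).elim
    by_contra hne
    have hcap : ∀ β, c (decorate a b e β {t, v, a, b}) =
        c (decorate a b e 0 {t, v, a, b}) + β := by
      intro β
      rcases zmod_two_eq_zero_or_one β with rfl | rfl
      · rw [add_zero]
      · revert hne
        generalize c (decorate a b e 0 {t, v, a, b}) = x
        generalize c (decorate a b e 1 {t, v, a, b}) = y
        revert x y
        decide
    have hst : ∀ F : Finset V, t ∈ F → v ∈ F → σ ⊆ F := fun F h1 h2 => by
      rw [hσe]; simp [Finset.insert_subset_iff, h1, h2]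
    refine h.oneSided (fun F => c' F + c (decorate a b e 0 {t, v, a, b})) ?_ ?_
    · intro F hF G hG ht hv hFG
      have hσF := hst F (Finset.mem_inter.1 ht).1 (Finset.mem_inter.1 hv).1
      have hσG := hst G (Finset.mem_inter.1 ht).2 (Finset.mem_inter.1 hv).2
      split_ifs with hτ
      · rw [cap F hF _ hFG (Finset.subset_inter hσF hσG) Finset.inter_subset_left hτ,
          cap G hG _ hFG (Finset.subset_inter hσF hσG) Finset.inter_subset_right hτ, hcap (s F),
          hcap (s G)]
        have := h.side F hF G hG hFG (h.or_mem_of_subset_tetra hτ hFG)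
        rw [if_pos hτ] at this
        rw [← this]
        generalize c _ = x
        generalize s F = y
        generalize s G = z
        revert x y z
        decide
      · rw [adj F hF G hG hσF hσG hFG hτ, CharTwo.add_self_eq_zero]
    · intro F hF ht hv hab
      have key : ∀ z, z ∈ F → z = a ∨ z = b →
          c' F = c (decorate a b e (s F) {t, v, a, b}) := by
        intro z hz hzab
        have htz : t ≠ z := by rcases hzab with rfl | rfl; exacts [h.ta, h.tb]
        have hvz : v ≠ z := by rcases hzab with rfl | rfl; exacts [h.va, h.vb]
        refine cap F hF {t, v, z} (Finset.card_three_of_ne h.tv htz hvz) (hst _ (by simp) (by simp))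
          (by simp [Finset.insert_subset_iff, ht, hv, hz]) ?_
        rcases hzab with rfl | rfl <;> simp [Finset.insert_subset_iff]
      rw [hab.elim (fun ha => key a ha (Or.inl rfl)) (fun hb => key b hb (Or.inr rfl)), hcap (s F)]
      generalize c _ = x
      generalize s F = y
      revert x y
      decide
  have hconst := h.good.conn σ hσ.le c' (by
    intro F hF G hG hσF hσG hFG
    by_cases hτ : F ∩ G ⊆ {t, v, a, b}
    · have hσi := Finset.subset_inter hσF hσG
      have heq := hcaps (hσi.trans hτ)
      have hall : ∀ β, c (decorate a b e β {t, v, a, b}) = c (decorate a b e 0 {t, v, a, b}) := by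
        intro β
        rcases zmod_two_eq_zero_or_one β with rfl | rfl
        · rfl
        · exact heq.symm
      rw [cap F hF _ hFG hσi Finset.inter_subset_left hτ,
          cap G hG _ hFG hσi Finset.inter_subset_right hτ, hall, hall (s G)]
    · exact adj F hF G hG hσF hσG hFG hτ)
  have rep : ∀ A ∈ unfoldFacets 𝓕 t v a b s e, decorate a b e 0 σ ⊆ A →
      ∃ F ∈ 𝓕, σ ⊆ F ∧ c A = c' F := by
    intro A hA hs
    obtain ⟨β', F, rfl, hF⟩ := mem_unfoldFacets.1 hA
    obtain ⟨hs1, -⟩ := decorate_subset.1 hs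
    rcases hF with ⟨hF, rfl⟩ | rfl
    · exact ⟨F, hF, hs1, rfl⟩
    · obtain ⟨ρ, hσρ, hρτ, hρ⟩ := Finset.exists_subsuperset_card_eq (n := 3) hs1 (by omega)
        (by rw [h.card_tetra]; omega)
      obtain ⟨F, hF, hρF, rfl, -⟩ := h.exists_side hρτ hρ β'
      exact ⟨F, hF, hσρ.trans hρF, (cap F hF ρ hρ hσρ hρF hρτ).symm⟩
  intro A hA B hB hsA hsB
  obtain ⟨F, hF, hσF, e1⟩ := rep A hA hsA
  obtain ⟨G, hG, hσG, e2⟩ := rep B hB hsB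
  rw [e1, e2]
  exact hconst F hF G hG hσF hσG

theorem conn_edge_unfold (σ : Finset W) (hσ : σ.card = 2) (c : Finset W → ZMod 2)
    (hc : ∀ F ∈ unfoldFacets 𝓕 t v a b s e, ∀ G ∈ unfoldFacets 𝓕 t v a b s e,
      σ ⊆ F → σ ⊆ G → (F ∩ G).card = 3 → c F = c G) :
    ∀ F ∈ unfoldFacets 𝓕 t v a b s e, ∀ G ∈ unfoldFacets 𝓕 t v a b s e,
      σ ⊆ F → σ ⊆ G → c F = c G := by
  intro F hF G hG hσF
  obtain ⟨β, F', rfl, -⟩ := mem_unfoldFacets.1 hF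
  obtain ⟨ρ, -, rfl⟩ := exists_decorate_of_subset hσF
  rw [card_decorate] at hσ
  by_cases hm : a ∈ ρ ∨ b ∈ ρ
  · exact h.conn_edge_of_mem e hσ hm β c hc _ hF G hG hσF
  · rw [not_mem_of_not_or hm e β 0] at hc hσF ⊢
    exact h.conn_edge_of_not_mem e hσ hm c hc _ hF G hG hσF

/-- The two new tetrahedra are linked through the connected star of `tv`, so crossing the cut in
either direction does not change the colour. -/
theorem conn_t_unfold (c : Finset W → ZMod 2)
    (hc : ∀ F ∈ unfoldFacets 𝓕 t v a b s e, ∀ G ∈ unfoldFacets 𝓕 t v a b s e,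
      e (t, 0) ∈ F → e (t, 0) ∈ G → (F ∩ G).card = 3 → c F = c G) :
    ∀ F ∈ unfoldFacets 𝓕 t v a b s e, ∀ G ∈ unfoldFacets 𝓕 t v a b s e,
      e (t, 0) ∈ F → e (t, 0) ∈ G → c F = c G := by
  let c' : Finset V → ZMod 2 := fun F => c (decorate a b e (s F) F)
  have ht0 : ∀ β F, t ∈ F → e (t, 0) ∈ decorate a b e β F := fun β F hF =>
    mem_decorate.2 ⟨hF, by simp [h.ta, h.tb]⟩
  have hv0 : ∀ β F, v ∈ F → e (v, 0) ∈ decorate a b e β F := fun β F hF =>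
    mem_decorate.2 ⟨hF, by simp [h.va, h.vb]⟩
  have hcaps : ∀ β β', c (decorate a b e β {t, v, a, b}) = c (decorate a b e β' {t, v, a, b}) := by
    intro β β'
    refine h.conn_edge_unfold e {e (t, 0), e (v, 0)} (Finset.card_pair ?_) c ?_ _ (mem_cap e β) _
      (mem_cap e β') ?_ ?_
    · simpa using h.tv
    · intro F hF G hG h1 h2
      exact hc F hF G hG (h1 (by simp)) (h2 (by simp))
    · rw [Finset.insert_subset_iff, Finset.singleton_subset_iff]
      exact ⟨ht0 _ _ (by simp), hv0 _ _ (by simp)⟩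
    · rw [Finset.insert_subset_iff, Finset.singleton_subset_iff]
      exact ⟨ht0 _ _ (by simp), hv0 _ _ (by simp)⟩
  have cap : ∀ F ∈ 𝓕, ∀ ρ, ρ.card = 3 → t ∈ ρ → ρ ⊆ F → ρ ⊆ {t, v, a, b} →
      c' F = c (decorate a b e (s F) {t, v, a, b}) := by
    intro F hF ρ hρ htρ hρF hρτ
    exact hc _ (h.mem_lift e hF) _ (mem_cap e _) (ht0 _ _ (hρF htρ)) (ht0 _ _ (hρτ htρ))
      (h.inter_card_cap e hF hρ hρF hρτ)
  have hconst := h.good.conn {t} (by simp) c' (by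
    intro F hF G hG htF htG hFG
    rw [Finset.singleton_subset_iff] at htF htG
    by_cases hτ : F ∩ G ⊆ {t, v, a, b}
    · have hti := Finset.mem_inter.2 ⟨htF, htG⟩
      rw [cap F hF _ hFG hti Finset.inter_subset_left hτ,
          cap G hG _ hFG hti Finset.inter_subset_right hτ]
      exact hcaps _ _
    · exact hc _ (h.mem_lift e hF) _ (h.mem_lift e hG) (ht0 _ _ htF) (ht0 _ _ htG)
        (h.inter_card_lift e hF hG hFG hτ))
  have rep : ∀ A ∈ unfoldFacets 𝓕 t v a b s e, e (t, 0) ∈ A → ∃ F ∈ 𝓕, t ∈ F ∧ c A = c' F := by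
    intro A hA hs
    obtain ⟨β', F, rfl, hF⟩ := mem_unfoldFacets.1 hA
    have htF := (mem_decorate.1 hs).1
    rcases hF with ⟨hF, rfl⟩ | rfl
    · exact ⟨F, hF, htF, rfl⟩
    · have hρτ : {t, v, a} ⊆ ({t, v, a, b} : Finset V) := by simp [Finset.insert_subset_iff]
      have hρ := Finset.card_three_of_ne h.tv h.ta h.va
      obtain ⟨F, hF, hρF, rfl, -⟩ := h.exists_side hρτ hρ β'
      exact ⟨F, hF, hρF (by simp), (cap F hF _ hρ (by simp) hρF hρτ).symm⟩
  intro A hA B hB hsA hsB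
  obtain ⟨F, hF, hσF, e1⟩ := rep A hA hsA
  obtain ⟨G, hG, hσG, e2⟩ := rep B hB hsB
  rw [e1, e2]
  exact hconst F hF G hG (by simpa using hσF) (by simpa using hσG)

theorem isConedNormal_unfold : IsConedNormal (unfoldFacets 𝓕 t v a b s e) (e (t, 0)) where
  nonempty := ⟨_, mem_cap e 0⟩
  card_eq _ hA := h.card_unfold e hA
  two_facets := h.two_facets_unfold e
  conn := conn_of_conn_edges (fun _ hA => h.card_unfold e hA) (h.cone_unfold e)
    (h.conn_edge_unfold e) (h.conn_t_unfold e)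
  cone := h.cone_unfold e

end UnfoldData

end Unfold

/-! ### Effect of unfolding on `bettiAt`, and the folding back. -/

noncomputable section UnfoldCount

variable {V W : Type*}

theorem zmod_two_swap (γ γ' : ZMod 2) :
    γ = γ' ∨ γ = 0 ∧ γ' = γ + 1 ∨ γ' = 0 ∧ γ = γ' + 1 := by
  revert γ γ'; decide

theorem isFacet_ofFacets {𝓕 : Finset (Finset V)} (hc : ∀ F ∈ 𝓕, F.card = 4) {F : Finset V} :
    (ofFacets 𝓕).IsFacet F ↔ F ∈ 𝓕 := by
  constructor
  · rintro ⟨hF, hmax⟩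
    obtain ⟨hn, G, hG, hs⟩ := mem_ofFacets.1 hF
    rw [← hmax G (mem_ofFacets.2 ⟨hn.mono hs, G, hG, Finset.Subset.refl _⟩) hs]
    exact hG
  · intro hF
    have hn : F.Nonempty := Finset.card_pos.1 (by rw [hc F hF]; omega)
    refine ⟨mem_ofFacets.2 ⟨hn, F, hF, Finset.Subset.refl _⟩, fun G hG hs => ?_⟩
    obtain ⟨-, H, hH, hs'⟩ := mem_ofFacets.1 hG
    have h1 : F = H := Finset.eq_of_subset_of_card_le (hs.trans hs') (by rw [hc F hF, hc H hH])
    exact Finset.Subset.antisymm (hs'.trans h1.ge) hs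

namespace UnfoldData

variable {𝓕 : Finset (Finset V)} {t v a b : V} {s : Finset V → ZMod 2}
  (h : UnfoldData 𝓕 t v a b s) (e : V × ZMod 2 ≃ W)
include h

omit h in
theorem cap_ne_cap : decorate a b e 0 {t, v, a, b} ≠ decorate a b e 1 {t, v, a, b} := by
  intro he
  have := (decorate_subset.1 he.subset).2 (Or.inl (by simp))
  exact zero_ne_one this

theorem card_filter_unfold (P : Finset W → Prop) [DecidablePred P] :
    ((unfoldFacets 𝓕 t v a b s e).filter P).card =
      (𝓕.filter fun F => P (decorate a b e (s F) F)).card +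
        ((if P (decorate a b e 0 {t, v, a, b}) then 1 else 0) +
          if P (decorate a b e 1 {t, v, a, b}) then 1 else 0) := by
  rw [unfoldFacets, Finset.card_filter, Finset.sum_union, Finset.sum_image,
    Finset.sum_pair (cap_ne_cap e), Finset.card_filter]
  · intro F _ G _ hFG
    have hFG' : decorate a b e (s F) F = decorate a b e (s G) G := hFG
    rw [← image_decorate a b e (s F) F, hFG', image_decorate]
  · rw [Finset.disjoint_left]
    intro A hA hA'
    obtain ⟨F, hF, rfl⟩ := Finset.mem_image.1 hA
    apply h.ne_tetra hF
    rw [Finset.mem_insert, Finset.mem_singleton] at hA'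
    rcases hA' with hA' | hA' <;>
    rw [← image_decorate a b e (s F) F, hA', image_decorate]

theorem mem_decorate_t {β : ZMod 2} {F : Finset V} : e (t, 0) ∈ decorate a b e β F ↔ t ∈ F := by
  rw [mem_decorate]
  simp [h.ta, h.tb]

/-- Both new tetrahedra contain `t`, so only inner facets are gained. -/
theorem outerCount_unfold {x : V} (hx : ¬ (x = a ∨ x = b)) :
    outerCount (unfoldFacets 𝓕 t v a b s e) (e (t, 0)) (e (x, 0)) = outerCount 𝓕 t x := by
  rw [outerCount, h.card_filter_unfold]
  simp only [h.mem_decorate_t e, mem_decorate, if_neg hx]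
  simp [outerCount]

theorem innerCount_unfold {x : V} (hx : ¬ (x = a ∨ x = b)) :
    innerCount (unfoldFacets 𝓕 t v a b s e) (e (t, 0)) (e (x, 0)) =
      innerCount 𝓕 t x + if x ∈ ({t, v, a, b} : Finset V) then 2 else 0 := by
  rw [innerCount, h.card_filter_unfold]
  simp only [h.mem_decorate_t e, mem_decorate, if_neg hx]
  split_ifs <;> simp_all [innerCount]

omit h in
theorem card_filter_side (P : Finset V → Prop) [DecidablePred P] :
    (𝓕.filter fun F => P F ∧ 0 = s F).card + (𝓕.filter fun F => P F ∧ 1 = s F).card =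
      (𝓕.filter P).card := by
  rw [← Finset.card_union_of_disjoint, ← Finset.filter_or]
  · congr 1
    ext F
    simp only [Finset.mem_filter]
    rcases zmod_two_eq_zero_or_one (s F) with h0 | h0 <;> rw [h0] <;> simp
  · rw [Finset.disjoint_filter]
    rintro F - ⟨-, h0⟩ ⟨-, h1⟩
    exact zero_ne_one (h0.trans h1.symm)

theorem outerCount_add_unfold {x : V} (hx : x = a ∨ x = b) :
    outerCount (unfoldFacets 𝓕 t v a b s e) (e (t, 0)) (e (x, 0)) +
      outerCount (unfoldFacets 𝓕 t v a b s e) (e (t, 0)) (e (x, 1)) = outerCount 𝓕 t x := by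
  simp only [outerCount, h.card_filter_unfold, h.mem_decorate_t e, mem_decorate, if_pos hx]
  rw [← card_filter_side (s := s) fun F => x ∈ F ∧ t ∉ F]
  simp only [and_right_comm]
  simp

theorem innerCount_add_unfold {x : V} (hx : x = a ∨ x = b) :
    innerCount (unfoldFacets 𝓕 t v a b s e) (e (t, 0)) (e (x, 0)) +
      innerCount (unfoldFacets 𝓕 t v a b s e) (e (t, 0)) (e (x, 1)) = innerCount 𝓕 t x + 2 := by
  simp only [innerCount, h.card_filter_unfold, h.mem_decorate_t e, mem_decorate, if_pos hx]
  rw [← card_filter_side (s := s) fun F => x ∈ F ∧ t ∈ F]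
  have hx' : x ∈ ({t, v, a, b} : Finset V) := by rcases hx with rfl | rfl <;> simp
  simp only [and_right_comm, hx']
  simp
  omega

theorem exists_mem_unfold {x : V} (hx : ¬ (x = a ∨ x = b)) :
    (∃ A ∈ unfoldFacets 𝓕 t v a b s e, e (x, 0) ∈ A) ↔ ∃ F ∈ 𝓕, x ∈ F := by
  constructor
  · rintro ⟨A, hA, hxA⟩
    obtain ⟨β, F, rfl, hF⟩ := mem_unfoldFacets.1 hA
    have hxF := (mem_decorate.1 hxA).1
    rcases hF with hF | rfl
    · exact ⟨F, hF.1, hxF⟩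
    · obtain ⟨ρ, hxρ, hρτ, hρ⟩ := Finset.exists_subsuperset_card_eq (n := 3)
        (Finset.singleton_subset_iff.2 hxF) (by simp) (by rw [h.card_tetra]; omega)
      obtain ⟨F, hF, hs⟩ := h.ridge ρ hρτ hρ
      exact ⟨F, hF, hs (Finset.singleton_subset_iff.1 hxρ)⟩
  · rintro ⟨F, hF, hxF⟩
    exact ⟨_, h.mem_lift e hF, mem_decorate.2 ⟨hxF, by rw [if_neg hx]⟩⟩

theorem exists_mem_of_mem_tetra {x : V} (hx : x ∈ ({t, v, a, b} : Finset V)) :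
    ∃ F ∈ 𝓕, x ∈ F := by
  obtain ⟨ρ, hxρ, hρτ, hρ⟩ := Finset.exists_subsuperset_card_eq (n := 3)
    (Finset.singleton_subset_iff.2 hx) (by simp) (by rw [h.card_tetra]; omega)
  obtain ⟨F, hF, hs⟩ := h.ridge ρ hρτ hρ
  exact ⟨F, hF, hs (Finset.singleton_subset_iff.1 hxρ)⟩

theorem bettiAt_unfold {x : V} (hx : x ∉ ({t, v, a, b} : Finset V)) (hF : ∃ F ∈ 𝓕, x ∈ F) :
    bettiAt (unfoldFacets 𝓕 t v a b s e) (e (t, 0)) (e (x, 0)) = bettiAt 𝓕 t x := by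
  have hxt : x ≠ t := by rintro rfl; simp at hx
  have hxab : ¬ (x = a ∨ x = b) := by rintro (rfl | rfl) <;> simp at hx
  have h1 := (h.isConedNormal_unfold e).outerCount_add_two (x := e (x, 0)) (by simpa using hxt)
    ((h.exists_mem_unfold e hxab).2 hF)
  have h2 := h.good.outerCount_add_two hxt hF
  rw [h.outerCount_unfold e hxab, h.innerCount_unfold e hxab, if_neg hx] at h1
  omega

/-- Both new tetrahedra are inner facets at `v`; two more of these lower the value in Euler's
relation by one. -/
theorem bettiAt_unfold_edge :
    bettiAt (unfoldFacets 𝓕 t v a b s e) (e (t, 0)) (e (v, 0)) + 1 = bettiAt 𝓕 t v := by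
  have hxab : ¬ (v = a ∨ v = b) := by simp [h.va, h.vb]
  have hF : ∃ F ∈ 𝓕, v ∈ F := h.exists_mem_of_mem_tetra (by simp)
  have h1 := (h.isConedNormal_unfold e).outerCount_add_two (x := e (v, 0))
    (by simpa using h.tv.symm) ((h.exists_mem_unfold e hxab).2 hF)
  have h2 := h.good.outerCount_add_two h.tv.symm hF
  rw [h.outerCount_unfold e hxab, h.innerCount_unfold e hxab, if_pos (by simp)] at h1
  omega

/-- The two copies share out the old facets and gain one new tetrahedron each. The sum of their
Euler relations is the relation at `x`. -/
theorem bettiAt_unfold_add {x : V} (hx : x = a ∨ x = b) :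
    bettiAt (unfoldFacets 𝓕 t v a b s e) (e (t, 0)) (e (x, 0)) +
      bettiAt (unfoldFacets 𝓕 t v a b s e) (e (t, 0)) (e (x, 1)) = bettiAt 𝓕 t x := by
  have hxt : x ≠ t := by rcases hx with rfl | rfl; exacts [h.ta.symm, h.tb.symm]
  have hxτ : x ∈ ({t, v, a, b} : Finset V) := by rcases hx with rfl | rfl <;> simp
  have hm : ∀ γ, ∃ A ∈ unfoldFacets 𝓕 t v a b s e, e (x, γ) ∈ A := fun γ =>
    ⟨_, mem_cap e γ, mem_decorate.2 ⟨hxτ, by rw [if_pos hx]⟩⟩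
  have h0 := (h.isConedNormal_unfold e).outerCount_add_two (x := e (x, 0)) (by simpa using hxt)
    (hm 0)
  have h1 := (h.isConedNormal_unfold e).outerCount_add_two (x := e (x, 1)) (by simp) (hm 1)
  have h2 := h.good.outerCount_add_two hxt (h.exists_mem_of_mem_tetra hxτ)
  have h3 := h.outerCount_add_unfold e hx
  have h4 := h.innerCount_add_unfold e hx
  omega

omit h in
theorem vertex_unfold {x : V} {γ : ZMod 2}
    (hm : ∃ A ∈ unfoldFacets 𝓕 t v a b s e, e (x, γ) ∈ A) : x = a ∨ x = b ∨ γ = 0 := by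
  obtain ⟨A, hA, hxA⟩ := hm
  obtain ⟨β, F, rfl, -⟩ := mem_unfoldFacets.1 hA
  have := (mem_decorate.1 hxA).2
  split_ifs at this with hab
  · exact hab.elim Or.inl fun hb => Or.inr (Or.inl hb)
  · exact Or.inr (Or.inr this)

/-- The proper faces of `tvab` already belong to `𝓕` by `ridge`, so removing the image of the new
tetrahedra removes exactly what was added. -/
theorem image_ofFacets_unfold :
    (ofFacets 𝓕).faces = {τ | ∃ ρ, ρ ∈ ofFacets (unfoldFacets 𝓕 t v a b s e) ∧
      τ = ρ.image fun w => (e.symm w).1} \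
        {(decorate a b e 0 {t, v, a, b}).image fun w => (e.symm w).1} := by
  rw [image_decorate]
  ext τ
  simp only [Set.mem_sdiff, Set.mem_ofPred_eq, Set.mem_singleton_iff, mem_ofFacets]
  constructor
  · intro hτ
    obtain ⟨hn, F, hF, hs⟩ := mem_ofFacets.1 hτ
    refine ⟨⟨decorate a b e (s F) τ, ⟨hn.image _, _, h.mem_lift e hF,
      decorate_subset.2 ⟨hs, fun _ => rfl⟩⟩, (image_decorate _ _ _ _ _).symm⟩, ?_⟩
    rintro rfl
    apply h.notMem
    rw [Finset.eq_of_subset_of_card_le hs (by rw [h.card_tetra, h.good.card_eq F hF])]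
    exact hF
  · rintro ⟨⟨ρ, ⟨hn, A, hA, hs⟩, rfl⟩, hne⟩
    obtain ⟨β, F, rfl, hF⟩ := mem_unfoldFacets.1 hA
    obtain ⟨σ, hσ, rfl⟩ := exists_decorate_of_subset hs
    rw [image_decorate] at hne ⊢
    have hσn : σ.Nonempty := Finset.image_nonempty.1 hn
    change σ ∈ ofFacets 𝓕
    rw [mem_ofFacets]
    refine ⟨hσn, ?_⟩
    rcases hF with hF | rfl
    · exact ⟨F, hF.1, hσ⟩
    · have hlt := Finset.card_lt_card (Finset.ssubset_iff_subset_ne.2 ⟨hσ, hne⟩)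
      rw [h.card_tetra] at hlt
      obtain ⟨ρ, hσρ, hρτ, hρ⟩ := Finset.exists_subsuperset_card_eq (n := 3) hσ (by omega)
        (by rw [h.card_tetra]; omega)
      obtain ⟨F, hF, hs⟩ := h.ridge ρ hρτ hρ
      exact ⟨F, hF, hσρ.trans hs⟩

theorem inter_cap_eq : decorate a b e 0 {t, v, a, b} ∩ decorate a b e 1 {t, v, a, b} =
    {e (t, 0), e (v, 0)} := by
  ext w
  obtain ⟨⟨x, γ⟩, rfl⟩ := e.surjective w
  rw [Finset.mem_inter, mem_decorate, mem_decorate]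
  simp only [Finset.mem_insert, Finset.mem_singleton, EmbeddingLike.apply_eq_iff_eq, Prod.mk.injEq]
  constructor
  · rintro ⟨⟨h1, h2⟩, -, h3⟩
    by_cases hab : x = a ∨ x = b
    · rw [if_pos hab] at h2 h3
      exact (zero_ne_one (h2.symm.trans h3)).elim
    · rw [if_neg hab] at h2
      tauto
  · rintro (⟨rfl, rfl⟩ | ⟨rfl, rfl⟩)
    · simp [h.ta, h.tb]
    · simp [h.va, h.vb]

/-- Two copies of a vertex of `ab` are joined by no edge, and their common neighbours lie in
`tv`. -/
theorem common_neighbour {x z : V} (hx : x = a ∨ x = b) {γ : ZMod 2} {A B : Finset W}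
    (hA : A ∈ unfoldFacets 𝓕 t v a b s e) (hB : B ∈ unfoldFacets 𝓕 t v a b s e)
    (hxA : e (x, 0) ∈ A) (hzA : e (z, γ) ∈ A) (hxB : e (x, 1) ∈ B) (hzB : e (z, γ) ∈ B) :
    z = t ∨ z = v := by
  obtain ⟨β, F, rfl, hF⟩ := mem_unfoldFacets.1 hA
  obtain ⟨β', G, rfl, hG⟩ := mem_unfoldFacets.1 hB
  rw [mem_decorate, if_pos hx] at hxA hxB
  rw [mem_decorate] at hzA hzB
  by_cases hzab : z = a ∨ z = b
  · rw [if_pos hzab] at hzA hzB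
    rw [← hzA.2] at hxA
    rw [← hzB.2] at hxB
    exact (zero_ne_one (hxA.2.trans hxB.2.symm)).elim
  by_contra hn
  have hz : z ∉ ({t, v, a, b} : Finset V) := by
    simp only [Finset.mem_insert, Finset.mem_singleton]
    tauto
  have hF' := hF.resolve_right fun e => hz (e ▸ hzA.1)
  have hG' := hG.resolve_right fun e => hz (e ▸ hzB.1)
  have := h.side_eq hx hz hF'.1 hG'.1 hxA.1 hzA.1 hxB.1 hzB.1
  rw [hF'.2, hG'.2, ← hxA.2, ← hxB.2] at this
  exact zero_ne_one this

end UnfoldData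

theorem SimpleGraph.Walk.exists_mid {G : SimpleGraph V} {u w : V} (p : G.Walk u w) (hne : u ≠ w)
    (hl : p.length ≤ 2) (hna : ¬ G.Adj u w) : ∃ z ∈ p.support, G.Adj u z ∧ G.Adj z w := by
  cases p with
  | nil => exact (hne rfl).elim
  | cons h1 p =>
    cases p with
    | nil => exact (hna h1).elim
    | cons h2 p =>
      cases p with
      | nil => exact ⟨_, by simp, h1, h2⟩
      | cons h3 p => simp at hl

namespace UnfoldData

variable {𝓕 : Finset (Finset V)} {t v a b : V} {s : Finset V → ZMod 2}
  (h : UnfoldData 𝓕 t v a b s) (e : V × ZMod 2 ≃ W)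
include h

/-- The bijection `ψ` switches the label of the copies of `a` and `b`, and the quotient map forgets
labels. -/
theorem isEdgeFolding_unfold :
    (ofFacets (unfoldFacets 𝓕 t v a b s e)).IsEdgeFolding (ofFacets 𝓕) := by
  have hfac : ∀ {A}, (ofFacets (unfoldFacets 𝓕 t v a b s e)).IsFacet A ↔
      A ∈ unfoldFacets 𝓕 t v a b s e := isFacet_ofFacets fun _ hA => h.card_unfold e hA
  have hψ : ∀ {w x γ}, w = e (x, γ) →
      (fun w => if (e.symm w).1 = a ∨ (e.symm w).1 = b then
        e ((e.symm w).1, (e.symm w).2 + 1) else w) w =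
      e (x, if x = a ∨ x = b then γ + 1 else γ) := by
    rintro _ x γ rfl
    simp only [Equiv.symm_apply_apply]
    split_ifs <;> rfl
  refine ⟨decorate a b e 0 {t, v, a, b}, decorate a b e 1 {t, v, a, b}, e (t, 0), e (v, 0),
    fun w => if (e.symm w).1 = a ∨ (e.symm w).1 = b then
      e ((e.symm w).1, (e.symm w).2 + 1) else w, fun w => (e.symm w).1,
    hfac.2 (mem_cap e 0), hfac.2 (mem_cap e 1), cap_ne_cap e, by simpa using h.tv,
    h.inter_cap_eq e, ⟨?_, ?_, ?_⟩, ?_, ?_, ?_, ?_, h.image_ofFacets_unfold e⟩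
  · intro w hw
    obtain ⟨⟨x, γ⟩, rfl⟩ := e.surjective w
    rw [Finset.mem_coe, mem_decorate] at hw
    rw [hψ rfl, Finset.mem_coe, mem_decorate]
    refine ⟨hw.1, ?_⟩
    split_ifs with hab
    · rw [hw.2, if_pos hab, zero_add]
    · rw [hw.2, if_neg hab]
  · intro w _ w' _ hww
    obtain ⟨⟨x, γ⟩, rfl⟩ := e.surjective w
    obtain ⟨⟨x', γ'⟩, rfl⟩ := e.surjective w'
    rw [hψ rfl, hψ rfl, EmbeddingLike.apply_eq_iff_eq, Prod.mk.injEq] at hww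
    obtain ⟨rfl, hγ⟩ := hww
    split_ifs at hγ
    · rw [add_right_cancel hγ]
    · rw [hγ]
  · intro w hw
    obtain ⟨⟨x, γ⟩, rfl⟩ := e.surjective w
    rw [Finset.mem_coe, mem_decorate] at hw
    refine ⟨e (x, 0), ?_, ?_⟩
    · rw [Finset.mem_coe, mem_decorate]
      exact ⟨hw.1, by split_ifs <;> rfl⟩
    · rw [hψ rfl, hw.2, zero_add]
  · rw [hψ rfl]
    simp [h.ta, h.tb]
  · rw [hψ rfl]
    simp [h.va, h.vb]
  · intro u hu hut huv
    obtain ⟨⟨x, γ⟩, rfl⟩ := e.surjective u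
    obtain ⟨hx, hγ⟩ := mem_decorate.1 hu
    have hxab : x = a ∨ x = b := by
      by_contra hab
      rw [if_neg hab] at hγ
      subst hγ
      simp only [Finset.mem_insert, Finset.mem_singleton] at hx
      rcases hx with rfl | rfl | hx
      · exact hut rfl
      · exact huv rfl
      · exact hab hx
    rw [if_pos hxab] at hγ
    subst hγ
    rw [hψ rfl, if_pos hxab, zero_add]
    intro p _ hl
    -- The path has a middle vertex, a common neighbour of both copies, hence `t` or `v`. An edge
    -- between the copies is excluded by `common_neighbour` too, with one copy in the role of the
    -- neighbour.
    obtain ⟨z, hz, h1, h2⟩ := p.exists_mid (by simp) hl (by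
      rintro ⟨-, hm⟩
      obtain ⟨-, A, hA, hs⟩ := mem_ofFacets.1 hm
      have := h.common_neighbour e hxab hA hA (hs (by simp)) (hs (by simp)) (hs (by simp))
        (z := x) (γ := 0) (hs (by simp))
      rcases this with rfl | rfl
      · exact hxab.elim h.ta h.tb
      · exact hxab.elim h.va h.vb)
    obtain ⟨⟨z, γ⟩, rfl⟩ := e.surjective z
    obtain ⟨-, A, hA, hsA⟩ := mem_ofFacets.1 h1.2
    obtain ⟨-, B, hB, hsB⟩ := mem_ofFacets.1 h2.2
    have hγ := vertex_unfold e ⟨A, hA, hsA (x := e (z, γ)) (by simp)⟩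
    have hzt := h.common_neighbour e hxab hA hB (hsA (by simp)) (hsA (x := e (z, γ)) (by simp))
      (hsB (by simp)) (hsB (by simp))
    rcases hzt with rfl | rfl
    · rcases hγ with hγ | hγ | rfl
      · exact (h.ta hγ).elim
      · exact (h.tb hγ).elim
      · exact Or.inl hz
    · rcases hγ with hγ | hγ | rfl
      · exact (h.va hγ).elim
      · exact (h.vb hγ).elim
      · exact Or.inr hz
  · intro w w' hw hw'
    obtain ⟨⟨x, γ⟩, rfl⟩ := e.surjective w
    obtain ⟨⟨x', γ'⟩, rfl⟩ := e.surjective w'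
    have hv1 : x = a ∨ x = b ∨ γ = 0 := by
      obtain ⟨-, A, hA, hs⟩ := mem_ofFacets.1 hw
      exact vertex_unfold e ⟨A, hA, hs (by simp)⟩
    have hv2 : x' = a ∨ x' = b ∨ γ' = 0 := by
      obtain ⟨-, A, hA, hs⟩ := mem_ofFacets.1 hw'
      exact vertex_unfold e ⟨A, hA, hs (by simp)⟩
    rw [hψ rfl, hψ rfl, mem_decorate, mem_decorate]
    simp only [Equiv.symm_apply_apply, EmbeddingLike.apply_eq_iff_eq, Prod.mk.injEq]
    constructor
    · rintro rfl
      by_cases hab : x = a ∨ x = b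
      · have hxτ : x ∈ ({t, v, a, b} : Finset V) := by rcases hab with rfl | rfl <;> simp
        simp only [if_pos hab, hxτ, true_and]
        exact zmod_two_swap γ γ'
      · have e1 : γ = 0 := by tauto
        have e2 : γ' = 0 := by tauto
        exact Or.inl ⟨rfl, e1.trans e2.symm⟩
    · rintro (⟨h1, -⟩ | ⟨-, h1, -⟩ | ⟨-, h1, -⟩)
      · exact h1
      · exact h1.symm
      · exact h1

end UnfoldData

end UnfoldCount

/-! ### An edge in the support of `φ` away from two given vertices. -/

noncomputable section UnfoldExistence

variable {V : Type*}

theorem IsEvenAt.eq_zero_of_mem {𝓕 : Finset (Finset V)} {t v : V} {φ : Finset V → ZMod 2}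
    (hφ : IsEvenAt 𝓕 t v φ) {ρ : Finset V} (ht : t ∈ ρ) : φ ρ = 0 :=
  hφ.eq_zero ρ fun hm => (Finset.mem_filter.1 hm).2.2 ht

theorem mem_ridgesAt {𝓕 : Finset (Finset V)} {t v : V} {ρ : Finset V} :
    ρ ∈ ridgesAt 𝓕 t v ↔ ρ ∈ ridges 𝓕 ∧ v ∈ ρ ∧ t ∉ ρ := Finset.mem_filter

theorem Finset.exists_eq_of_card_three {ρ : Finset V} (hρ : ρ.card = 3) {v : V} (hv : v ∈ ρ) :
    ∃ x y, v ≠ x ∧ v ≠ y ∧ x ≠ y ∧ ρ = {v, x, y} := by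
  have h1 : (ρ.erase v).card = 2 := by rw [Finset.card_erase_of_mem hv]; omega
  obtain ⟨x, y, hxy, he⟩ := Finset.card_eq_two.1 h1
  have hx : x ∈ ρ.erase v := by rw [he]; simp
  have hy : y ∈ ρ.erase v := by rw [he]; simp
  exact ⟨x, y, (Finset.ne_of_mem_erase hx).symm, (Finset.ne_of_mem_erase hy).symm, hxy, by
    rw [← he, Finset.insert_erase hv]⟩

theorem Finset.exists_eq_of_card_four {F : Finset V} (hF : F.card = 4) {v : V} (hv : v ∈ F) :
    ∃ x y z, v ≠ x ∧ v ≠ y ∧ v ≠ z ∧ x ≠ y ∧ x ≠ z ∧ y ≠ z ∧ F = {v, x, y, z} := by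
  have h1 : (F.erase v).card = 3 := by rw [Finset.card_erase_of_mem hv]; omega
  obtain ⟨x, y, z, hxy, hxz, hyz, he⟩ := Finset.card_eq_three.1 h1
  have hx : x ∈ F.erase v := by rw [he]; simp
  have hy : y ∈ F.erase v := by rw [he]; simp
  have hz : z ∈ F.erase v := by rw [he]; simp
  exact ⟨x, y, z, (Finset.ne_of_mem_erase hx).symm, (Finset.ne_of_mem_erase hy).symm,
    (Finset.ne_of_mem_erase hz).symm, hxy, hxz, hyz, by rw [← he, Finset.insert_erase hv]⟩

theorem IsEvenAt.add_eq {𝓕 : Finset (Finset V)} (hc : ∀ F ∈ 𝓕, F.card = 4) {t v : V}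
    {φ : Finset V → ZMod 2} (hφ : IsEvenAt 𝓕 t v φ) {x y z : V} (hx : v ≠ x) (hy : v ≠ y)
    (hz : v ≠ z) (hF : ∃ F ∈ 𝓕, {v, x, y, z} ⊆ F) : φ {v, x, y} + φ {v, y, z} = φ {v, x, z} :=
  hφ.isCocycle hc x y z (mem_link_ofFacets.2 ⟨by simp, by simp [hx, hy, hz], by
    obtain ⟨F, hF, hs⟩ := hF
    exact ⟨F, hF, hs⟩⟩)

theorem isEvenAt_of_add_eq {𝓕 : Finset (Finset V)} (hc : ∀ F ∈ 𝓕, F.card = 4) {t v : V}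
    {φ : Finset V → ZMod 2} (h0 : ∀ ρ, ρ ∉ ridgesAt 𝓕 t v → φ ρ = 0)
    (hadd : ∀ x y z, v ≠ x → v ≠ y → v ≠ z → x ≠ y → x ≠ z → y ≠ z → {v, x, y, z} ∈ 𝓕 →
      φ {v, x, y} + φ {v, y, z} = φ {v, x, z}) : IsEvenAt 𝓕 t v φ := by
  refine ⟨h0, fun F hF hv => ?_⟩
  obtain ⟨x, y, z, hx, hy, hz, hxy, hxz, hyz, rfl⟩ := Finset.exists_eq_of_card_four (hc F hF) hv
  have e1 : ∑ ρ ∈ (ridgesAt 𝓕 t v).filter (· ⊆ {v, x, y, z}), φ ρ =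
      ∑ ρ ∈ {{v, x, y}, {v, y, z}, {v, x, z}}, φ ρ := by
    refine Finset.sum_subset_zero_on_sdiff ?_ ?_ fun _ _ => rfl
    · intro ρ hρ
      obtain ⟨hρ, hs⟩ := Finset.mem_filter.1 hρ
      obtain ⟨hr, hvρ, -⟩ := mem_ridgesAt.1 hρ
      obtain ⟨p, q, hp, hq, hpq, rfl⟩ := Finset.exists_eq_of_card_three (mem_ridges.1 hr).1 hvρ
      have h1 : p ∈ ({v, x, y, z} : Finset V) := hs (by simp)
      have h2 : q ∈ ({v, x, y, z} : Finset V) := hs (by simp)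
      simp only [Finset.mem_insert, Finset.mem_singleton] at h1 h2 ⊢
      rcases h1 with rfl | rfl | rfl | rfl
      · exact (hp rfl).elim
      all_goals
        rcases h2 with rfl | rfl | rfl | rfl
        · exact (hq rfl).elim
        all_goals simp_all [Finset.pair_comm]
    · intro ρ hρ
      rw [Finset.mem_sdiff, Finset.mem_filter] at hρ
      refine h0 ρ fun hm => hρ.2 ⟨hm, ?_⟩
      have := hρ.1
      simp only [Finset.mem_insert, Finset.mem_singleton] at this
      rcases this with rfl | rfl | rfl <;> simp [Finset.insert_subset_iff]
  have ne : ∀ {p q r : V}, v ≠ p → p ≠ q → p ≠ r → ({v, p, q} : Finset V) ≠ {v, q, r} ∧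
      ({v, p, q} : Finset V) ≠ {v, r, q} ∧ ({v, q, p} : Finset V) ≠ {v, q, r} := by
    intro p q r h1 h2 h3
    have hp : p ∉ ({v, q, r} : Finset V) := by simp [h1.symm, h2, h3]
    have hp' : p ∉ ({v, r, q} : Finset V) := by simp [h1.symm, h2, h3]
    refine ⟨fun e => hp (e ▸ by simp), fun e => hp' (e ▸ by simp), fun e => hp (e ▸ by simp)⟩
  rw [e1, Finset.sum_insert, Finset.sum_pair, ← add_assoc,
    hadd x y z hx hy hz hxy hxz hyz hF, CharTwo.add_self_eq_zero]
  · exact (ne hy hyz hxy.symm).2.1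
  · rw [Finset.mem_insert, Finset.mem_singleton, not_or]
    exact ⟨(ne hx hxy hxz).1, (ne hy hxy.symm hyz).2.2⟩

/-- The common value of `u` on the facets containing `ρ`. -/
def valueOn (𝓕 : Finset (Finset V)) (u : Finset V → ZMod 2) (ρ : Finset V) : ZMod 2 :=
  if ∃ F ∈ 𝓕, ρ ⊆ F ∧ u F = 1 then 1 else 0

/-- Over `ZMod 2` a common value is known once it is known whether 1 is attained. This lets
well-defined values be written without a choice. -/
theorem ite_exists_eq {ι : Type*} {P : ι → Prop} {u : ι → ZMod 2} {i : ι} (hi : P i)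
    (hu : ∀ j, P j → u j = u i) : (if ∃ j, P j ∧ u j = 1 then 1 else 0 : ZMod 2) = u i := by
  split_ifs with hex
  · obtain ⟨j, hj, h1⟩ := hex
    rw [← hu j hj, h1]
  · rcases zmod_two_eq_zero_or_one (u i) with h0 | h1
    · exact h0.symm
    · exact (hex ⟨i, hi, h1⟩).elim

namespace IsConedNormal

variable {𝓕 : Finset (Finset V)} {t : V} (h : IsConedNormal 𝓕 t)
include h

theorem valueOn_eq {u : Finset V → ZMod 2} {ρ F : Finset V} (hρ : ρ.card = 3)
    (hu : ∀ F ∈ 𝓕, ∀ G ∈ 𝓕, F ∩ G = ρ → u F = u G) (hF : F ∈ 𝓕) (hs : ρ ⊆ F) :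
    valueOn 𝓕 u ρ = u F := by
  rw [valueOn, ← ite_exists_eq (P := fun G => G ∈ 𝓕 ∧ ρ ⊆ G) (u := u) ⟨hF, hs⟩]
  · simp only [and_assoc]
  · rintro G ⟨hG, hsG⟩
    by_cases hFG : G = F
    · rw [hFG]
    · exact hu G hG F hF (Finset.eq_inter_of_card_three (h.card_eq G hG) (h.card_eq F hF) hFG hρ
        hsG hs)

/-- If the support of `φ` consists of faces meeting `pq`, then those at `p` contain `q`. -/
theorem eq_zero_of_support {v p q : V} {φ : Finset V → ZMod 2} (hφ : IsEvenAt 𝓕 t v φ)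
    (hpv : p ≠ v) (hqv : q ≠ v) (hqt : q ≠ t) (hpt : p ≠ t) (hpq : p ≠ q)
    (hs : ∀ ρ, φ ρ ≠ 0 → p ∈ ρ ∨ q ∈ ρ) {x : V} (hxq : x ≠ q) : φ {v, p, x} = 0 := by
  by_contra hx
  have hr : {v, p, x} ∈ ridgesAt 𝓕 t v := by
    by_contra hn
    exact hx (hφ.eq_zero _ hn)
  obtain ⟨hr, -, htρ⟩ := mem_ridgesAt.1 hr
  obtain ⟨hc3, F, hF, hsF⟩ := mem_ridges.1 hr
  have hxv : x ≠ v := by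
    rintro rfl
    rw [Finset.insert_comm, Finset.pair_eq_singleton, Finset.card_pair hpv] at hc3
    omega
  have hxp : x ≠ p := by
    rintro rfl
    rw [Finset.pair_eq_singleton, Finset.card_pair hpv.symm] at hc3
    omega
  have htwo : ∀ {x y z}, v ≠ x → v ≠ y → v ≠ z → (∃ F ∈ 𝓕, {v, x, y, z} ⊆ F) →
    φ {v, x, y} + φ {v, y, z} = φ {v, x, z} := fun h1 h2 h3 => hφ.add_eq h.card_eq h1 h2 h3
  have hnq : ∀ {y z}, v ≠ y → v ≠ z → y ≠ p → z ≠ p → y ≠ q → z ≠ q → φ {v, y, z} = 0 := by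
    intro y z h1 h2 h3 h4 h5 h6
    by_contra hn
    have := hs _ hn
    simp only [Finset.mem_insert, Finset.mem_singleton] at this
    rcases this with (rfl | rfl | rfl) | (rfl | rfl | rfl) <;> contradiction
  have hloc : ∀ F ∈ 𝓕, v ∈ F → p ∈ F → ∀ y ∈ F, ∀ z ∈ F, y ≠ v → y ≠ p → y ≠ q → z ≠ v → z ≠ p →
      z ≠ q → φ {v, p, y} = φ {v, p, z} := by
    intro F hF hv hp y hy z hz h1 h2 h3 h4 h5 h6
    have := htwo (x := p) (y := y) (z := z) hpv.symm h1.symm h4.symm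
      ⟨F, hF, by simp [Finset.insert_subset_iff, *]⟩
    rwa [hnq h1.symm h4.symm h2 h5 h3 h6, add_zero] at this
  let P : Finset V → V → Prop := fun F y => y ∈ F ∧ y ≠ v ∧ y ≠ p ∧ y ≠ q
  -- In the link of `v`, the edges from `p` to vertices other than `q` in one triangle have the same
  -- value, since the opposite edge avoids `p` and `q`. That value is the colour.
  let c : Finset V → ZMod 2 := fun F => if ∃ y, P F y ∧ φ {v, p, y} = 1 then 1 else 0
  have hcval : ∀ F ∈ 𝓕, v ∈ F → p ∈ F → ∀ y, P F y → c F = φ {v, p, y} := by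
    intro F hF hv hp y hy
    exact ite_exists_eq (u := fun y => φ {v, p, y}) hy fun z hz => hloc F hF hv hp z hz.1 y hy.1
      hz.2.1 hz.2.2.1 hz.2.2.2 hy.2.1 hy.2.2.1 hy.2.2.2
  have hvF : v ∈ F := hsF (by simp)
  have hpF : p ∈ F := hsF (by simp)
  have hxF : x ∈ F := hsF (by simp)
  obtain ⟨G, hG, hsG⟩ := h.cone F hF v hvF p hpF
  have hvt : v ≠ t := fun e => htρ (e ▸ by simp)
  -- The colour is constant around `p`, and it is 0 at a facet containing `t`.
  have hconst := h.conn {v, p} Finset.card_le_two c ?_ F hF G hG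
    (by simp [Finset.insert_subset_iff, *])
    ((Finset.subset_insert _ _).trans hsG)
  · rw [hcval F hF hvF hpF x ⟨hxF, hxv, hxp, hxq⟩, hcval G hG (hsG (by simp)) (hsG (by simp)) t
      ⟨hsG (by simp), hvt.symm, hpt.symm, hqt.symm⟩, hφ.eq_zero_of_mem (ρ := {v, p, t}) (by simp)] at hconst
    exact hx hconst
  intro A hA B hB hsA hsB hAB
  have hvA : v ∈ A := hsA (by simp)
  have hpA : p ∈ A := hsA (by simp)
  have hvB : v ∈ B := hsB (by simp)
  have hpB : p ∈ B := hsB (by simp)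
  by_cases hz : ∃ z ∈ A ∩ B, z ≠ v ∧ z ≠ p ∧ z ≠ q
  · obtain ⟨z, hz, h1⟩ := hz
    rw [Finset.mem_inter] at hz
    rw [hcval A hA hvA hpA z ⟨hz.1, h1⟩, hcval B hB hvB hpB z ⟨hz.2, h1⟩]
  -- What remains is the crossing of the edge `pq`.
  have hABe : A ∩ B = {v, p, q} := by
    refine Finset.eq_of_subset_of_card_le ?_ (by
      rw [hAB, Finset.card_three_of_ne hpv.symm hqv.symm hpq])
    intro z hzm
    simp only [Finset.mem_insert, Finset.mem_singleton]
    by_contra hn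
    rw [not_or, not_or] at hn
    exact hz ⟨z, hzm, hn⟩
  -- the sum over the star of `vp` of the values on the faces opposite to `p`
  have hopp : ∀ F ∈ 𝓕, v ∈ F → p ∈ F → q ∉ F → φ (F.erase p) = 0 := by
    intro F hF hv hp hq
    by_contra hn
    have := hs _ hn
    rw [Finset.mem_erase] at this
    rcases this with h1 | h1
    · exact h1.1 rfl
    · exact hq (Finset.mem_of_mem_erase h1)
  -- The value opposite to `p` in a facet is the sum of the values on its two triangles at `vp`.
  -- Over the whole star each such triangle is counted twice.
  have hsum : ∑ F ∈ 𝓕.filter ({v, p} ⊆ ·), φ (F.erase p) = 0 := by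
    have e1 : ∀ F ∈ 𝓕.filter ({v, p} ⊆ ·), φ (F.erase p) =
        ∑ ρ ∈ (ridges 𝓕).filter (fun ρ => {v, p} ⊆ ρ ∧ ρ ⊆ F), φ ρ := by
      intro F hF
      obtain ⟨hF, hsF⟩ := Finset.mem_filter.1 hF
      have hv : v ∈ F := hsF (by simp)
      have hp : p ∈ F := hsF (by simp)
      rw [sum_ridges_subset hF (h.card_eq F hF)]
      obtain ⟨y, z, w, h1, h2, h3, h4, h5, h6, rfl⟩ :=
        Finset.exists_eq_of_card_four (h.card_eq F hF) hv
      have key : ∀ y z, v ≠ y → v ≠ z → y ≠ z → p ≠ y → p ≠ z → {v, p, y, z} ∈ 𝓕 →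
          φ (({v, p, y, z} : Finset V).erase p) =
            ∑ r ∈ ({v, p, y, z} : Finset V).filter fun r =>
              {v, p} ⊆ ({v, p, y, z} : Finset V).erase r,
              φ (({v, p, y, z} : Finset V).erase r) := by
        intro y z h1 h2 h3 h4 h5 hm
        have f1 : (({v, p, y, z} : Finset V).filter fun r =>
              {v, p} ⊆ ({v, p, y, z} : Finset V).erase r) = {y, z} := by
          ext r
          simp only [Finset.mem_filter, Finset.mem_insert, Finset.mem_singleton,
            Finset.insert_subset_iff, Finset.singleton_subset_iff, Finset.mem_erase]
          constructor
          · rintro ⟨h, h', h''⟩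
            rcases h with rfl | rfl | h
            · exact (h'.1 rfl).elim
            · exact (h''.1 rfl).elim
            · exact h
          · rintro (rfl | rfl) <;> simp [*]
        have g1 : ({v, p, y, z} : Finset V).erase p = {v, y, z} := by
          ext r; simp only [Finset.mem_erase, Finset.mem_insert, Finset.mem_singleton]; grind
        have g2 : ({v, p, y, z} : Finset V).erase y = {v, p, z} := by
          ext r; simp only [Finset.mem_erase, Finset.mem_insert, Finset.mem_singleton]; grind
        have g3 : ({v, p, y, z} : Finset V).erase z = {v, p, y} := by
          ext r; simp only [Finset.mem_erase, Finset.mem_insert, Finset.mem_singleton]; grind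
        rw [f1, Finset.sum_pair h3, g1, g2, g3,
          ← htwo hpv.symm h1 h2 ⟨_, hm, Finset.Subset.refl _⟩]
        generalize φ _ = r
        generalize φ _ = r'
        revert r r'
        decide
      have hp' : p = y ∨ p = z ∨ p = w := by
        simp only [Finset.mem_insert, Finset.mem_singleton] at hp
        exact hp.resolve_left hpv
      rcases hp' with rfl | rfl | rfl
      · exact key z w h2 h3 h6 h4 h5 hF
      · have e : ({v, y, p, w} : Finset V) = {v, p, y, w} := by rw [Finset.insert_comm y p]
        rw [e] at hF ⊢
        exact key y w h1 h3 h5 h4.symm h6 hF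
      · have e : ({v, y, z, p} : Finset V) = {v, p, y, z} := by
          rw [Finset.pair_comm z p, Finset.insert_comm y p]
        rw [e] at hF ⊢
        exact key y z h1 h2 h4 h5.symm h6.symm hF
    rw [Finset.sum_congr rfl e1]
    have e2 : ∀ F ∈ 𝓕.filter (fun F => ¬ {v, p} ⊆ F),
        ∑ ρ ∈ (ridges 𝓕).filter (fun ρ => {v, p} ⊆ ρ ∧ ρ ⊆ F), φ ρ = 0 := by
      intro F hF
      rw [Finset.filter_false_of_mem, Finset.sum_empty]
      rintro ρ - ⟨h1, h2⟩
      exact (Finset.mem_filter.1 hF).2 (h1.trans h2)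
    have e3 := Finset.sum_filter_add_sum_filter_not 𝓕 ({v, p} ⊆ ·)
      fun F => ∑ ρ ∈ (ridges 𝓕).filter (fun ρ => {v, p} ⊆ ρ ∧ ρ ⊆ F), φ ρ
    rw [Finset.sum_eq_zero e2, add_zero, ← sum_ridges_comm ({v, p} ⊆ ·) fun ρ _ => φ ρ] at e3
    rw [e3]
    refine Finset.sum_eq_zero fun ρ hρ => even_card_eq_zero ?_ _
    obtain ⟨h1, h2⟩ := mem_ridges.1 (Finset.mem_filter.1 hρ).1
    exact h.two_facets ρ h1 h2
  obtain ⟨hne, hpair⟩ := h.filter_eq_pair hA hB hAB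
  -- All facets of the star except the two at `pq` contribute 0 by `hopp`.
  have hsum2 : φ (A.erase p) + φ (B.erase p) = 0 := by
    rw [← Finset.sum_pair hne (f := fun F => φ (F.erase p)), ← hpair, ← hsum]
    refine Finset.sum_subset ?_ ?_
    · intro F hF
      rw [Finset.mem_filter] at hF ⊢
      exact ⟨hF.1, (Finset.subset_inter hsA hsB).trans hF.2⟩
    · intro F hF hF'
      rw [Finset.mem_filter] at hF hF'
      have hv := hF.2 (show v ∈ {v, p} by simp)
      have hp := hF.2 (show p ∈ {v, p} by simp)
      refine hopp F hF.1 hv hp fun hq => hF' ⟨hF.1, ?_⟩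
      rw [hABe]
      simp [Finset.insert_subset_iff, *]
  have hval : ∀ F ∈ 𝓕, {v, p, q} ⊆ F → φ (F.erase p) = φ {v, p, q} + c F := by
    intro F hF hsF
    obtain ⟨y, hy, he⟩ := Finset.exists_erase_of_card (h.card_eq F hF)
      (Finset.card_three_of_ne hpv.symm hqv.symm hpq) hsF
    have hy' : y ∉ ({v, p, q} : Finset V) := by rw [he]; simp
    simp only [Finset.mem_insert, Finset.mem_singleton, not_or] at hy'
    have hFe : F = {v, p, q, y} := by
      rw [← Finset.insert_erase hy, ← he]
      ext r; simp only [Finset.mem_insert, Finset.mem_singleton]; tauto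
    rw [hcval F hF (hsF (by simp)) (hsF (by simp)) y ⟨hy, hy'⟩]
    have g1 : F.erase p = {v, q, y} := by
      rw [hFe]; ext r; simp only [Finset.mem_erase, Finset.mem_insert, Finset.mem_singleton]; grind
    rw [g1, ← htwo hpv.symm hqv.symm (Ne.symm hy'.1) ⟨F, hF, hFe.ge⟩]
    generalize φ _ = r
    generalize φ _ = r'
    revert r r'
    decide
  rw [hval A hA (by rw [← hABe]; exact Finset.inter_subset_left),
    hval B hB (by rw [← hABe]; exact Finset.inter_subset_right)] at hsum2
  revert hsum2
  generalize φ _ = r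
  generalize c A = r'
  generalize c B = r''
  revert r r' r''
  decide

/-- If every edge of the support met `p` or `q`, then `eq_zero_of_support` at both ends would leave
only `pq`. The cocycle rule in a facet at `vpq` kills that edge as well. -/
theorem exists_support {v p q : V} {φ : Finset V → ZMod 2} (hφ : IsEvenAt 𝓕 t v φ) (h0 : φ ≠ 0)
    (hpv : p ≠ v) (hqv : q ≠ v) (hqt : q ≠ t) (hpt : p ≠ t) (hpq : p ≠ q) :
    ∃ a b, v ≠ a ∧ v ≠ b ∧ a ≠ b ∧ a ≠ p ∧ a ≠ q ∧ b ≠ p ∧ b ≠ q ∧ φ {v, a, b} ≠ 0 := by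
  by_contra! hn
  have mem3 : ∀ ρ, φ ρ ≠ 0 → ∃ x y, v ≠ x ∧ v ≠ y ∧ x ≠ y ∧ ρ = {v, x, y} := by
    intro ρ hρ
    have hr : ρ ∈ ridgesAt 𝓕 t v := by
      by_contra hn
      exact hρ (hφ.eq_zero _ hn)
    obtain ⟨hr, hv, -⟩ := mem_ridgesAt.1 hr
    exact Finset.exists_eq_of_card_three (mem_ridges.1 hr).1 hv
  have hs : ∀ ρ, φ ρ ≠ 0 → p ∈ ρ ∨ q ∈ ρ := by
    intro ρ hρ
    obtain ⟨x, y, h1, h2, h3, rfl⟩ := mem3 ρ hρ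
    by_contra hpq
    simp only [Finset.mem_insert, Finset.mem_singleton, not_or] at hpq
    exact hρ (hn x y h1 h2 h3 (Ne.symm hpq.1.2.1) (Ne.symm hpq.2.2.1) (Ne.symm hpq.1.2.2)
      (Ne.symm hpq.2.2.2))
  have hp : ∀ x, x ≠ q → φ {v, p, x} = 0 := fun x hx =>
    h.eq_zero_of_support hφ hpv hqv hqt hpt hpq hs hx
  have hq : ∀ x, x ≠ p → φ {v, q, x} = 0 := fun x hx =>
    h.eq_zero_of_support hφ hqv hpv hpt hqt hpq.symm (fun ρ hρ => (hs ρ hρ).symm) hx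
  have hall : ∀ ρ, φ ρ ≠ 0 → ρ = {v, p, q} := by
    intro ρ hρ
    obtain ⟨x, y, h1, h2, h3, rfl⟩ := mem3 ρ hρ
    have := hs _ hρ
    simp only [Finset.mem_insert, Finset.mem_singleton] at this
    rcases this with (rfl | rfl | rfl) | (rfl | rfl | rfl)
    · exact (hpv rfl).elim
    · by_contra hne
      exact hρ (hp y fun e => hne (by rw [e]))
    · by_contra hne
      rw [Finset.pair_comm] at hρ hne
      exact hρ (hp x fun e => hne (by rw [e]))
    · exact (hqv rfl).elim
    · by_contra hne
      exact hρ (hq y fun e => hne (by rw [e, Finset.pair_comm]))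
    · by_contra hne
      rw [Finset.pair_comm] at hρ
      exact hρ (hq x fun e => hne (by rw [e]))
  obtain ⟨ρ, hρ⟩ := Function.ne_iff.1 h0
  rw [hall ρ hρ] at hρ
  have hr : {v, p, q} ∈ ridgesAt 𝓕 t v := by
    by_contra hn
    exact hρ (hφ.eq_zero _ hn)
  obtain ⟨hc3, F, hF, hsF⟩ := mem_ridges.1 (mem_ridgesAt.1 hr).1
  obtain ⟨y, hy, he⟩ := Finset.exists_erase_of_card (h.card_eq F hF) hc3 hsF
  have hy' : y ∉ ({v, p, q} : Finset V) := by rw [he]; simp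
  simp only [Finset.mem_insert, Finset.mem_singleton, not_or] at hy'
  have := hφ.add_eq h.card_eq hpv.symm hqv.symm (Ne.symm hy'.1) ⟨F, hF, by
    simp only [Finset.insert_subset_iff, Finset.singleton_subset_iff] at hsF ⊢
    exact ⟨hsF.1, hsF.2.1, hsF.2.2, hy⟩⟩
  rw [hq y hy'.2.1, hp y hy'.2.2, add_zero] at this
  exact hρ this

end IsConedNormal

end UnfoldExistence

/-! ### The two sides of a missing tetrahedron and one-sidedness. -/

noncomputable section UnfoldData

variable {V : Type*}

/-- The indicator function of the pair `ab`. -/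
def pairIndicator (a b x : V) : ZMod 2 := if x = a ∨ x = b then 1 else 0

/-- The weight of `x` in `F` given by the side `s F` if `x` is one of `a`, `b`, and by the value of
`d` on the facets containing `tvx` otherwise. -/
def sideWeight (𝓕 : Finset (Finset V)) (t v a b : V) (d : Finset V → ZMod 2) (c : ZMod 2) (x : V) :
    ZMod 2 :=
  pairIndicator a b x * c + (1 + pairIndicator a b x) * valueOn 𝓕 d {t, v, x}

theorem sideWeight_of_mem {𝓕 : Finset (Finset V)} {t v a b x : V} {d : Finset V → ZMod 2}
    {c : ZMod 2} (hx : x = a ∨ x = b) : sideWeight 𝓕 t v a b d c x = c := by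
  rw [sideWeight, pairIndicator, if_pos hx, one_mul, CharTwo.add_self_eq_zero, zero_mul, add_zero]

theorem sideWeight_of_not_mem {𝓕 : Finset (Finset V)} {t v a b x : V} {d : Finset V → ZMod 2}
    {c : ZMod 2} (hx : ¬ (x = a ∨ x = b)) :
    sideWeight 𝓕 t v a b d c x = valueOn 𝓕 d {t, v, x} := by
  rw [sideWeight, pairIndicator, if_neg hx, zero_mul, zero_add, add_zero, one_mul]

theorem subset_insert_iff_of_card {t : V} {ρ ρ₀ : Finset V} (hρ : ρ.card = 3) (hρ₀ : ρ₀.card = 3)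
    (ht : t ∉ ρ) : ρ ⊆ insert t ρ₀ ↔ ρ = ρ₀ := by
  constructor
  · intro hs
    refine Finset.eq_of_subset_of_card_le (fun x hx => ?_) (by omega)
    exact (Finset.mem_insert.1 (hs hx)).resolve_left fun e => ht (e ▸ hx)
  · rintro rfl
    exact Finset.subset_insert _ _

theorem Finset.eq_three {ρ : Finset V} (hρ : ρ.card = 3) {x y z : V} (hx : x ∈ ρ) (hy : y ∈ ρ)
    (hz : z ∈ ρ) (hxy : x ≠ y) (hxz : x ≠ z) (hyz : y ≠ z) : ρ = {x, y, z} := by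
  symm
  refine Finset.eq_of_subset_of_card_le (by simp [Finset.insert_subset_iff, *]) ?_
  rw [hρ, Finset.card_three_of_ne hxy hxz hyz]

namespace IsConedNormal

variable {𝓕 : Finset (Finset V)} {t : V} (h : IsConedNormal 𝓕 t)
include h

/-- At a vertex with vanishing `bettiAt`, the boundary of a triangle at the vertex together with its
cone separates the star. -/
theorem exists_bd_eq_ite {x : V} (hxt : x ≠ t) (hb : bettiAt 𝓕 t x = 0) {ρ₀ : Finset V}
    (hρ₀ : ρ₀ ∈ ridgesAt 𝓕 t x) :
    ∃ c : Finset V → ZMod 2, ∀ ρ ∈ ridges 𝓕, x ∈ ρ →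
      bd 𝓕 c ρ = if ρ ⊆ insert t ρ₀ then 1 else 0 := by
  -- The boundary is prescribed only on triangles off `t`; on those through `t` it is forced by
  -- `bd_cone`.
  obtain ⟨c, hc⟩ := IsConedNormal.exists_bd_eq hb fun ρ => if ρ = ρ₀ then 1 else 0
  obtain ⟨hr₀, hx₀, ht₀⟩ := mem_ridgesAt.1 hρ₀
  have hc₀ := (mem_ridges.1 hr₀).1
  refine ⟨c, fun ρ hρ hx => ?_⟩
  have hc3 := (mem_ridges.1 hρ).1
  by_cases ht : t ∈ ρ
  · obtain ⟨p, hp⟩ : ∃ p, p ∈ (ρ.erase t).erase x := Finset.card_pos.1 (by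
      rw [Finset.card_erase_of_mem (Finset.mem_erase.2 ⟨hxt, hx⟩), Finset.card_erase_of_mem ht]
      omega)
    simp only [Finset.mem_erase] at hp
    have hρe := Finset.eq_three hc3 ht hx hp.2.2 hxt.symm (Ne.symm hp.2.1) (Ne.symm hp.1)
    rw [hρe, h.bd_cone (Ne.symm hp.1) hxt hp.2.1]
    have e1 : ∀ σ ∈ (ridges 𝓕).filter (fun ρ => {x, p} ⊆ ρ ∧ t ∉ ρ),
        bd 𝓕 c σ = if σ = ρ₀ then 1 else 0 := by
      intro σ hσ
      obtain ⟨h1, h2, h3⟩ := Finset.mem_filter.1 hσ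
      exact hc σ (mem_ridgesAt.2 ⟨h1, h2 (by simp), h3⟩)
    rw [Finset.sum_congr rfl e1, Finset.sum_ite_eq']
    congr 1
    rw [eq_iff_iff, Finset.mem_filter]
    constructor
    · rintro ⟨-, h1, -⟩
      exact Finset.insert_subset_insert _ h1
    · intro hs
      refine ⟨hr₀, ?_, ht₀⟩
      rw [Finset.insert_subset_iff, Finset.singleton_subset_iff]
      have := hs (show p ∈ _ by simp)
      exact ⟨hx₀, (Finset.mem_insert.1 this).resolve_left hp.2.1⟩
  · rw [hc ρ (mem_ridgesAt.2 ⟨hρ, hx, ht⟩)]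
    congr 1
    rw [eq_iff_iff, subset_insert_iff_of_card hc3 hc₀ ht]

/-- The circuits `tvb` and `tva` separate the stars of `a` and of `b`. On the common star of `ab`
the two separations differ by a constant, so after a shift they fit together. -/
theorem exists_side {v a b : V} (hta : t ≠ a) (htb : t ≠ b) (hr : {v, a, b} ∈ ridgesAt 𝓕 t v) (ha : bettiAt 𝓕 t a = 0)
    (hb : bettiAt 𝓕 t b = 0) :
    ∃ s : Finset V → ZMod 2, ∀ F ∈ 𝓕, ∀ G ∈ 𝓕, (F ∩ G).card = 3 → (a ∈ F ∩ G ∨ b ∈ F ∩ G) →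
      s F + s G = if F ∩ G ⊆ {t, v, a, b} then 1 else 0 := by
  obtain ⟨hr0, hv, ht⟩ := mem_ridgesAt.1 hr
  obtain ⟨c, hc⟩ := h.exists_bd_eq_ite hta.symm ha (mem_ridgesAt.2 ⟨hr0, by simp, ht⟩)
  obtain ⟨c', hc'⟩ := h.exists_bd_eq_ite htb.symm hb (mem_ridgesAt.2 ⟨hr0, by simp, ht⟩)
  have hconst := h.eq_of_bd_eq_zero (σ := {a, b}) Finset.card_le_two (c := c + c') (by
    intro ρ hρ hs
    rw [bd_add, hc ρ hρ (hs (by simp)), hc' ρ hρ (hs (by simp)), CharTwo.add_self_eq_zero])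
  obtain ⟨-, F₀, hF₀, hs₀⟩ := mem_ridges.1 hr0
  have key : ∀ F ∈ 𝓕, a ∈ F → b ∈ F → c F = c' F + (c F₀ + c' F₀) := by
    intro F hF h1 h2
    have := hconst F hF F₀ hF₀ (by simp [Finset.insert_subset_iff, h1, h2])
      ((Finset.subset_insert _ _).trans hs₀)
    simp only [Pi.add_apply] at this
    rw [← this]
    generalize c F = r
    generalize c' F = r'
    revert r r'
    decide
  refine ⟨fun F => if a ∈ F then c F else c' F + (c F₀ + c' F₀), ?_⟩
  intro F hF G hG hFG hm
  have hρ : F ∩ G ∈ ridges 𝓕 := mem_ridges.2 ⟨hFG, F, hF, Finset.inter_subset_left⟩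
  rcases hm with hm | hm
  · beta_reduce
    rw [← hc _ hρ hm, h.bd_inter c hF hG hFG, if_pos (Finset.mem_inter.1 hm).1,
      if_pos (Finset.mem_inter.1 hm).2]
  · beta_reduce
    rw [← hc' _ hρ hm, h.bd_inter c' hF hG hFG]
    have e1 : ∀ F ∈ 𝓕, b ∈ F → (if a ∈ F then c F else c' F + (c F₀ + c' F₀)) =
        c' F + (c F₀ + c' F₀) := by
      intro F hF hb
      split_ifs with ha
      · exact key F hF ha hb
      · rfl
    rw [e1 F hF (Finset.mem_inter.1 hm).1, e1 G hG (Finset.mem_inter.1 hm).2]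
    generalize c F₀ + c' F₀ = r
    generalize c' F = r'
    generalize c' G = r''
    revert r r' r''
    decide

/-- If `φ` generates the even functions at `v`, then a side cannot be extended over the star of
`tv` as a two-sided colouring. -/
theorem false_of_twoSided {v a b : V} (hvt : v ≠ t) (hva : v ≠ a) (hvb : v ≠ b) (hab : a ≠ b)
    (hta : t ≠ a) (htb : t ≠ b) (hb1 : bettiAt 𝓕 t v ≤ 1) {φ : Finset V → ZMod 2}
    (hφ : IsEvenAt 𝓕 t v φ) (hφab : φ {v, a, b} ≠ 0) (hτ : {t, v, a, b} ∉ 𝓕)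
    {s d : Finset V → ZMod 2}
    (side : ∀ F ∈ 𝓕, ∀ G ∈ 𝓕, (F ∩ G).card = 3 → (a ∈ F ∩ G ∨ b ∈ F ∩ G) →
      s F + s G = if F ∩ G ⊆ {t, v, a, b} then 1 else 0)
    (hd : ∀ F ∈ 𝓕, ∀ G ∈ 𝓕, t ∈ F ∩ G → v ∈ F ∩ G → (F ∩ G).card = 3 →
      d F + d G = if F ∩ G ⊆ {t, v, a, b} then 1 else 0)
    (hds : ∀ F ∈ 𝓕, t ∈ F → v ∈ F → (a ∈ F ∨ b ∈ F) → d F = s F) : False := by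
  let w : ZMod 2 → V → ZMod 2 := sideWeight 𝓕 t v a b d
  have hr : {v, a, b} ∈ ridgesAt 𝓕 t v := by
    by_contra hn
    exact hφab (hφ.eq_zero _ hn)
  have hτ3 : ∀ {ρ : Finset V}, ρ.card = 3 → t ∉ ρ → (ρ ⊆ {t, v, a, b} ↔ ρ = {v, a, b}) :=
    fun h1 h2 => subset_insert_iff_of_card h1 (Finset.card_three_of_ne hva hvb hab) h2
  have hw1 : ∀ {x c}, x = a ∨ x = b → w c x = c := fun hx => sideWeight_of_mem hx
  have hw0 : ∀ {x c}, ¬ (x = a ∨ x = b) → w c x = valueOn 𝓕 d {t, v, x} :=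
    fun hx => sideWeight_of_not_mem hx
  -- In a facet at `tv` all weights equal `d F`, in agreement with the vanishing of `θ` on triangles
  -- through `t`.
  have hwd : ∀ F ∈ 𝓕, t ∈ F → v ∈ F → ∀ x ∈ F, x ≠ t → x ≠ v → w (s F) x = d F := by
    intro F hF ht hv x hx hxt hxv
    by_cases hxab : x = a ∨ x = b
    · rw [hw1 hxab]
      exact (hds F hF ht hv (hxab.imp (fun e : x = a => e ▸ hx) fun e : x = b => e ▸ hx)).symm
    · rw [hw0 hxab]
      refine h.valueOn_eq (Finset.card_three_of_ne hvt.symm hxt.symm hxv.symm) ?_ hF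
        (by simp [Finset.insert_subset_iff, *])
      intro A hA B hB hAB
      have := hd A hA B hB (by rw [hAB]; simp) (by rw [hAB]; simp)
        (by rw [hAB, Finset.card_three_of_ne hvt.symm hxt.symm hxv.symm])
      rw [hAB, if_neg] at this
      · exact zmod_two_eq_of_add_eq_zero this
      · intro hs
        have := hs (show x ∈ _ by simp)
        simp only [Finset.mem_insert, Finset.mem_singleton] at this
        tauto
  -- the weights of the vertices of `ρ ∌ t` other than `v`, added up
  let θ : Finset V → ZMod 2 := fun ρ =>
    if ρ ∈ ridgesAt 𝓕 t v then ∑ p ∈ ρ.erase v, w (valueOn 𝓕 s ρ) p else 0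
  have hθ : ∀ F ∈ 𝓕, ∀ x ∈ F, ∀ y ∈ F, v ∈ F → v ≠ x → v ≠ y → x ≠ y → t ≠ x → t ≠ y →
      θ {v, x, y} = w (s F) x + w (s F) y := by
    intro F hF x hx y hy hv hvx hvy hxy htx hty
    have hc3 := Finset.card_three_of_ne hvx hvy hxy
    have hs : {v, x, y} ⊆ F := by simp [Finset.insert_subset_iff, *]
    have htρ : t ∉ ({v, x, y} : Finset V) := by simp [hvt.symm, htx, hty]
    have hm : {v, x, y} ∈ ridgesAt 𝓕 t v :=
      mem_ridgesAt.2 ⟨mem_ridges.2 ⟨hc3, F, hF, hs⟩, by simp, htρ⟩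
    simp only [θ, if_pos hm]
    rw [Finset.erase_insert (by simp [hvx, hvy]), Finset.sum_pair hxy]
    by_cases hxab : x = a ∨ x = b
    · by_cases hyab : y = a ∨ y = b
      · rw [hw1 hxab, hw1 hxab, hw1 hyab, hw1 hyab, CharTwo.add_self_eq_zero,
          CharTwo.add_self_eq_zero]
      rw [hw0 hyab, hw0 hyab, hw1 hxab, hw1 hxab, h.valueOn_eq hc3 _ hF hs]
      intro A hA B hB hAB
      have := side A hA B hB (by rw [hAB, hc3])
        (by rw [hAB]; rcases hxab with rfl | rfl <;> simp)
      rw [hAB, if_neg] at this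
      · exact zmod_two_eq_of_add_eq_zero this
      · rw [hτ3 hc3 htρ]
        intro e
        have hy : y ∈ ({v, a, b} : Finset V) := by rw [← e]; simp
        simp only [Finset.mem_insert, Finset.mem_singleton] at hy
        exact hy.elim (fun e => hvy e.symm) hyab
    · by_cases hyab : y = a ∨ y = b
      · rw [hw0 hxab, hw0 hxab, hw1 hyab, hw1 hyab, h.valueOn_eq hc3 _ hF hs]
        intro A hA B hB hAB
        have := side A hA B hB (by rw [hAB, hc3])
          (by rw [hAB]; rcases hyab with rfl | rfl <;> simp)
        rw [hAB, if_neg] at this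
        · exact zmod_two_eq_of_add_eq_zero this
        · rw [hτ3 hc3 htρ]
          intro e
          have hx : x ∈ ({v, a, b} : Finset V) := by rw [← e]; simp
          simp only [Finset.mem_insert, Finset.mem_singleton] at hx
          exact hx.elim (fun e => hvx e.symm) hxab
      · rw [hw0 hxab, hw0 hxab, hw0 hyab, hw0 hyab]
  have hθ0 : ∀ ρ, ρ ∉ ridgesAt 𝓕 t v → θ ρ = 0 := fun ρ hρ => if_neg hρ
  have hθt : ∀ ρ, t ∈ ρ → θ ρ = 0 := fun ρ hρ => hθ0 ρ fun hm => (mem_ridgesAt.1 hm).2.2 hρ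
  -- Locally `θ` is a sum of two vertex weights, so the terms cancel in pairs around each facet at
  -- `v`.
  have hθe : IsEvenAt 𝓕 t v θ := by
    refine isEvenAt_of_add_eq h.card_eq hθ0 ?_
    intro x y z hx hy hz hxy hxz hyz hF
    by_cases htx : t = x
    · subst htx
      rw [hθt _ (by simp), hθt {v, t, z} (by simp), hθ _ hF y (by simp) z (by simp) (by simp) hy hz
        hyz hxy hxz, hwd _ hF (by simp) (by simp) y (by simp) hxy.symm hy.symm,
        hwd _ hF (by simp) (by simp) z (by simp) hxz.symm hz.symm, CharTwo.add_self_eq_zero,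
        add_zero]
    by_cases hty : t = y
    · subst hty
      rw [hθt {v, x, t} (by simp), hθt {v, t, z} (by simp), hθ _ hF x (by simp) z (by simp)
        (by simp) hx hz hxz htx hyz, hwd _ hF (by simp) (by simp) x (by simp) hxy hx.symm,
        hwd _ hF (by simp) (by simp) z (by simp) hyz.symm hz.symm, CharTwo.add_self_eq_zero]
      exact (CharTwo.add_self_eq_zero _).symm
    by_cases htz : t = z
    · subst htz
      rw [hθt {v, y, t} (by simp), hθt {v, x, t} (by simp), hθ _ hF x (by simp) y (by simp)
        (by simp) hx hy hxy htx hty, hwd _ hF (by simp) (by simp) x (by simp) hxz hx.symm,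
        hwd _ hF (by simp) (by simp) y (by simp) hyz hy.symm, CharTwo.add_self_eq_zero,
        add_zero]
    rw [hθ _ hF x (by simp) y (by simp) (by simp) hx hy hxy htx hty,
      hθ _ hF y (by simp) z (by simp) (by simp) hy hz hyz hty htz,
      hθ _ hF x (by simp) z (by simp) (by simp) hx hz hxz htx htz]
    generalize w _ x = r
    generalize w _ y = r'
    generalize w _ z = r''
    revert r r' r''
    decide
  obtain ⟨-, F₀, hF₀, hs₀⟩ := mem_ridges.1 (mem_ridgesAt.1 hr).1
  have hθab : θ {v, a, b} = 0 := by
    rw [hθ F₀ hF₀ a (hs₀ (by simp)) b (hs₀ (by simp)) (hs₀ (by simp)) hva hvb hab hta htb,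
      hw1 (Or.inl rfl), hw1 (Or.inr rfl), CharTwo.add_self_eq_zero]
  -- The only possible nonzero even function is `φ`, and `θ` differs from it at `vab`.
  have hθz : θ = 0 := by
    refine (eq_zero_or_eq_of_bettiAt_le_one hb1 hφ hθe fun e => hφab (by rw [e]; rfl)).resolve_right
      fun e => hφab (by rw [← e]; exact hθab)
  -- the weights in a facet agree, and their common value is a colouring
  let c : Finset V → ZMod 2 := fun F =>
    if ∃ p, (p ∈ F ∧ p ≠ v ∧ p ≠ t) ∧ w (s F) p = 1 then 1 else 0
  have hcw : ∀ F ∈ 𝓕, v ∈ F → ∀ x ∈ F, x ≠ v → x ≠ t → c F = w (s F) x := by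
    intro F hF hv x hx hxv hxt
    refine ite_exists_eq (u := w (s F)) ⟨hx, hxv, hxt⟩ ?_
    rintro y ⟨hy, hyv, hyt⟩
    by_cases hxy : x = y
    · rw [hxy]
    have := hθ F hF x hx y hy hv hxv.symm hyv.symm hxy hxt.symm hyt.symm
    rw [hθz] at this
    exact (zmod_two_eq_of_add_eq_zero this.symm).symm
  have hbd : ∀ ρ ∈ ridgesAt 𝓕 t v, bd 𝓕 c ρ = if ρ = {v, a, b} then 1 else 0 := by
    intro ρ hρ
    obtain ⟨hρr, hvρ, htρ⟩ := mem_ridgesAt.1 hρ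
    obtain ⟨hc3, F, hF, hsF⟩ := mem_ridges.1 hρr
    obtain ⟨G, hG, -, hsG, rfl, -⟩ := h.exists_other hF hc3 hsF
    rw [h.bd_inter c hF hG hc3]
    have htp : ∀ p ∈ F ∩ G, p ≠ t := fun p hp e => htρ (e ▸ hp)
    have hcp : ∀ p ∈ F ∩ G, p ≠ v → c F + c G = w (s F) p + w (s G) p := by
      intro p hp hpv
      obtain ⟨h1, h2⟩ := Finset.mem_inter.1 hp
      rw [hcw F hF (hsF hvρ) p h1 hpv (htp p hp), hcw G hG (hsG hvρ) p h2 hpv (htp p hp)]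
    have ite_eq : (if F ∩ G ⊆ {t, v, a, b} then (1 : ZMod 2) else 0) =
        if F ∩ G = {v, a, b} then 1 else 0 := by simp only [hτ3 hc3 htρ]
    by_cases ha : a ∈ F ∩ G
    · rw [hcp a ha hva.symm, hw1 (Or.inl rfl), hw1 (Or.inl rfl), ← ite_eq]
      exact side F hF G hG hc3 (Or.inl ha)
    by_cases hb : b ∈ F ∩ G
    · rw [hcp b hb hvb.symm, hw1 (Or.inr rfl), hw1 (Or.inr rfl), ← ite_eq]
      exact side F hF G hG hc3 (Or.inr hb)
    rw [if_neg fun e => ha (by rw [e]; simp)]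
    obtain ⟨x, y, hx, -, -, he⟩ := Finset.exists_eq_of_card_three hc3 hvρ
    have hxm : x ∈ F ∩ G := by rw [he]; simp
    have hxab : ¬ (x = a ∨ x = b) := by
      rintro (rfl | rfl)
      · exact ha hxm
      · exact hb hxm
    rw [hcp x hxm hx.symm, hw0 hxab, hw0 hxab, CharTwo.add_self_eq_zero]
  -- Off `t`, the boundary of `c` is exactly `vab`. Orthogonality to `φ` then reads `φ {v, a, b} =
  -- 0`.
  have hsum := sum_mul_bd_eq_zero hφ c
  rw [Finset.sum_congr rfl fun ρ hρ => by rw [hbd ρ hρ]] at hsum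
  simp only [mul_ite, mul_one, mul_zero] at hsum
  rw [Finset.sum_ite_eq', if_pos hr] at hsum
  exact hφab hsum

/-- Any triangle `vab` in the support of `φ`, with `bettiAt` zero at `a` and `b`, yields a missing
tetrahedron that can be unfolded. -/
theorem unfoldData_of_isEvenAt {v a b : V} (hvt : v ≠ t) (hva : v ≠ a) (hvb : v ≠ b) (hab : a ≠ b)
    (hb1 : bettiAt 𝓕 t v ≤ 1) {φ : Finset V → ZMod 2}
    (hφ : IsEvenAt 𝓕 t v φ) (hφab : φ {v, a, b} ≠ 0) (ha : bettiAt 𝓕 t a = 0)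
    (hb : bettiAt 𝓕 t b = 0) : ∃ s, UnfoldData 𝓕 t v a b s := by
  have hr : {v, a, b} ∈ ridgesAt 𝓕 t v := by
    by_contra hn
    exact hφab (hφ.eq_zero _ hn)
  obtain ⟨hr0, -, htρ⟩ := mem_ridgesAt.1 hr
  have hta : t ≠ a := fun e => htρ (e ▸ by simp)
  have htb : t ≠ b := fun e => htρ (e ▸ by simp)
  obtain ⟨hc3, F₀, hF₀, hs₀⟩ := mem_ridges.1 hr0
  -- In a facet `tvab` the cocycle rule and the vanishing of `φ` on triangles through `t` would
  -- force `φ {v, a, b} = 0`.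
  have hτ : {t, v, a, b} ∉ 𝓕 := by
    intro hm
    have := hφ.add_eq h.card_eq hvt hva hvb ⟨_, hm, by rw [Finset.insert_comm]⟩
    rw [hφ.eq_zero_of_mem (ρ := {v, t, a}) (by simp), hφ.eq_zero_of_mem (ρ := {v, t, b}) (by simp),
      zero_add] at this
    exact hφab this
  obtain ⟨s, side⟩ := h.exists_side hta htb hr ha hb
  refine ⟨s, h, hvt.symm, hta, htb, hva, hvb, hab, hτ, ?_, side, fun d hd hds =>
    h.false_of_twoSided hvt hva hvb hab hta htb hb1 hφ hφab hτ side hd hds⟩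
  intro ρ hs hρ
  by_cases ht : t ∈ ρ
  · have h2 : (ρ.erase t).card = 2 := by rw [Finset.card_erase_of_mem ht]; omega
    obtain ⟨x, y, -, hxy⟩ := Finset.card_eq_two.1 h2
    have hm : ∀ z ∈ ρ.erase t, z ∈ F₀ := by
      intro z hz
      rw [Finset.mem_erase] at hz
      exact hs₀ ((Finset.mem_insert.1 (hs hz.2)).resolve_left hz.1)
    obtain ⟨G, hG, hsG⟩ := h.cone F₀ hF₀ x (hm x (by rw [hxy]; simp)) y (hm y (by rw [hxy]; simp))
    refine ⟨G, hG, ?_⟩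
    rw [← Finset.insert_erase ht, hxy]
    exact hsG
  · rw [(subset_insert_iff_of_card hρ hc3 ht).1 hs]
    exact ⟨F₀, hF₀, hs₀⟩

theorem exists_unfoldData {v p q : V} (hvt : v ≠ t) (hb1 : bettiAt 𝓕 t v = 1)
    (hpv : p ≠ v) (hqv : q ≠ v) (hqt : q ≠ t) (hpt : p ≠ t) (hpq : p ≠ q)
    (hb : ∀ x, (∃ F ∈ 𝓕, x ∈ F) → x ≠ t → x ≠ v → x ≠ p → x ≠ q → bettiAt 𝓕 t x = 0) :
    ∃ a b s, UnfoldData 𝓕 t v a b s ∧ bettiAt 𝓕 t a = 0 ∧ bettiAt 𝓕 t b = 0 ∧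
      a ≠ p ∧ a ≠ q ∧ b ≠ p ∧ b ≠ q := by
  obtain ⟨φ, hφ, h0⟩ := exists_isEvenAt_of_bettiAt_ne_zero (hb1.trans_ne one_ne_zero)
  obtain ⟨a, b, hva, hvb, hab, hap, haq, hbp, hbq, hφab⟩ :=
    h.exists_support hφ h0 hpv hqv hqt hpt hpq
  have hr : {v, a, b} ∈ ridgesAt 𝓕 t v := by
    by_contra hn
    exact hφab (hφ.eq_zero _ hn)
  obtain ⟨hr0, -, htρ⟩ := mem_ridgesAt.1 hr
  obtain ⟨-, F₀, hF₀, hs₀⟩ := mem_ridges.1 hr0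
  have ha := hb a ⟨F₀, hF₀, hs₀ (by simp)⟩ (fun e => htρ (e ▸ by simp)) hva.symm hap haq
  have hb := hb b ⟨F₀, hF₀, hs₀ (by simp)⟩ (fun e => htρ (e ▸ by simp)) hvb.symm hbp hbq
  obtain ⟨s, hs⟩ := h.unfoldData_of_isEvenAt hvt hva hvb hab hb1.le hφ hφab ha hb
  exact ⟨a, b, s, hs, ha, hb, hap, haq, hbp, hbq⟩

/-- Unfolding at `v`: every vertex of the resulting complex other than the copies of `t` and of the
vertices with nonvanishing `bettiAt` has a sphere as its link. -/
theorem exists_unfolding [Fintype V] {v p q : V} (hvt : v ≠ t) (hb1 : bettiAt 𝓕 t v = 1)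
    (hpv : p ≠ v) (hqv : q ≠ v) (hqt : q ≠ t) (hpt : p ≠ t) (hpq : p ≠ q)
    (hb : ∀ x, (∃ F ∈ 𝓕, x ∈ F) → x ≠ t → x ≠ v → x ≠ p → x ≠ q → bettiAt 𝓕 t x = 0) :
    ∃ (n : ℕ) (𝓖 : Finset (Finset (Fin n))) (j : V → Fin n), Function.Injective j ∧
      IsConedNormal 𝓖 (j t) ∧ (ofFacets 𝓖).IsEdgeFolding (ofFacets 𝓕) ∧
      (∀ y, (∃ F ∈ 𝓕, y ∈ F) → (∃ G ∈ 𝓖, j y ∈ G)) ∧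
      (∀ y, (∃ F ∈ 𝓕, y ∈ F) → (y = p ∨ y = q) → bettiAt 𝓖 (j t) (j y) = bettiAt 𝓕 t y) ∧
      ∀ z, (∃ G ∈ 𝓖, z ∈ G) → z ≠ j t → (bettiAt 𝓖 (j t) z = 0 ∨
        ∃ y, (∃ F ∈ 𝓕, y ∈ F) ∧ (y = p ∨ y = q) ∧ z = j y) := by
  obtain ⟨a, b, s, hs, ha, hb0, hap, haq, hbp, hbq⟩ := h.exists_unfoldData hvt hb1 hpv hqv hqt hpt
    hpq hb
  let e := Fintype.equivFin (V × ZMod 2)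
  have hpqτ : ∀ y, y = p ∨ y = q → y ∉ ({t, v, a, b} : Finset V) := by
    rintro y (rfl | rfl) <;> simp [*, Ne.symm]
  refine ⟨_, unfoldFacets 𝓕 t v a b s e, fun x => e (x, 0), ?_, hs.isConedNormal_unfold e,
    hs.isEdgeFolding_unfold e, ?_, ?_, ?_⟩
  · intro x y hxy
    simpa using hxy
  · intro y hy
    by_cases hyab : y = a ∨ y = b
    · refine ⟨_, UnfoldData.mem_cap e 0, mem_decorate.2 ⟨?_, by rw [if_pos hyab]⟩⟩
      rcases hyab with rfl | rfl <;> simp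
    · exact (hs.exists_mem_unfold e hyab).2 hy
  · intro y hy hypq
    exact hs.bettiAt_unfold e (hpqτ y hypq) hy
  · intro z hz hzt
    obtain ⟨⟨y, γ⟩, rfl⟩ := e.surjective z
    beta_reduce
    by_cases hyab : y = a ∨ y = b
    · have h1 := hs.bettiAt_unfold_add e hyab
      have h2 : bettiAt 𝓕 t y = 0 := by rcases hyab with rfl | rfl <;> assumption
      left
      rcases zmod_two_eq_zero_or_one γ with rfl | rfl <;> omega
    · have hγ : γ = 0 := by
        have := UnfoldData.vertex_unfold e hz
        tauto
      subst hγ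
      have hyt : y ≠ t := fun e => hzt (by rw [e])
      by_cases hyv : y = v
      · subst hyv
        have := hs.bettiAt_unfold_edge e
        left; omega
      have hy := (hs.exists_mem_unfold e hyab).1 hz
      by_cases hypq : y = p ∨ y = q
      · exact Or.inr ⟨y, hy, hypq, rfl⟩
      · left
        rw [hs.bettiAt_unfold e (by simp only [Finset.mem_insert, Finset.mem_singleton]; tauto) hy]
        exact hb y hy hyt hyv (by tauto) (by tauto)

end IsConedNormal

end UnfoldData

/-! ### Translation between normal pseudomanifolds and coned facet sets. -/

noncomputable section Conversion

variable {V : Type*}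

/-- If the link of `σ` is connected and `c` is constant on the star of every face `σ ∪ {u}`, then
`c` is constant on the star of `σ`. -/
theorem eq_of_isConn_link {𝓕 : Finset (Finset V)} (hc : ∀ F ∈ 𝓕, F.card = 4) {σ : Finset V}
    (hσ : σ.card ≤ 3) (h : ((ofFacets 𝓕).link σ).IsConn) {c : Finset V → ZMod 2}
    (hu : ∀ u, u ∉ σ → ∀ A ∈ 𝓕, ∀ B ∈ 𝓕, σ ⊆ A → u ∈ A → σ ⊆ B → u ∈ B → c A = c B) :
    ∀ A ∈ 𝓕, ∀ B ∈ 𝓕, σ ⊆ A → σ ⊆ B → c A = c B := by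
  have key : ∀ (u w : V), ((ofFacets 𝓕).link σ).graph.Walk u w → u ∉ σ → ∀ A ∈ 𝓕, ∀ B ∈ 𝓕,
      σ ⊆ A → u ∈ A → σ ⊆ B → w ∈ B → c A = c B := by
    intro u w p
    induction p with
    | nil => exact hu _
    | cons hadj p ih =>
      intro hun A hA B hB hsA huA hsB hwB
      obtain ⟨-, hd, H, hH, hs⟩ := mem_link_ofFacets.1 hadj.2
      rw [Finset.union_subset_iff, Finset.insert_subset_iff, Finset.singleton_subset_iff] at hs
      rw [Finset.disjoint_right] at hd
      rw [hu _ hun A hA H hH hsA huA hs.1 hs.2.1]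
      exact ih (hd (by simp)) H hH B hB hs.1 hs.2.2 hsB hwB
  have hex : ∀ A ∈ 𝓕, ∃ u ∈ A, u ∉ σ := fun A hA =>
    Finset.exists_mem_notMem_of_card_lt_card (by rw [hc A hA]; omega)
  have hv : ∀ A ∈ 𝓕, σ ⊆ A → ∀ u ∈ A, u ∉ σ → {u} ∈ (ofFacets 𝓕).link σ := fun A hA hs u hu hun =>
    mem_link_ofFacets.2 ⟨by simp, by simpa using hun, A, hA, Finset.union_subset hs (by simpa)⟩
  intro A hA B hB hsA hsB
  obtain ⟨u, huA, hun⟩ := hex A hA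
  obtain ⟨w, hwB, hwn⟩ := hex B hB
  obtain ⟨p⟩ := h.2 u w (hv A hA hsA u huA hun) (hv B hB hsB w hwB hwn)
  exact key u w p hun A hA B hB hsA huA hsB hwB

namespace PreAbstractSimplicialComplex

theorem exists_isFacet [Fintype V] (K : PreAbstractSimplicialComplex V) {σ : Finset V}
    (hσ : σ ∈ K) : ∃ F, K.IsFacet F ∧ σ ⊆ F := by
  obtain ⟨F, hs, hF⟩ := (Set.toFinite K.faces).exists_le_maximal hσ
  exact ⟨F, ⟨hF.1, fun τ hτ hsub => Finset.Subset.antisymm (hF.2 hτ hsub) hsub⟩, hs⟩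

theorem eq_ofFacets [Fintype V] (K : PreAbstractSimplicialComplex V) :
    K = ofFacets (Finset.univ.filter fun F => K.IsFacet F) := by
  ext σ
  change σ ∈ K ↔ σ ∈ ofFacets _
  simp only [mem_ofFacets, Finset.mem_filter, Finset.mem_univ, true_and]
  constructor
  · intro hσ
    exact ⟨nonempty_of_mem hσ, K.exists_isFacet hσ⟩
  · rintro ⟨hn, F, hF, hs⟩
    exact mem_of_subset hF.1 hs hn

/-- A colouring that is locally constant is constant on stars of triangles, then on stars of edges
by connectedness of their links, then on the star of `t`. Coning supplies the rest. -/
theorem IsNormalPseudomanifold.isConedNormal [Fintype V] {K : PreAbstractSimplicialComplex V}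
    (h : K.IsNormalPseudomanifold 3) {t : V} (ht : {t} ∈ K)
    (hgraph : K.graphFaces = (K.star {t}).graphFaces) :
    IsConedNormal (Finset.univ.filter fun F => K.IsFacet F) t := by
  set 𝓕 := Finset.univ.filter fun F => K.IsFacet F with h𝓕
  have hmem : ∀ {F}, F ∈ 𝓕 ↔ K.IsFacet F := by simp [h𝓕]
  have hK : K = ofFacets 𝓕 := K.eq_ofFacets
  have hc : ∀ F ∈ 𝓕, F.card = 4 := fun F hF => h.pure F (hmem.1 hF)
  have cone : ∀ F ∈ 𝓕, ∀ x ∈ F, ∀ y ∈ F, ∃ G ∈ 𝓕, {t, x, y} ⊆ G := by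
    intro F hF x hx y hy
    have h1 : {x, y} ∈ K.graphFaces :=
      ⟨mem_of_subset (hmem.1 hF).1 (by simp [Finset.insert_subset_iff, hx, hy]) (by simp),
        Finset.card_le_two⟩
    rw [hgraph] at h1
    obtain ⟨G, hG, hs⟩ := K.exists_isFacet h1.1.2
    exact ⟨G, hmem.2 hG, hs⟩
  have htwo : ∀ ρ : Finset V, ρ.card = 3 → (∃ F ∈ 𝓕, ρ ⊆ F) → (𝓕.filter (ρ ⊆ ·)).card = 2 := by
    rintro ρ hρ ⟨F, hF, hs⟩
    rw [← h.two_facets ρ (mem_of_subset (hmem.1 hF).1 hs (Finset.card_pos.1 (by omega))) hρ,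
      ← Set.ncard_coe_finset]
    congr 1
    ext G
    simp [hmem]
  have htri : ∀ c : Finset V → ZMod 2, ∀ ρ : Finset V, ρ.card = 3 →
      (∀ F ∈ 𝓕, ∀ G ∈ 𝓕, ρ ⊆ F → ρ ⊆ G → (F ∩ G).card = 3 → c F = c G) →
      ∀ F ∈ 𝓕, ∀ G ∈ 𝓕, ρ ⊆ F → ρ ⊆ G → c F = c G := by
    intro c ρ hρ hloc F hF G hG h1 h2
    by_cases hFG : F = G
    · rw [hFG]
    · exact hloc F hF G hG h1 h2
        (by rw [Finset.eq_inter_of_card_three (hc F hF) (hc G hG) hFG hρ h1 h2, hρ])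
  have hedge : ∀ σ : Finset V, σ.card = 2 → ∀ c : Finset V → ZMod 2,
      (∀ F ∈ 𝓕, ∀ G ∈ 𝓕, σ ⊆ F → σ ⊆ G → (F ∩ G).card = 3 → c F = c G) →
      ∀ F ∈ 𝓕, ∀ G ∈ 𝓕, σ ⊆ F → σ ⊆ G → c F = c G := by
    intro σ hσ c hloc F hF G hG h1 h2
    have hσK : σ ∈ K := mem_of_subset (hmem.1 hF).1 h1 (Finset.card_pos.1 (by omega))
    have hconn := h.link_connected σ hσK (by omega)
    rw [hK] at hconn
    refine eq_of_isConn_link hc (by omega) hconn ?_ F hF G hG h1 h2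
    intro u hu A hA B hB hA1 hA2 hB1 hB2
    refine htri c (insert u σ) (by rw [Finset.card_insert_of_notMem hu, hσ]) ?_ A hA B hB
      (Finset.insert_subset hA2 hA1) (Finset.insert_subset hB2 hB1)
    intro C hC D hD h3 h4 h5
    exact hloc C hC D hD ((Finset.subset_insert _ _).trans h3)
      ((Finset.subset_insert _ _).trans h4) h5
  refine ⟨?_, hc, htwo, conn_of_conn_edges hc cone hedge ?_, cone⟩
  · obtain ⟨F, hF, -⟩ := K.exists_isFacet ht
    exact ⟨F, hmem.2 hF⟩
  · intro c hloc F hF G hG h1 h2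
    have hconn := h.link_connected {t} ht (by simp)
    rw [hK] at hconn
    refine eq_of_isConn_link hc (by simp) hconn ?_ F hF G hG (by simpa) (by simpa)
    intro u hu A hA B hB hA1 hA2 hB1 hB2
    refine hedge {u, t} (Finset.card_pair (by simpa using hu)) c ?_ A hA B hB
      (Finset.insert_subset hA2 hA1) (Finset.insert_subset hB2 hB1)
    intro C hC D hD h3 h4 h5
    exact hloc C hC D hD (h3 (by simp)) (h4 (by simp)) h5

end PreAbstractSimplicialComplex

namespace IsConedNormal

variable {𝓕 : Finset (Finset V)} {t : V} (h : IsConedNormal 𝓕 t)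
include h

theorem isConn_link {σ : Finset V} (hσ : σ ∈ ofFacets 𝓕) (hc : σ.card ≤ 2) :
    ((ofFacets 𝓕).link σ).IsConn := by
  obtain ⟨-, F, hF, hs⟩ := mem_ofFacets.1 hσ
  have hv : ∀ {A}, A ∈ 𝓕 → σ ⊆ A → ∀ {u}, u ∈ A → u ∉ σ → {u} ∈ (ofFacets 𝓕).link σ :=
    fun hA hs u hu hun =>
    mem_link_ofFacets.2 ⟨by simp, by simpa using hun, _, hA, Finset.union_subset hs (by simpa)⟩
  obtain ⟨u, huF, hu⟩ := Finset.exists_mem_notMem_of_card_lt_card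
    (show σ.card < F.card by rw [h.card_eq F hF]; omega)
  refine ⟨⟨u, hv hF hs huF hu⟩, ?_⟩
  intro a b ha hb
  obtain ⟨-, had, A, hA, hsA⟩ := mem_link_ofFacets.1 ha
  obtain ⟨-, hbd, B, hB, hsB⟩ := mem_link_ofFacets.1 hb
  rw [Finset.disjoint_singleton_right] at had hbd
  rw [Finset.union_subset_iff, Finset.singleton_subset_iff] at hsA hsB
  have hadj : ∀ F ∈ 𝓕, σ ⊆ F → ∀ x ∈ F, ∀ y ∈ F, x ∉ σ → y ∉ σ →
      ((ofFacets 𝓕).link σ).graph.Reachable x y := by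
    intro F hF hs x hx y hy hxs hys
    by_cases hxy : x = y
    · rw [hxy]
    · refine SimpleGraph.Adj.reachable ⟨hxy, mem_link_ofFacets.2 ⟨by simp, by simp [hxs, hys], F, hF,
        Finset.union_subset hs (by simp [Finset.insert_subset_iff, hx, hy])⟩⟩
  -- Colouring a facet by whether its vertices outside `σ` can be reached from `a` turns
  -- connectedness of stars into that of links.
  let c : Finset V → ZMod 2 := fun F =>
    if ∃ x ∈ F, x ∉ σ ∧ ((ofFacets 𝓕).link σ).graph.Reachable a x then 1 else 0
  have hc1 : ∀ F ∈ 𝓕, σ ⊆ F → ∀ x ∈ F, x ∉ σ →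
      c F = if ((ofFacets 𝓕).link σ).graph.Reachable a x then 1 else 0 := by
    intro F hF hs x hx hxs
    simp only [c]
    congr 1
    rw [eq_iff_iff]
    constructor
    · rintro ⟨y, hy, hys, hr⟩
      exact hr.trans (hadj F hF hs y hy x hx hys hxs)
    · intro hr
      exact ⟨x, hx, hxs, hr⟩
  have hconst := h.conn σ hc c (by
    intro F hF G hG h1 h2 h3
    obtain ⟨x, hx, hxs⟩ := Finset.exists_mem_notMem_of_card_lt_card
      (show σ.card < (F ∩ G).card by omega)
    rw [Finset.mem_inter] at hx
    rw [hc1 F hF h1 x hx.1 hxs, hc1 G hG h2 x hx.2 hxs]) A hA B hB hsA.1 hsB.1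
  rw [hc1 A hA hsA.1 a hsA.2 had, hc1 B hB hsB.1 b hsB.2 hbd, if_pos (SimpleGraph.Reachable.refl _)]
    at hconst
  by_contra hn
  rw [if_neg hn] at hconst
  exact one_ne_zero hconst

theorem isNormalPseudomanifold : (ofFacets 𝓕).IsNormalPseudomanifold 3 where
  nonempty := by
    obtain ⟨F, hF⟩ := h.nonempty
    exact ⟨F, ((isFacet_ofFacets h.card_eq).2 hF).1⟩
  pure F hF := h.card_eq F ((isFacet_ofFacets h.card_eq).1 hF)
  two_facets ρ hρ hc := by
    rw [← h.two_facets ρ hc (mem_ofFacets.1 hρ).2, ← Set.ncard_coe_finset]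
    congr 1
    ext F
    simp [isFacet_ofFacets h.card_eq]
  strongly_connected F G hF hG := by
    set R := fun α β => (ofFacets 𝓕).IsFacet α ∧ (ofFacets 𝓕).IsFacet β ∧ (α ∩ β).card = 3
    -- Reachability from `F` is a colouring that is constant across adjacent facets.
    let c : Finset V → ZMod 2 := fun A => if Relation.ReflTransGen R F A then 1 else 0
    have hconst := h.conn ∅ (by simp) c (by
      intro A hA B hB _ _ hAB
      have h1 : R A B :=
        ⟨(isFacet_ofFacets h.card_eq).2 hA, (isFacet_ofFacets h.card_eq).2 hB, hAB⟩
      have h2 : R B A := ⟨h1.2.1, h1.1, by rw [Finset.inter_comm]; exact hAB⟩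
      simp only [c]
      congr 1
      rw [eq_iff_iff]
      exact ⟨fun h => h.tail h1, fun h => h.tail h2⟩)
      F ((isFacet_ofFacets h.card_eq).1 hF) G ((isFacet_ofFacets h.card_eq).1 hG) (by simp)
      (by simp)
    simp only [c] at hconst
    rw [if_pos Relation.ReflTransGen.refl] at hconst
    by_contra hn
    rw [if_neg hn] at hconst
    exact one_ne_zero hconst
  link_connected σ hσ hc := h.isConn_link hσ (by omega)

theorem mem_link_t {τ : Finset V} (hτ : τ.card ≤ 2) :
    τ ∈ (ofFacets 𝓕).link {t} ↔ τ ∈ ofFacets 𝓕 ∧ t ∉ τ := by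
  rw [mem_link_ofFacets, Finset.disjoint_singleton_left, mem_ofFacets]
  constructor
  · rintro ⟨hn, ht, F, hF, hs⟩
    exact ⟨⟨hn, F, hF, Finset.subset_union_right.trans hs⟩, ht⟩
  · rintro ⟨⟨hn, F, hF, hs⟩, ht⟩
    refine ⟨hn, ht, ?_⟩
    have hc : τ.card = 1 ∨ τ.card = 2 := by have := Finset.card_pos.2 hn; omega
    rcases hc with hc | hc
    · obtain ⟨x, rfl⟩ := Finset.card_eq_one.1 hc
      obtain ⟨G, hG, hsG⟩ := h.cone F hF x (hs (by simp)) x (hs (by simp))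
      exact ⟨G, hG, by simpa [Finset.insert_subset_iff] using hsG⟩
    · obtain ⟨x, y, -, rfl⟩ := Finset.card_eq_two.1 hc
      obtain ⟨G, hG, hsG⟩ := h.cone F hF x (hs (by simp)) y (hs (by simp))
      exact ⟨G, hG, hsG⟩

theorem exists_t_mem : ∃ F ∈ 𝓕, t ∈ F := by
  obtain ⟨F, hF⟩ := h.nonempty
  obtain ⟨x, hx⟩ := Finset.card_pos.1 (show 0 < F.card by rw [h.card_eq F hF]; omega)
  obtain ⟨G, hG, hs⟩ := h.cone F hF x hx x hx
  exact ⟨G, hG, hs (by simp)⟩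

theorem fNum_zero [Finite V] : (ofFacets 𝓕).fNum 0 = ((ofFacets 𝓕).link {t}).fNum 0 + 1 := by
  rw [PreAbstractSimplicialComplex.fNum, PreAbstractSimplicialComplex.fNum, ← Set.ncard_insert_of_notMem (a := {t})]
  · congr 1
    ext τ
    simp only [Set.mem_insert_iff, Set.mem_ofPred_eq, zero_add]
    constructor
    · rintro ⟨h1, h2⟩
      obtain ⟨x, rfl⟩ := Finset.card_eq_one.1 h2
      by_cases hx : x = t
      · exact Or.inl (by rw [hx])
      · exact Or.inr ⟨(h.mem_link_t (by simp)).2 ⟨h1, by simpa using Ne.symm hx⟩, h2⟩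
    · rintro (rfl | ⟨h1, h2⟩)
      · obtain ⟨F, hF, ht⟩ := h.exists_t_mem
        exact ⟨mem_ofFacets.2 ⟨by simp, F, hF, by simpa using ht⟩, by simp⟩
      · exact ⟨((h.mem_link_t (by omega)).1 h1).1, h2⟩
  · rintro ⟨h1, -⟩
    exact ((h.mem_link_t (by simp)).1 h1).2 (by simp)

/-- The graph is the cone with apex `t` over the graph of the link of `t`: edges avoiding `t` lie in
that link, and edges at `t` correspond to its vertices. -/
theorem fNum_one [Finite V] : (ofFacets 𝓕).fNum 1 =
    ((ofFacets 𝓕).link {t}).fNum 1 + ((ofFacets 𝓕).link {t}).fNum 0 := by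
  rw [PreAbstractSimplicialComplex.fNum, PreAbstractSimplicialComplex.fNum,
    PreAbstractSimplicialComplex.fNum, ← Set.InjOn.ncard_image (f := insert t)
    (s := {σ | σ ∈ (ofFacets 𝓕).link {t} ∧ σ.card = 0 + 1}), ← Set.ncard_union_eq]
  · congr 1
    ext τ
    simp only [Set.mem_union, Set.mem_image, Set.mem_ofPred_eq, zero_add, one_add_one_eq_two]
    constructor
    · rintro ⟨h1, h2⟩
      by_cases ht : t ∈ τ
      · have hc : (τ.erase t).card = 1 := by rw [Finset.card_erase_of_mem ht]; omega
        refine Or.inr ⟨τ.erase t, ⟨(h.mem_link_t (by omega)).2 ⟨?_, by simp⟩, hc⟩,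
          Finset.insert_erase ht⟩
        exact PreAbstractSimplicialComplex.mem_of_subset h1 (Finset.erase_subset _ _)
          (Finset.card_pos.1 (by omega))
      · exact Or.inl ⟨(h.mem_link_t (by omega)).2 ⟨h1, ht⟩, h2⟩
    · rintro (⟨h1, h2⟩ | ⟨σ, ⟨h1, h2⟩, rfl⟩)
      · exact ⟨((h.mem_link_t (by omega)).1 h1).1, h2⟩
      · obtain ⟨hn, hd, F, hF, hs⟩ := mem_link_ofFacets.1 h1
        rw [Finset.disjoint_singleton_left] at hd
        exact ⟨mem_ofFacets.2 ⟨by simp, F, hF, hs⟩, by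
          rw [Finset.card_insert_of_notMem hd, h2]; rfl⟩
  · rw [Set.disjoint_left]
    rintro _ ⟨h1, h2⟩ ⟨σ, -, rfl⟩
    exact ((h.mem_link_t (by omega)).1 h1).2 (by simp)
  · rintro σ ⟨h1, h2⟩ τ ⟨h3, h4⟩ he
    have d1 := ((h.mem_link_t (by omega)).1 h1).2
    have d2 := ((h.mem_link_t (by omega)).1 h3).2
    rw [← Finset.erase_insert d1, ← Finset.erase_insert d2]
    exact congrArg (Finset.erase · t) he

/-- For the link of `t` with `f₀` vertices and `f₁` edges, coning gives `(f₁ + f₀) - 4 (f₀ + 1) + 10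
= f₁ - 3 f₀ + 6`. -/
theorem isG₂MinimalNormal3 [Finite V] : (ofFacets 𝓕).IsG₂MinimalNormal3 := by
  refine ⟨h.isNormalPseudomanifold, t, ?_, ?_⟩
  · obtain ⟨F, hF, ht⟩ := h.exists_t_mem
    exact mem_ofFacets.2 ⟨by simp, F, hF, by simpa using ht⟩
  · rw [PreAbstractSimplicialComplex.g₂, PreAbstractSimplicialComplex.g₂, h.fNum_zero, h.fNum_one]
    have e1 : (3 + 2 : ℕ).choose 2 = 10 := by decide
    have e2 : (2 + 2 : ℕ).choose 2 = 6 := by decide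
    rw [e1, e2]
    push_cast
    ring

/-- One direction is the recognition of spheres by ear removal, the other the vanishing of cocycles
on spheres. -/
theorem isSingular_iff [Fintype V] {x : V} (hxt : x ≠ t) :
    (ofFacets 𝓕).IsSingular x ↔ (∃ F ∈ 𝓕, x ∈ F) ∧ bettiAt 𝓕 t x ≠ 0 := by
  have hm : {x} ∈ ofFacets 𝓕 ↔ ∃ F ∈ 𝓕, x ∈ F := by
    simp [mem_ofFacets]
  rw [PreAbstractSimplicialComplex.IsSingular, hm]
  refine and_congr_right fun hx => ?_
  constructor
  · intro hemp hb
    have := h.outerCount_add_two hxt hx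
    obtain ⟨e⟩ := h.nonempty_link_homeomorph_sphere hxt (by omega)
    exact hemp.false e
  · intro hb
    exact ⟨fun e => hb (h.bettiAt_eq_zero_of_homeomorph hxt e)⟩

theorem isSingular_t [Fintype V] {x : V} (hxt : x ≠ t) (hx : ∃ F ∈ 𝓕, x ∈ F)
    (hb : bettiAt 𝓕 t x ≠ 0) : (ofFacets 𝓕).IsSingular t := by
  obtain ⟨F, hF, ht⟩ := h.exists_t_mem
  exact ⟨mem_ofFacets.2 ⟨by simp, F, hF, by simpa using ht⟩,
    ⟨fun e => hb (h.bettiAt_eq_zero_of_link_sphere hxt hx e)⟩⟩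

/-- If exactly one further vertex besides `t` and `v` is singular, then unfolding at `v` leaves two
singular vertices. -/
theorem exists_unfolding_two_singular [Fintype V] {v w : V} (hvt : v ≠ t) (hwt : w ≠ t)
    (hwv : w ≠ v) (hb1 : bettiAt 𝓕 t v = 1) (hw : ∃ F ∈ 𝓕, w ∈ F) (hbw : bettiAt 𝓕 t w ≠ 0)
    (hb : ∀ x, (∃ F ∈ 𝓕, x ∈ F) → x ≠ t → x ≠ v → x ≠ w → bettiAt 𝓕 t x = 0) :
    ∃ (n : ℕ) (Δ' : PreAbstractSimplicialComplex (Fin n)), Δ'.IsG₂MinimalNormal3 ∧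
      {v | Δ'.IsSingular v}.ncard = 2 ∧ Δ'.IsEdgeFolding (ofFacets 𝓕) := by
  obtain ⟨F, hF⟩ := h.nonempty
  -- Unfolding avoids two vertices but only `w` needs protection, so `q` is an arbitrary further
  -- vertex; it is not singular.
  obtain ⟨q, hqF, hq⟩ := Finset.exists_mem_notMem_of_card_lt_card
    (show ({t, v, w} : Finset V).card < F.card by
      rw [h.card_eq F hF]; exact Finset.card_le_three.trans_lt (by omega))
  simp only [Finset.mem_insert, Finset.mem_singleton, not_or] at hq
  have hbq := hb q ⟨F, hF, hqF⟩ hq.1 hq.2.1 hq.2.2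
  obtain ⟨n, 𝓖, j, hj, hG, hfold, hvert, hbj, hbz⟩ := h.exists_unfolding hvt hb1 hwv hq.2.1 hq.1 hwt
    (Ne.symm hq.2.2) fun x hx h1 h2 h3 _ => hb x hx h1 h2 h3
  have hjwt : j w ≠ j t := hj.ne hwt
  have hjw : bettiAt 𝓖 (j t) (j w) ≠ 0 := by
    rw [hbj w hw (Or.inl rfl)]; exact hbw
  refine ⟨n, ofFacets 𝓖, hG.isG₂MinimalNormal3, ?_, hfold⟩
  have hS : {x | (ofFacets 𝓖).IsSingular x} = {j t, j w} := by
    ext z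
    simp only [Set.mem_ofPred_eq, Set.mem_insert_iff, Set.mem_singleton_iff]
    constructor
    · intro hz
      by_contra hn
      rw [not_or] at hn
      obtain ⟨hz1, hz2⟩ := (hG.isSingular_iff hn.1).1 hz
      obtain ⟨y, hy, rfl | rfl, rfl⟩ := (hbz z hz1 hn.1).resolve_left hz2
      · exact hn.2 rfl
      · exact hz2 ((hbj y hy (Or.inr rfl)).trans hbq)
    · rintro (rfl | rfl)
      · exact hG.isSingular_t hjwt (hvert w hw) hjw
      · exact (hG.isSingular_iff hjwt).2 ⟨hvert w hw, hjw⟩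
  rw [hS, Set.ncard_pair hjwt.symm]

end IsConedNormal

end Conversion

/-! ### The two cases of the theorem. -/

theorem mainTheorem3 {V : Type*} [Fintype V] (Δ : PreAbstractSimplicialComplex V)
    (hΔ : Δ.IsG₂MinimalNormal3) (t : V) (ht : Δ.IsSingular t)
    (hgraph : Δ.graphFaces = (Δ.star {t}).graphFaces) :
    ({v | Δ.IsSingular v}.ncard = 3 → (∃ v, Δ.HasRP2Singularity v) →
      ∃ (n : ℕ) (Δ' : PreAbstractSimplicialComplex (Fin n)),
        Δ'.IsG₂MinimalNormal3 ∧ {v | Δ'.IsSingular v}.ncard = 2 ∧ Δ'.IsEdgeFolding Δ) ∧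
    ({v | Δ.IsSingular v}.ncard = 4 →
      (∃ v w, v ≠ w ∧ Δ.HasRP2Singularity v ∧ Δ.HasRP2Singularity w) →
      ∃ (n m : ℕ) (Δ' : PreAbstractSimplicialComplex (Fin n))
        (Δ'' : PreAbstractSimplicialComplex (Fin m)),
        Δ'.IsG₂MinimalNormal3 ∧ {v | Δ'.IsSingular v}.ncard = 2 ∧
        Δ'.IsEdgeFolding Δ'' ∧ Δ''.IsEdgeFolding Δ) := by
  obtain ⟨𝓕, h, rfl⟩ : ∃ 𝓕, IsConedNormal 𝓕 t ∧ Δ = ofFacets 𝓕 :=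
    ⟨_, hΔ.1.isConedNormal ht.1 hgraph, Δ.eq_ofFacets⟩
  set S := {v | (ofFacets 𝓕).IsSingular v} with hSdef
  have htS : t ∈ S := ht
  have hsing : ∀ {x}, x ≠ t → (x ∈ S ↔ (∃ F ∈ 𝓕, x ∈ F) ∧ bettiAt 𝓕 t x ≠ 0) :=
    fun hx => h.isSingular_iff hx
  have hone : ∀ {x}, x ≠ t → x ∈ S → bettiAt 𝓕 t x ≤ 1 → bettiAt 𝓕 t x = 1 := by
    intro x hx hxS hle
    have := ((hsing hx).1 hxS).2
    omega
  -- An `ℝP²` link at `x ≠ t` gives the value 1 at `x`. At `t` it bounds the values at all other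
  -- vertices by 1, and singular ones have nonzero value.
  have hRP : ∀ {x}, (ofFacets 𝓕).HasRP2Singularity x →
      (x = t → ∀ y ∈ S, y ≠ t → bettiAt 𝓕 t y = 1) ∧ (x ≠ t → bettiAt 𝓕 t x = 1) := by
    rintro x ⟨hx, ⟨e⟩⟩
    refine ⟨?_, fun hxt => hone hxt hx (h.bettiAt_le_one_of_homeomorph hxt e)⟩
    rintro rfl y hy hyt
    exact hone hyt hy (h.bettiAt_le_one_of_link_RP2 hyt ((hsing hyt).1 hy).1 e)
  have hzero : ∀ {x}, (∃ F ∈ 𝓕, x ∈ F) → x ≠ t → x ∉ S → bettiAt 𝓕 t x = 0 := by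
    intro x hx hxt hxS
    by_contra hn
    exact hxS ((hsing hxt).2 ⟨hx, hn⟩)
  constructor
  · rintro hS ⟨r, hr⟩
    obtain ⟨v, hv, hvt, hb⟩ : ∃ v ∈ S, v ≠ t ∧ bettiAt 𝓕 t v = 1 := by
      by_cases hrt : r = t
      · obtain ⟨v, hv, hvt⟩ := Set.exists_ne_of_one_lt_ncard (by omega : 1 < S.ncard) t
        exact ⟨v, hv, hvt, (hRP hr).1 hrt v hv hvt⟩
      · exact ⟨r, hr.1, hrt, (hRP hr).2 hrt⟩
    have hcard : (S \ {t, v}).ncard = 1 := by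
      rw [Set.ncard_sdiff (Set.insert_subset htS (Set.singleton_subset_iff.2 hv)), hS,
        Set.ncard_pair hvt.symm]
    obtain ⟨w, hw⟩ := Set.ncard_eq_one.1 hcard
    have hwm : w ∈ S \ {t, v} := by rw [hw]; rfl
    obtain ⟨hwS, hwn⟩ := hwm
    simp only [Set.mem_insert_iff, Set.mem_singleton_iff, not_or] at hwn
    obtain ⟨hwF, hbw⟩ := (hsing hwn.1).1 hwS
    refine h.exists_unfolding_two_singular hvt hwn.1 hwn.2 hb hwF hbw fun x hx h1 h2 h3 =>
      hzero hx h1 fun hxS => h3 ?_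
    have : x ∈ S \ {t, v} := ⟨hxS, by simp [h1, h2]⟩
    rw [hw] at this
    exact this
  · rintro hS ⟨r, r', hrr, hr, hr'⟩
    -- If `t` is one of the two given vertices, then all three other singular vertices have value 1;
    -- otherwise the given vertices serve.
    obtain ⟨v, v', hv, hv', hvt, hvt', hvv, hb, hb'⟩ : ∃ v v', v ∈ S ∧ v' ∈ S ∧ v ≠ t ∧ v' ≠ t ∧
        v ≠ v' ∧ bettiAt 𝓕 t v = 1 ∧ bettiAt 𝓕 t v' = 1 := by
      by_cases hrt : r = t ∨ r' = t
      · have hall : ∀ y ∈ S, y ≠ t → bettiAt 𝓕 t y = 1 :=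
          hrt.elim (hRP hr).1 (hRP hr').1
        have hcard : 1 < (S \ {t}).ncard := by
          rw [Set.ncard_sdiff_singleton_of_mem htS]
          omega
        obtain ⟨v, v', hv, hv', hvv⟩ := (Set.one_lt_ncard_iff (Set.toFinite _)).1 hcard
        exact ⟨v, v', hv.1, hv'.1, hv.2, hv'.2, hvv, hall v hv.1 hv.2, hall v' hv'.1 hv'.2⟩
      · rw [not_or] at hrt
        exact ⟨r, r', hr.1, hr'.1, hrt.1, hrt.2, hrr, (hRP hr).2 hrt.1, (hRP hr').2 hrt.2⟩
    have hcard : (S \ {t, v, v'}).ncard = 1 := by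
      rw [Set.ncard_sdiff (Set.insert_subset htS (Set.insert_subset hv
        (Set.singleton_subset_iff.2 hv'))), hS, Set.ncard_eq_three.2
          ⟨t, v, v', hvt.symm, hvt'.symm, hvv, rfl⟩]
    obtain ⟨w, hw⟩ := Set.ncard_eq_one.1 hcard
    have hwm : w ∈ S \ {t, v, v'} := by rw [hw]; rfl
    obtain ⟨hwS, hwn⟩ := hwm
    simp only [Set.mem_insert_iff, Set.mem_singleton_iff, not_or] at hwn
    obtain ⟨hwF, hbw⟩ := (hsing hwn.1).1 hwS
    obtain ⟨hvF', -⟩ := (hsing hvt').1 hv'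
    -- Unfolding at `v` keeps the values at `v'` and `w` and creates no new singular vertex. The
    -- second unfolding takes place at the image of `v'`.
    obtain ⟨m, 𝓖, j, hj, hG, hfold, hvert, hbj, hbz⟩ := h.exists_unfolding hvt hb hvv.symm hwn.2.1
      hwn.1 hvt' (Ne.symm hwn.2.2) fun x hx h1 h2 h3 h4 => hzero hx h1 fun hxS => h4 (by
        have : x ∈ S \ {t, v, v'} := ⟨hxS, by simp [h1, h2, h3]⟩
        rw [hw] at this
        exact this)
    obtain ⟨n, Δ', h1, h2, h3⟩ := hG.exists_unfolding_two_singular (hj.ne hvt') (hj.ne hwn.1)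
      (hj.ne hwn.2.2) ((hbj v' hvF' (Or.inl rfl)).trans hb') (hvert w hwF)
      (by rw [hbj w hwF (Or.inr rfl)]; exact hbw) (by
        intro z hz h1 h2 h3
        refine (hbz z hz h1).resolve_right ?_
        rintro ⟨y, -, rfl | rfl, rfl⟩
        · exact h2 rfl
        · exact h3 rfl)
    exact ⟨n, m, Δ', ofFacets 𝓖, h1, h2, h3, hfold⟩
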